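/- **Setting.** Let $X$ be a compact complex manifold of dimension $n$ with a Kähler form $\omega$. Put $\omega_\phi=\omega+i\partial\bar\partial\phi$ and let $\mathcal H_\omega=\{\phi\in C^\infty(X,\mathbb R):\omega_\phi>0\}$, an open subset of the Fréchet space $C^\infty(X,\mathbb R)$, so that $T_\phi\mathcal H_\omega=C^\infty(X,\mathbb R)$. Let $g_M(\xi,\eta)=\int_X\xi\eta\,\omega_\phi^n$ be the Mabuchi metric on $\mathcal H_\omega$. Let $\{\cdot,\cdot\}_{\omega_\phi}$ be the Poisson bracket of the symplectic form $\omega_\phi$, with the sign for which $\{\xi_1,\xi_2\}_{\omega_\phi}\omega_\phi^n=n\,d\xi_1\wedge d\xi_2\wedge\omega_\phi^{n-1}$, extended complex bilinearly to complex functions. Define the three-form $$\theta(\xi_1,\xi_2,\xi_3)=g_M(\{\xi_1,\xi_2\}_{\omega_\phi},\xi_3)=\int_X\{\xi_1,\xi_2\}_{\omega_\phi}\,\xi_3\,\omega_\phi^n .$$ Let $\alpha$ be a two-form of class $C^1$ on $\mathcal H_\omega$ with $d\alpha=\theta$; that is, for constant vector fields, $\xi_1\alpha(\xi_2,\xi_3)-\xi_2\alpha(\xi_1,\xi_3)+\xi_3\alpha(\xi_1,\xi_2)=\theta(\xi_1,\xi_2,\xi_3)$.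 Extend $\alpha$ complex bilinearly to $\mathbb C\otimes T\mathcal H_\omega$. Let $D\subset\mathbb C^m$ be open, with coordinates $z_1,\dots,z_m$ and Euclidean volume $dV$. For a smooth map $\Phi:D\to\mathcal H_\omega$ (that is, $\Phi$ is smooth on $D\times X$ and $\Phi(z,\cdot)\in\mathcal H_\omega$ for every $z\in D$), let $|\Phi_*|$ be the Hilbert–Schmidt norm of the differential of $\Phi$ with respect to the Euclidean metric of $D$ and $g_M$, and let $$\mathscr E(\Phi)=\int_D|\Phi_*|^2\,dV+4i\sum_{j=1}^m\int_D\alpha(\Phi_{\bar z_j},\Phi_{z_j})\,dV .$$ **Lemma (Euler–Lagrange equation).** Let $\Phi:D\to\mathcal H_\omega$ be smooth and such that the integrals defining $\mathscr E(\Phi)$ converge absolutely. Then $\Phi$ is a critical point of $\mathscr E$, meaning that for every smooth $\Psi:D\to C^\infty(X,\mathbb R)$ with compact support in $D$ the derivative $\frac{d}{dt}\big|_{t=0}\mathscr E(\Phi+t\Psi)$ exists and is $0$, if and only if $\Phi$ satisfies the WZW equation $$\sum_{j=1}^m\Big(|\nabla\Phi_{z_j}|^2-2\Phi_{z_j\bar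 z_j}+i\{\Phi_{\bar z_j},\Phi_{z_j}\}_{\omega_\Phi}\Big)=0\qquad\text{on } D\times X .$$ Here the gradient and its norm are those of the Riemannian metric $\omega_\Phi(\cdot,J\cdot)$, and $|\nabla f|^2=|\nabla\operatorname{Re}f|^2+|\nabla\operatorname{Im}f|^2$ for a complex function $f$. -/

import Mathlib

open scoped Manifold ContDiff

/-- A complex manifold (a manifold modelled on `ℂⁿ` with holomorphic transition maps) is a smooth
real manifold, with the same charts. -/
instance complexManifold_isManifold_real (n : ℕ) (X : Type*) [TopologicalSpace X]
    [ChartedSpace (Fin n → ℂ) X] [IsManifold 𝓘(ℂ, Fin n → ℂ) ω X] :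
    IsManifold 𝓘(ℝ, Fin n → ℂ) ∞ X := by
  refine isManifold_of_contDiffOn _ _ _ fun e e' he he' => ?_
  have h := (contDiffGroupoid ω 𝓘(ℂ, Fin n → ℂ)).compatible he he'
  rw [contDiffGroupoid, mem_groupoid_of_pregroupoid] at h
  have h1 : ContDiffOn ℂ ω _ _ := h.1
  exact (h1.restrict_scalars ℝ).of_le le_top

noncomputable section

namespace WZW

/-! ### Pointwise linear algebra of a positive real `(1,1)`-form

All forms below are real bilinear forms on `ℂⁿ`.  As everywhere in Mathlib, the tangent space
`T_xX` is identified with the model space `ℂⁿ` through the preferred chart `chartAt _ x`; as the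
charts are holomorphic, the complex structure of `T_xX` is multiplication by `i` on `ℂⁿ`. -/

/-- Real bilinear forms on `ℂⁿ`. -/
abbrev BForm (n : ℕ) : Type := (Fin n → ℂ) →L[ℝ] (Fin n → ℂ) →L[ℝ] ℝ

/-- Multiplication by `i` on `ℂⁿ`. -/
def cplxJ (n : ℕ) : (Fin n → ℂ) →L[ℝ] (Fin n → ℂ) :=
  (ContinuousLinearMap.lsmul ℝ ℂ : ℂ →L[ℝ] (Fin n → ℂ) →L[ℝ] (Fin n → ℂ)) Complex.I

/-- The symmetric form `g(u, v) = η(u, i v)` associated with a `(1,1)`-form `η`. -/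
def metricOf {n : ℕ} (η : BForm n) : BForm n :=
  η.bilinearComp (ContinuousLinearMap.id ℝ _) (cplxJ n)

/-- `|∇f|²` at a point, where `a` is the differential of the real function `f` at this point, and
the gradient is the vector `∇f` with `g(∇f, ·) = a`, for the metric `g` of `η`. -/
def gradSqR {n : ℕ} (η : BForm n) (a : (Fin n → ℂ) →L[ℝ] ℝ) : ℝ :=
  metricOf η ((metricOf η).inverse a) ((metricOf η).inverse a)

/-- The Poisson bracket at a point of two real functions with differentials `a`, `b`:
`η(X_a, X_b)`, where the Hamiltonian vector `X_a` is determined by `η(X_a, ·) = a`.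
For `η = dx ∧ dy` this is `a_x b_y - a_y b_x`. -/
def bracketR {n : ℕ} (η : BForm n) (a b : (Fin n → ℂ) →L[ℝ] ℝ) : ℝ :=
  η (η.inverse a) (η.inverse b)

/-- The Hermitian matrix `h` with `η = (i/2) ∑ h_{kl} dz_k ∧ dz̄_l`. -/
def hermMatrix {n : ℕ} (η : BForm n) : Matrix (Fin n) (Fin n) ℂ :=
  Matrix.of fun k l =>
    (η (Pi.single k 1) (Pi.single l Complex.I) : ℂ)
      - Complex.I * (η (Pi.single k 1) (Pi.single l 1) : ℂ)

/-- The density of `ηⁿ = η ∧ ⋯ ∧ η` with respect to Lebesgue measure on `ℂⁿ`: since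
`η = (i/2) ∑ h_{kl} dz_k ∧ dz̄_l`, one has
`ηⁿ = n! det h · (i/2)dz_1 ∧ dz̄_1 ∧ ⋯ ∧ (i/2)dz_n ∧ dz̄_n`. -/
def topPower {n : ℕ} (η : BForm n) : ℝ :=
  (n.factorial : ℝ) * (hermMatrix η).det.re

/-! ### Forms and functions on the manifold -/

section Manifold

variable {n : ℕ} {X : Type*} [TopologicalSpace X] [ChartedSpace (Fin n → ℂ) X]

variable (n X) in
/-- `C^∞(X, ℝ)`. -/
abbrev Smooth : Type _ := ContMDiffMap 𝓘(ℝ, Fin n → ℂ) 𝓘(ℝ, ℝ) X ℝ ∞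

/-- The differential of a real function, as a covector on `T_xX = ℂⁿ`. -/
def dAt (n : ℕ) {X : Type*} [TopologicalSpace X] [ChartedSpace (Fin n → ℂ) X]
    (f : X → ℝ) (x : X) : (Fin n → ℂ) →L[ℝ] ℝ :=
  mfderiv 𝓘(ℝ, Fin n → ℂ) 𝓘(ℝ, ℝ) f x

/-- The expression of a field of bilinear forms in the chart `e = chartAt p`, that is, its
pull-back by `e⁻¹`, at the point `y` of the target of `e`. -/
def inChart (η : X → BForm n) (p : X) (y : Fin n → ℂ) : BForm n :=
  (η ((chartAt (Fin n → ℂ) p).symm y)).bilinearComp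
    (mfderiv 𝓘(ℝ, Fin n → ℂ) 𝓘(ℝ, Fin n → ℂ) (chartAt (Fin n → ℂ) p).symm y)
    (mfderiv 𝓘(ℝ, Fin n → ℂ) 𝓘(ℝ, Fin n → ℂ) (chartAt (Fin n → ℂ) p).symm y)

/-- `i∂∂̄φ`, computed at `x` in the holomorphic chart `chartAt x`:
`i∂∂̄φ(u, v) = (D²φ(v, i u) - D²φ(u, i v)) / 2`. -/
def iddbar (n : ℕ) {X : Type*} [TopologicalSpace X] [ChartedSpace (Fin n → ℂ) X]
    (φ : X → ℝ) (x : X) : BForm n :=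
  let B : BForm n := fderiv ℝ (fderiv ℝ (φ ∘ (chartAt (Fin n → ℂ) x).symm))
    (chartAt (Fin n → ℂ) x x)
  (1 / 2 : ℝ) • (B.flip.bilinearComp (cplxJ n) (ContinuousLinearMap.id ℝ _)
    - B.bilinearComp (ContinuousLinearMap.id ℝ _) (cplxJ n))

end Manifold

/-- A Kähler form on a complex manifold `X` of dimension `n`: a smooth closed positive real
`(1,1)`-form. -/
structure KahlerForm (n : ℕ) (X : Type*) [TopologicalSpace X] [ChartedSpace (Fin n → ℂ) X] where
  /-- the form, at each point, on the tangent space -/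
  form : X → BForm n
  alternating : ∀ x u, form x u u = 0
  type_one_one : ∀ x u v, form x (cplxJ n u) (cplxJ n v) = form x u v
  positive : ∀ x u, u ≠ 0 → 0 < form x u (cplxJ n u)
  smooth : ∀ p : X, ContDiffOn ℝ ∞ (inChart form p) (chartAt (Fin n → ℂ) p).target
  closed : ∀ p : X, ∀ y ∈ (chartAt (Fin n → ℂ) p).target, ∀ u v w : Fin n → ℂ,
    fderiv ℝ (inChart form p) y u v w + fderiv ℝ (inChart form p) y v w u
      + fderiv ℝ (inChart form p) y w u v = 0

section Potentials

variable {n : ℕ} {X : Type*} [TopologicalSpace X] [ChartedSpace (Fin n → ℂ) X]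

/-- `ω_φ = ω + i∂∂̄φ`. -/
def KahlerForm.perturb (K : KahlerForm n X) (φ : X → ℝ) : X → BForm n :=
  fun x => K.form x + iddbar n φ x

/-- The space of Kähler potentials `H_ω = {φ ∈ C^∞(X, ℝ) : ω + i∂∂̄φ > 0}`. -/
def KahlerForm.potentials (K : KahlerForm n X) : Set (Smooth n X) :=
  {φ | ∀ x u, u ≠ 0 → 0 < K.perturb φ x u (cplxJ n u)}

/-- `|∇f|²` for a complex function `f` and the Kähler metric of `ω_φ`:
`|∇f|² = |∇ Re f|² + |∇ Im f|²`. -/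
def KahlerForm.gradSq (K : KahlerForm n X) (φ : X → ℝ) (f : X → ℂ) (x : X) : ℝ :=
  gradSqR (K.perturb φ x) (dAt n (fun y => (f y).re) x)
    + gradSqR (K.perturb φ x) (dAt n (fun y => (f y).im) x)

/-- The Poisson bracket of two real functions for the symplectic form `ω_φ`. -/
def KahlerForm.bracket (K : KahlerForm n X) (φ : X → ℝ) (f g : X → ℝ) (x : X) : ℝ :=
  bracketR (K.perturb φ x) (dAt n f x) (dAt n g x)

/-- The complex bilinear extension of the Poisson bracket to complex functions. -/
def KahlerForm.bracketC (K : KahlerForm n X) (φ : X → ℝ) (f g : X → ℂ) (x : X) : ℂ :=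
  ((K.bracket φ (fun y => (f y).re) (fun y => (g y).re) x
      - K.bracket φ (fun y => (f y).im) (fun y => (g y).im) x : ℝ) : ℂ)
    + Complex.I * ((K.bracket φ (fun y => (f y).re) (fun y => (g y).im) x
      + K.bracket φ (fun y => (f y).im) (fun y => (g y).re) x : ℝ) : ℂ)

end Potentials

/-! ### Integration over `X` against `ω_φⁿ` -/

section Integration

variable {n : ℕ} {X : Type*} [TopologicalSpace X] [ChartedSpace (Fin n → ℂ) X]
  [IsManifold 𝓘(ℂ, Fin n → ℂ) ω X] [CompactSpace X] [T2Space X]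

variable (n X) in
/-- A smooth partition of unity on `X` subordinate to the cover by the domains of the charts. -/
def chartPartition : SmoothPartitionOfUnity X 𝓘(ℝ, Fin n → ℂ) X Set.univ :=
  Classical.choose
    (SmoothPartitionOfUnity.exists_isSubordinate_chartAt_source 𝓘(ℝ, Fin n → ℂ) X)

/-- `∫_X f ηⁿ`, through the partition of unity `chartPartition` and the charts. -/
def integralTop (η : X → BForm n) (f : X → ℝ) : ℝ :=
  ∑ᶠ p : X, ∫ y in (chartAt (Fin n → ℂ) p).target,
    chartPartition n X p ((chartAt (Fin n → ℂ) p).symm y)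
      * f ((chartAt (Fin n → ℂ) p).symm y) * topPower (inChart η p y)

/-- The Mabuchi metric `g_M(ξ, ζ) = ∫_X ξ ζ ω_φⁿ`. -/
def KahlerForm.mabuchi (K : KahlerForm n X) (φ : X → ℝ) (ξ ζ : X → ℝ) : ℝ :=
  integralTop (K.perturb φ) (fun x => ξ x * ζ x)

/-- The three-form `θ(ξ₁, ξ₂, ξ₃) = g_M({ξ₁, ξ₂}, ξ₃)` on `H_ω`. -/
def KahlerForm.theta (K : KahlerForm n X) (φ ξ₁ ξ₂ ξ₃ : Smooth n X) : ℝ :=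
  K.mabuchi φ (K.bracket φ ξ₁ ξ₂) ξ₃

end Integration

/-! ### Two-forms on `H_ω` -/

section TwoForms

variable {n : ℕ} {X : Type*} [TopologicalSpace X] [ChartedSpace (Fin n → ℂ) X]

/-- The `k`-th derivative of a smooth function, read in the chart at `p`, as a continuous map on
the target of the chart. -/
def chartDeriv [IsManifold 𝓘(ℝ, Fin n → ℂ) ∞ X] (p : X) (k : ℕ) (f : Smooth n X) :
    C((chartAt (Fin n → ℂ) p).target, (Fin n → ℂ) [×k]→L[ℝ] ℝ) where
  toFun y := iteratedFDeriv ℝ k (f ∘ (chartAt (Fin n → ℂ) p).symm) y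
  continuous_toFun := by
    have h : ContDiffOn ℝ ∞ (f ∘ (chartAt (Fin n → ℂ) p).symm)
        (chartAt (Fin n → ℂ) p).target :=
      contMDiffOn_iff_contDiffOn.1
        (f.contMDiff.comp_contMDiffOn (contMDiffOn_chart_symm (I := 𝓘(ℝ, Fin n → ℂ))))
    have ho := (chartAt (Fin n → ℂ) p).open_target
    have h2 := (h.continuousOn_iteratedFDerivWithin (m := k) (by exact_mod_cast le_top)
      ho.uniqueDiffOn).congr
      (fun y hy => (iteratedFDerivWithin_of_isOpen k ho hy).symm)
    exact h2.domRestrict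

/-- The Fréchet topology of `C^∞(X, ℝ)`: locally uniform convergence, in the charts, of all
derivatives. -/
instance smoothTopology [IsManifold 𝓘(ℝ, Fin n → ℂ) ∞ X] : TopologicalSpace (Smooth n X) :=
  ⨅ (p : X) (k : ℕ), TopologicalSpace.induced (chartDeriv p k) inferInstance

variable (n X) in
/-- A field of bilinear forms on the trivial bundle `C^∞(X) × C^∞(X) → C^∞(X)`. -/
abbrev FormField : Type _ :=
  Smooth n X → Smooth n X →ₗ[ℝ] Smooth n X →ₗ[ℝ] ℝ

/-- The derivative at `φ`, in the direction `v`, of the function `α(ξ, ζ)`, where `ξ`, `ζ` are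
regarded as constant vector fields. -/
def dirDeriv (α : FormField n X) (φ v ξ ζ : Smooth n X) : ℝ :=
  deriv (fun t : ℝ => α (φ + t • v) ξ ζ) 0

/-- `α` is a two-form of class `C¹` on the open subset `H_ω` of the Fréchet space `C^∞(X, ℝ)`
(the values of `α` outside `H_ω` are irrelevant). -/
structure IsTwoForm [IsManifold 𝓘(ℝ, Fin n → ℂ) ∞ X] (K : KahlerForm n X) (α : FormField n X) :
    Prop where
  alternating : ∀ φ ∈ K.potentials, ∀ ξ, α φ ξ ξ = 0
  continuousOn : ContinuousOn
    (fun q : Smooth n X × Smooth n X × Smooth n X => α q.1 q.2.1 q.2.2)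
    {q | q.1 ∈ K.potentials}
  differentiable : ∀ φ ∈ K.potentials, ∀ v ξ ζ,
    DifferentiableAt ℝ (fun t : ℝ => α (φ + t • v) ξ ζ) 0
  continuousOn_deriv : ContinuousOn
    (fun q : Smooth n X × Smooth n X × Smooth n X × Smooth n X =>
      dirDeriv α q.1 q.2.1 q.2.2.1 q.2.2.2)
    {q | q.1 ∈ K.potentials}

/-- The exterior derivative of a two-form on `H_ω`, evaluated on constant vector fields:
`dα(ξ₁, ξ₂, ξ₃) = ξ₁ α(ξ₂, ξ₃) - ξ₂ α(ξ₁, ξ₃) + ξ₃ α(ξ₁, ξ₂)`. -/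
def extD (α : FormField n X) (φ ξ₁ ξ₂ ξ₃ : Smooth n X) : ℝ :=
  dirDeriv α φ ξ₁ ξ₂ ξ₃ - dirDeriv α φ ξ₂ ξ₁ ξ₃ + dirDeriv α φ ξ₃ ξ₁ ξ₂

open Classical in
/-- A function on `X` that is smooth, as an element of `C^∞(X, ℝ)` (zero if it is not smooth). -/
def toSmooth (n : ℕ) {X : Type*} [TopologicalSpace X] [ChartedSpace (Fin n → ℂ) X]
    (f : X → ℝ) : Smooth n X :=
  if h : ContMDiff 𝓘(ℝ, Fin n → ℂ) 𝓘(ℝ, ℝ) ∞ f then ⟨f, h⟩ else 0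

/-- The complex bilinear extension of `α_φ` to `ℂ ⊗ T_φ H_ω = C^∞(X, ℂ)`. -/
def evalC (α : FormField n X) (φ : Smooth n X) (ξ ζ : X → ℂ) : ℂ :=
  ((α φ (toSmooth n fun x => (ξ x).re) (toSmooth n fun x => (ζ x).re)
      - α φ (toSmooth n fun x => (ξ x).im) (toSmooth n fun x => (ζ x).im) : ℝ) : ℂ)
    + Complex.I * ((α φ (toSmooth n fun x => (ξ x).re) (toSmooth n fun x => (ζ x).im)
      + α φ (toSmooth n fun x => (ξ x).im) (toSmooth n fun x => (ζ x).re) : ℝ) : ℂ)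

end TwoForms

/-! ### Maps from a domain of `ℂᵐ` to `H_ω` -/

section Maps

variable {m n : ℕ} {X : Type*} [TopologicalSpace X] [ChartedSpace (Fin n → ℂ) X]

/-- `∂F/∂z_j = (∂F/∂x_j - i ∂F/∂y_j) / 2`, where `z_j = x_j + i y_j`. -/
def dz (j : Fin m) (F : (Fin m → ℂ) → ℂ) (z : Fin m → ℂ) : ℂ :=
  (fderiv ℝ F z (Pi.single j 1) - Complex.I * fderiv ℝ F z (Pi.single j Complex.I)) / 2

/-- `∂F/∂z̄_j = (∂F/∂x_j + i ∂F/∂y_j) / 2`. -/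
def dzbar (j : Fin m) (F : (Fin m → ℂ) → ℂ) (z : Fin m → ℂ) : ℂ :=
  (fderiv ℝ F z (Pi.single j 1) + Complex.I * fderiv ℝ F z (Pi.single j Complex.I)) / 2

/-- The real directional derivative of `Φ` at `z` along `v`, a function on `X`. -/
def realDeriv (Φ : (Fin m → ℂ) → Smooth n X) (v z : Fin m → ℂ) : X → ℝ :=
  fun x => fderiv ℝ (fun w => Φ w x) z v

/-- `Φ_{z_j}` at `z`, a complex function on `X`. -/
def Dz (Φ : (Fin m → ℂ) → Smooth n X) (j : Fin m) (z : Fin m → ℂ) : X → ℂ :=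
  fun x => dz j (fun w => (Φ w x : ℂ)) z

/-- `Φ_{z̄_j}` at `z`, a complex function on `X`. -/
def Dzbar (Φ : (Fin m → ℂ) → Smooth n X) (j : Fin m) (z : Fin m → ℂ) : X → ℂ :=
  fun x => dzbar j (fun w => (Φ w x : ℂ)) z

/-- `Φ_{z_j z̄_j}` at `z`, a complex function on `X`. -/
def DzDzbar (Φ : (Fin m → ℂ) → Smooth n X) (j : Fin m) (z : Fin m → ℂ) : X → ℂ :=
  fun x => dzbar j (dz j (fun w => (Φ w x : ℂ))) z

/-- `Φ` is a smooth map from `D` to `C^∞(X, ℝ)`, that is, smooth as a function on `D × X`. -/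
def SmoothInto (D : Set (Fin m → ℂ)) (Φ : (Fin m → ℂ) → Smooth n X) : Prop :=
  ContMDiffOn (𝓘(ℝ, Fin m → ℂ).prod 𝓘(ℝ, Fin n → ℂ)) 𝓘(ℝ, ℝ) ∞
    (fun q : (Fin m → ℂ) × X => Φ q.1 q.2) (D ×ˢ Set.univ)

/-- `Ψ` is a smooth map from `D` to `C^∞(X, ℝ)` with compact support in `D` (extended by zero). -/
def IsVariation (D : Set (Fin m → ℂ)) (Ψ : (Fin m → ℂ) → Smooth n X) : Prop :=
  SmoothInto Set.univ Ψ ∧ ∃ C ⊆ D, IsCompact C ∧ ∀ z ∉ C, Ψ z = 0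

variable [IsManifold 𝓘(ℂ, Fin n → ℂ) ω X] [CompactSpace X] [T2Space X]

/-- `|Φ_*|²` at `z`: the squared Hilbert–Schmidt norm of the differential of `Φ`, for the
Euclidean metric of `ℂᵐ = ℝ²ᵐ` and the Mabuchi metric. -/
def KahlerForm.energyDensity (K : KahlerForm n X) (Φ : (Fin m → ℂ) → Smooth n X)
    (z : Fin m → ℂ) : ℝ :=
  ∑ j : Fin m,
    (K.mabuchi (Φ z) (realDeriv Φ (Pi.single j 1) z) (realDeriv Φ (Pi.single j 1) z)
      + K.mabuchi (Φ z) (realDeriv Φ (Pi.single j Complex.I) z)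
          (realDeriv Φ (Pi.single j Complex.I) z))

/-- The perturbed energy `𝓔(Φ) = ∫_D |Φ_*|² dV + 4i ∑_j ∫_D α(Φ_{z̄_j}, Φ_{z_j}) dV`. -/
def KahlerForm.perturbedEnergy (K : KahlerForm n X) (α : FormField n X) (D : Set (Fin m → ℂ))
    (Φ : (Fin m → ℂ) → Smooth n X) : ℂ :=
  ((∫ z in D, K.energyDensity Φ z : ℝ) : ℂ)
    + 4 * Complex.I * ∑ j : Fin m, ∫ z in D, evalC α (Φ z) (Dzbar Φ j z) (Dz Φ j z)

/-- The integrals defining `𝓔(Φ)` converge. -/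
def KahlerForm.EnergyDefined (K : KahlerForm n X) (α : FormField n X) (D : Set (Fin m → ℂ))
    (Φ : (Fin m → ℂ) → Smooth n X) : Prop :=
  MeasureTheory.IntegrableOn (K.energyDensity Φ) D ∧
    ∀ j : Fin m, MeasureTheory.IntegrableOn
      (fun z => evalC α (Φ z) (Dzbar Φ j z) (Dz Φ j z)) D

/-- `Φ` is a critical point of `𝓔`: the derivative of `𝓔(Φ + tΨ)` at `t = 0` exists and vanishes
for every compactly supported smooth `Ψ : D → C^∞(X, ℝ)`. -/
def KahlerForm.IsCritical (K : KahlerForm n X) (α : FormField n X) (D : Set (Fin m → ℂ))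
    (Φ : (Fin m → ℂ) → Smooth n X) : Prop :=
  ∀ Ψ : (Fin m → ℂ) → Smooth n X, IsVariation D Ψ →
    HasDerivAt (fun t : ℝ => K.perturbedEnergy α D (fun z => Φ z + t • Ψ z)) 0 0

/-- The left-hand side of the WZW equation at `(z, x)`. -/
def KahlerForm.wzw (K : KahlerForm n X) (Φ : (Fin m → ℂ) → Smooth n X) (z : Fin m → ℂ) (x : X) :
    ℂ :=
  ∑ j : Fin m, ((K.gradSq (Φ z) (Dz Φ j z) x : ℂ) - 2 * DzDzbar Φ j z x
    + Complex.I * K.bracketC (Φ z) (Dzbar Φ j z) (Dz Φ j z) x)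

end Maps

end WZW

end

noncomputable section

namespace WZW

/-! ### Pointwise linear algebra -/

/-! Everything becomes real once each complex direction is split as z_j = x_j + i y_j. Write u, v
for the x_j- and y_j-directions. Then 4i α(Φ_z̄, Φ_z) = 2 α(Φ_u, Φ_v), so the energy is the integral
over D of the real function Σ_j (g_M(Φ_u, Φ_u) + g_M(Φ_v, Φ_v) + 2 α(Φ_u, Φ_v))
(`perturbedEnergy_eq`). The left side of the WZW equation is a quarter of Σ_j EL_j, where EL_j =
|∇Φ_u|² + |∇Φ_v|² - 2(Φ_uu + Φ_vv) + 2{Φ_u, Φ_v} (`wzw_eq`).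

The heart is a formula pointwise in z, `lineDeriv_density`. Regard Φ + tΨ as a family with parameter
(z, t), let τ be the t-direction and ψ = Φ_τ. The τ-derivative of the j-th density equals ∂_u J +
∂_v J' + ∫_X ψ EL_j ω_Φⁿ, with currents J = 2 g_M(Φ_u, ψ) + 2 α(ψ, Φ_v) and J' = 2 g_M(Φ_v, ψ) + 2
α(Φ_u, ψ). For the metric terms, ω_φⁿ varies by the Laplacian of the variation
(`SmoothFam.fderiv_topPower`), and Green's formula `integral_gradDot` moves that Laplacian off ψ
(`integral_lap_sub`). For the terms with α, the three derivatives of α assemble into dα(ψ, Φ_u, Φ_v)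
= θ(ψ, Φ_u, Φ_v), which is ∫_X ψ {Φ_u, Φ_v} ω_Φⁿ because Poisson brackets have integral zero
(`integral_bracket`, `KahlerForm.theta_eq`). Both integrations by parts on X come from one
divergence computation in a chart, `trace_hamiltonian_field`, where the derivatives of the form
cancel because ω_φ is closed.

The currents vanish wherever Ψ does, so integrating over D leaves the first variation ∫_D ∫_X Ψ Σ_j
EL_j ω_Φⁿ (`hasDerivAt_perturbedEnergy`). It is zero if the equation holds. Conversely, Ψ = χ Σ_j
EL_j with a bump function χ forces Σ_j EL_j = 0 (`eq_zero_of_forall_variation`).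

Two analytic points need care. The form α is C¹ only through directional derivatives on a Fréchet
space, so the chain rule along a smooth family, `IsTwoForm.hasLineDerivAt_along`, is proved with the
mean value theorem on segments, H_ω being convex. Integrals over X are defined through a partition
of unity, so their independence of the chart comes from the change of variables formula
(`setIntegral_chart_eq`). -/

theorem hasDerivAt_line {F : Type*} [NormedAddCommGroup F] [NormedSpace ℝ F] {f : F → ℝ} {x : F}
    (h : DifferentiableAt ℝ f x) (v : F) :
    HasDerivAt (fun t : ℝ => f (x + t • v)) (fderiv ℝ f x v) 0 :=
  h.hasFDerivAt.hasLineDerivAt v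

section Linear

variable {n : ℕ}

@[simp] theorem cplxJ_apply (u : Fin n → ℂ) : cplxJ n u = Complex.I • u := rfl

theorem metricOf_apply (η : BForm n) (u v : Fin n → ℂ) :
    metricOf η u v = η u (Complex.I • v) := rfl

theorem I_smul_I_smul (u : Fin n → ℂ) : Complex.I • Complex.I • u = -u := by
  rw [smul_smul, Complex.I_mul_I, neg_one_smul]

/-- Alternating real `(1,1)`-forms on `ℂⁿ`. -/
structure IsOneOne (η : BForm n) : Prop where
  alternating : ∀ u, η u u = 0
  type_one_one : ∀ u v, η (Complex.I • u) (Complex.I • v) = η u v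

/-- Positive real `(1,1)`-forms on `ℂⁿ`. -/
structure IsPositive (η : BForm n) : Prop extends IsOneOne η where
  positive : ∀ u, u ≠ 0 → 0 < η u (Complex.I • u)

theorem IsOneOne.swap {η : BForm n} (h : IsOneOne η) (u v : Fin n → ℂ) : η u v = -η v u := by
  have := h.alternating (u + v)
  simp only [map_add, _root_.add_apply, h.alternating] at this
  linarith

theorem IsOneOne.I_left {η : BForm n} (h : IsOneOne η) (u v : Fin n → ℂ) :
    η (Complex.I • u) v = -η u (Complex.I • v) := by
  have := h.type_one_one u (Complex.I • v)
  rw [I_smul_I_smul, map_neg] at this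
  linarith

theorem IsOneOne.add {η β : BForm n} (h : IsOneOne η) (h' : IsOneOne β) : IsOneOne (η + β) :=
  ⟨fun u => by simp [h.alternating, h'.alternating],
    fun u v => by simp [h.type_one_one, h'.type_one_one]⟩

theorem IsOneOne.smul {η : BForm n} (h : IsOneOne η) (c : ℝ) : IsOneOne (c • η) :=
  ⟨fun u => by simp [h.alternating], fun u v => by simp [h.type_one_one]⟩

/-- Positivity gives injectivity, and the dimensions agree. Since `ContinuousLinearMap.inverse` is
zero by convention on non-invertible maps, this is what gives every later use of `η.inverse` its
meaning. -/
theorem IsPositive.exists_equiv {η : BForm n} (h : IsPositive η) :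
    ∃ e : (Fin n → ℂ) ≃L[ℝ] ((Fin n → ℂ) →L[ℝ] ℝ), (e : BForm n) = η := by
  have hinj : Function.Injective η.toLinearMap := by
    rw [← LinearMap.ker_eq_bot, LinearMap.ker_eq_bot']
    intro u hu
    by_contra hne
    have := h.positive u hne
    have h0 : η u = 0 := hu
    simp [h0] at this
  have hdim : Module.finrank ℝ (Fin n → ℂ) = Module.finrank ℝ ((Fin n → ℂ) →L[ℝ] ℝ) := by
    rw [← (LinearMap.toContinuousLinearMap (𝕜 := ℝ) (E := Fin n → ℂ) (F' := ℝ)).finrank_eq]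
    exact (Subspace.dual_finrank_eq (K := ℝ) (V := Fin n → ℂ)).symm
  refine ⟨(LinearEquiv.ofInjectiveOfFinrankEq η.toLinearMap hinj hdim).toContinuousLinearEquiv, ?_⟩
  ext u v
  rfl

theorem IsPositive.inverse_apply {η : BForm n} (h : IsPositive η) (u : Fin n → ℂ) :
    η.inverse (η u) = u := by
  obtain ⟨e, rfl⟩ := h.exists_equiv
  simp

theorem IsPositive.apply_inverse {η : BForm n} (h : IsPositive η) (a : (Fin n → ℂ) →L[ℝ] ℝ) :
    η (η.inverse a) = a := by
  obtain ⟨e, rfl⟩ := h.exists_equiv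
  simp

theorem IsPositive.inverse_unique {η : BForm n} (h : IsPositive η) {a : (Fin n → ℂ) →L[ℝ] ℝ}
    {u : Fin n → ℂ} (hu : ∀ v, η u v = a v) : η.inverse a = u := by
  have : η u = a := ContinuousLinearMap.ext hu
  rw [← this, h.inverse_apply]

/-- The pairing of two covectors for the metric of `η`. -/
def dotR (η : BForm n) (a b : (Fin n → ℂ) →L[ℝ] ℝ) : ℝ := a (η.inverse (-(b.comp (cplxJ n))))

theorem IsPositive.metricOf_inverse {η : BForm n} (h : IsPositive η)
    (a : (Fin n → ℂ) →L[ℝ] ℝ) :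
    (metricOf η).inverse a = η.inverse (-(a.comp (cplxJ n))) := by
  obtain ⟨e, he⟩ := h.exists_equiv
  let j : (Fin n → ℂ) ≃L[ℝ] (Fin n → ℂ) :=
    ContinuousLinearEquiv.equivOfInverse (cplxJ n) (-cplxJ n)
      (fun u => by simp [I_smul_I_smul]) (fun u => by simp [I_smul_I_smul])
  -- The metric is `η` followed by composition with the isomorphism `i`, so its `inverse` is a true
  -- inverse and not the default value.
  have hm : metricOf η = ((e.trans (j.symm.arrowCongr (ContinuousLinearEquiv.refl ℝ ℝ)) :
      (Fin n → ℂ) ≃L[ℝ] ((Fin n → ℂ) →L[ℝ] ℝ)) : BForm n) := by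
    ext u v
    subst he
    rfl
  have hz : metricOf η (η.inverse (-(a.comp (cplxJ n)))) = a := by
    ext v
    rw [metricOf_apply, h.apply_inverse]
    simp [I_smul_I_smul]
  conv_lhs => rw [← hz]
  rw [hm]
  simp only [ContinuousLinearMap.inverse_equiv]
  exact ContinuousLinearEquiv.symm_apply_apply _ _

theorem IsPositive.gradSqR_eq {η : BForm n} (h : IsPositive η) (a : (Fin n → ℂ) →L[ℝ] ℝ) :
    gradSqR η a = dotR η a a := by
  rw [gradSqR, h.metricOf_inverse, metricOf_apply, h.apply_inverse, dotR]
  simp [I_smul_I_smul]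

theorem IsPositive.bracketR_eq {η : BForm n} (h : IsPositive η) (a b : (Fin n → ℂ) →L[ℝ] ℝ) :
    bracketR η a b = a (η.inverse b) := by
  rw [bracketR, h.apply_inverse]

theorem IsPositive.bracketR_swap {η : BForm n} (h : IsPositive η)
    (a b : (Fin n → ℂ) →L[ℝ] ℝ) : bracketR η a b = -bracketR η b a :=
  h.swap _ _

/-- The pairing equals η(A, iB) for the gradients A, B of the two covectors, and η(·, i·) is
symmetric for a (1,1)-form. -/
theorem IsPositive.dotR_swap {η : BForm n} (h : IsPositive η)
    (a b : (Fin n → ℂ) →L[ℝ] ℝ) : dotR η a b = dotR η b a := by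
  have key : ∀ a b : (Fin n → ℂ) →L[ℝ] ℝ, dotR η a b
      = η (η.inverse (-(a.comp (cplxJ n)))) (Complex.I • η.inverse (-(b.comp (cplxJ n)))) := by
    intro a b
    rw [h.apply_inverse]
    simp [dotR, I_smul_I_smul]
  rw [key, key, h.swap, h.I_left, neg_neg]

/-- The pull-back of a bilinear form by a linear map. -/
def pull (A : (Fin n → ℂ) →L[ℝ] (Fin n → ℂ)) (η : BForm n) : BForm n := η.bilinearComp A A

@[simp] theorem pull_apply (A : (Fin n → ℂ) →L[ℝ] (Fin n → ℂ)) (η : BForm n)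
    (u v : Fin n → ℂ) : pull A η u v = η (A u) (A v) := rfl

theorem pull_pull (A B : (Fin n → ℂ) →L[ℝ] (Fin n → ℂ)) (η : BForm n) :
    pull A (pull B η) = pull (B.comp A) η := rfl

theorem IsOneOne.pull {η : BForm n} (h : IsOneOne η) {A : (Fin n → ℂ) →L[ℝ] (Fin n → ℂ)}
    (hA : ∀ u, A (Complex.I • u) = Complex.I • A u) : IsOneOne (pull A η) :=
  ⟨fun u => h.alternating _, fun u v => by simp [hA, h.type_one_one]⟩

theorem IsPositive.pull {η : BForm n} (h : IsPositive η) {A : (Fin n → ℂ) →L[ℝ] (Fin n → ℂ)}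
    (hA : ∀ u, A (Complex.I • u) = Complex.I • A u) (hi : Function.Injective A) :
    IsPositive (pull A η) :=
  ⟨h.toIsOneOne.pull hA, fun u hu => by
    rw [pull_apply, hA]
    exact h.positive _ fun h0 => hu (hi (by rw [h0, map_zero]))⟩

/-- Naturality under a complex linear isomorphism: covectors are pulled back, vectors are moved by
the inverse. Brackets, gradient pairings and `contr` may therefore be computed in any holomorphic
chart. -/
theorem IsPositive.pull_inverse {η : BForm n} (h : IsPositive η)
    (A : (Fin n → ℂ) ≃L[ℝ] (Fin n → ℂ))
    (hA : ∀ u, A (Complex.I • u) = Complex.I • A u) (b : (Fin n → ℂ) →L[ℝ] ℝ) :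
    (WZW.pull A.toContinuousLinearMap η).inverse (b.comp A.toContinuousLinearMap)
      = A.symm (η.inverse b) := by
  refine (h.pull (A := A) hA A.injective).inverse_unique fun v => ?_
  simp [h.apply_inverse]

theorem IsPositive.bracketR_pull {η : BForm n} (h : IsPositive η)
    (A : (Fin n → ℂ) ≃L[ℝ] (Fin n → ℂ))
    (hA : ∀ u, A (Complex.I • u) = Complex.I • A u) (a b : (Fin n → ℂ) →L[ℝ] ℝ) :
    bracketR (WZW.pull A.toContinuousLinearMap η) (a.comp A.toContinuousLinearMap) (b.comp A.toContinuousLinearMap)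
      = bracketR η a b := by
  rw [(h.pull (A := A) hA A.injective).bracketR_eq, h.bracketR_eq, h.pull_inverse A hA]
  simp

theorem IsPositive.dotR_pull {η : BForm n} (h : IsPositive η)
    (A : (Fin n → ℂ) ≃L[ℝ] (Fin n → ℂ))
    (hA : ∀ u, A (Complex.I • u) = Complex.I • A u) (a b : (Fin n → ℂ) →L[ℝ] ℝ) :
    dotR (WZW.pull A.toContinuousLinearMap η) (a.comp A.toContinuousLinearMap) (b.comp A.toContinuousLinearMap)
      = dotR η a b := by
  have : -((b.comp A.toContinuousLinearMap).comp (cplxJ n))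
      = (-(b.comp (cplxJ n))).comp A.toContinuousLinearMap := by
    ext u
    simp [hA]
  rw [dotR, dotR, this, h.pull_inverse A hA]
  simp

/-- Half the trace of `η⁻¹ β`, that is, `n β ∧ ηⁿ⁻¹ / ηⁿ`. -/
def contr (η β : BForm n) : ℝ :=
  (1 / 2) * LinearMap.trace ℝ (Fin n → ℂ) (η.inverse.comp β).toLinearMap

theorem contr_smul (η β : BForm n) (c : ℝ) : contr η (c • β) = c * contr η β := by
  simp only [contr, ContinuousLinearMap.comp_smul, ContinuousLinearMap.toLinearMap_smul, map_smul,
    smul_eq_mul]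
  ring

theorem IsPositive.contr_pull {η : BForm n} (h : IsPositive η)
    (A : (Fin n → ℂ) ≃L[ℝ] (Fin n → ℂ))
    (hA : ∀ u, A (Complex.I • u) = Complex.I • A u) (β : BForm n) :
    contr (WZW.pull A.toContinuousLinearMap η)
      (WZW.pull A.toContinuousLinearMap β) = contr η β := by
  rw [contr, contr, 
    ← LinearMap.trace_conj' (η.inverse.comp β).toLinearMap A.symm.toLinearEquiv]
  congr 2
  refine LinearMap.ext fun u => ?_
  have : WZW.pull A.toContinuousLinearMap β u
      = (β (A u)).comp A.toContinuousLinearMap := rfl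
  change (WZW.pull A.toContinuousLinearMap η).inverse (WZW.pull A.toContinuousLinearMap β u) = _
  rw [this, h.pull_inverse A hA]
  simp [LinearEquiv.conj_apply]

variable (n) in
/-- The real basis `e_1, …, e_n, i e_1, …, i e_n` of `ℂⁿ`. -/
def realBasis : Module.Basis (Fin n ⊕ Fin n) ℝ (Fin n → ℂ) :=
  Module.Basis.ofEquivFun
    { toFun := fun u => Sum.elim (fun k => (u k).re) (fun k => (u k).im)
      map_add' := fun u v => by ext (k | k) <;> simp
      map_smul' := fun c u => by ext (k | k) <;> simp
      invFun := fun c k => ⟨c (Sum.inl k), c (Sum.inr k)⟩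
      left_inv := fun u => by ext k; simp
      right_inv := fun c => by ext (k | k) <;> simp }

theorem realBasis_inl (k : Fin n) : realBasis n (Sum.inl k) = Pi.single k 1 := by
  rw [realBasis, Module.Basis.coe_ofEquivFun]
  ext l
  by_cases h : l = k
  · subst h; simp [Complex.ext_iff]
  · simp [Complex.ext_iff, h]

theorem realBasis_inr (k : Fin n) : realBasis n (Sum.inr k) = Pi.single k Complex.I := by
  rw [realBasis, Module.Basis.coe_ofEquivFun]
  ext l
  by_cases h : l = k
  · subst h; simp [Complex.ext_iff]
  · simp [Complex.ext_iff, h]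

theorem single_I (k : Fin n) :
    (Pi.single k Complex.I : Fin n → ℂ) = Complex.I • Pi.single k (1 : ℂ) := by
  rw [← Pi.single_smul, smul_eq_mul, mul_one]

/-- The real matrix of a bilinear form. -/
def gram (η : BForm n) : Matrix (Fin n ⊕ Fin n) (Fin n ⊕ Fin n) ℝ :=
  Matrix.of fun i j => η (realBasis n i) (realBasis n j)

theorem gram_add (η β : BForm n) : gram (η + β) = gram η + gram β := by ext; simp [gram]

theorem gram_smul (η : BForm n) (c : ℝ) : gram (c • η) = c • gram η := by ext; simp [gram]

theorem apply_map_realBasis (A : (Fin n → ℂ) →L[ℝ] (Fin n → ℂ)) (i : Fin n ⊕ Fin n) :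
    A (realBasis n i)
      = ∑ k, LinearMap.toMatrix (realBasis n) (realBasis n) A.toLinearMap k i • realBasis n k := by
  simp only [LinearMap.toMatrix_apply]
  exact ((realBasis n).sum_repr _).symm

theorem gram_comp (η : BForm n) (A : (Fin n → ℂ) →L[ℝ] (Fin n → ℂ)) :
    gram (η.comp A) = (LinearMap.toMatrix (realBasis n) (realBasis n) A.toLinearMap).transpose
      * gram η := by
  ext i j
  simp only [gram, Matrix.of_apply, Matrix.mul_apply, Matrix.transpose_apply,
    ContinuousLinearMap.comp_apply]
  rw [apply_map_realBasis A i]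
  simp

theorem gram_pull (η : BForm n) (A : (Fin n → ℂ) →L[ℝ] (Fin n → ℂ)) :
    gram (pull A η) = (LinearMap.toMatrix (realBasis n) (realBasis n) A.toLinearMap).transpose
      * gram η * LinearMap.toMatrix (realBasis n) (realBasis n) A.toLinearMap := by
  rw [← gram_comp]
  ext i j
  simp only [gram, Matrix.of_apply, Matrix.mul_apply, ContinuousLinearMap.comp_apply, pull_apply]
  rw [apply_map_realBasis A j]
  simp [mul_comm]

theorem IsOneOne.hermMatrix_isHermitian {η : BForm n} (h : IsOneOne η) :
    (hermMatrix η).IsHermitian := by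
  ext k l
  simp only [hermMatrix, Matrix.conjTranspose_apply, Matrix.of_apply, single_I]
  rw [h.swap (Pi.single l 1) (Complex.I • Pi.single k 1), h.I_left, neg_neg,
    h.swap (Pi.single l 1)]
  simp [Complex.ext_iff]

/-- Adding i times the second block column to the first, and then subtracting i times the first
block row from the second, makes the matrix block triangular. Both operations have determinant 1. -/
theorem det_fromBlocks_rotation {ι : Type*} [Fintype ι] [DecidableEq ι] (A B : Matrix ι ι ℂ) :
    (Matrix.fromBlocks A B (-B) A).det
      = (A + Complex.I • B).det * (A - Complex.I • B).det := by
  have h1 : (Matrix.fromBlocks (1 : Matrix ι ι ℂ) 0 (-Complex.I • 1) 1)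
      * (Matrix.fromBlocks A B (-B) A * Matrix.fromBlocks 1 0 (Complex.I • 1) 1)
      = Matrix.fromBlocks (A + Complex.I • B) B 0 (A - Complex.I • B) := by
    simp only [Matrix.fromBlocks_multiply]
    congr 1
    · simp
    · simp
    · simp [smul_smul]
      abel
    · simp
      abel
  have h2 := congrArg Matrix.det h1
  simpa [Matrix.det_mul, Matrix.det_fromBlocks_zero₁₂, Matrix.det_fromBlocks_zero₂₁] using h2

theorem IsOneOne.det_hermMatrix_im {η : BForm n} (h : IsOneOne η) :
    (hermMatrix η).det.im = 0 := by
  have := congrArg Matrix.det h.hermMatrix_isHermitian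
  rw [Matrix.det_conjTranspose] at this
  exact Complex.conj_eq_iff_im.1 this

/-- In the basis e_k, i e_k the Gram matrix has blocks P, Q, -Q, P, with P + iQ = iH and P - iQ = -i
Hᵀ for the Hermitian matrix H. The powers of i cancel and (det H)² remains. The real Gram
determinant transforms simply under real linear maps, which makes it the tool for handling
`topPower`. -/
theorem IsOneOne.det_gram {η : BForm n} (h : IsOneOne η) :
    (gram η).det = (hermMatrix η).det.re ^ 2 := by
  let P : Matrix (Fin n) (Fin n) ℂ :=
    Matrix.of fun k l => ((η (Pi.single k 1) (Pi.single l 1) : ℝ) : ℂ)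
  let Q : Matrix (Fin n) (Fin n) ℂ :=
    Matrix.of fun k l => ((η (Pi.single k 1) (Pi.single l Complex.I) : ℝ) : ℂ)
  have hg : (gram η).map Complex.ofRealHom = Matrix.fromBlocks P Q (-Q) P := by
    ext (k | k) (l | l)
    · simp [gram, realBasis_inl, P]
    · simp [gram, realBasis_inl, realBasis_inr, Q]
    · simp [gram, realBasis_inl, realBasis_inr, Q, single_I, h.I_left]
    · simp [gram, realBasis_inr, P, single_I, h.type_one_one]
  have h1 : P + Complex.I • Q = Complex.I • hermMatrix η := by
    ext k l
    simp only [P, Q, hermMatrix, Matrix.add_apply, Matrix.smul_apply, Matrix.of_apply,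
      smul_eq_mul]
    linear_combination ((η (Pi.single k 1) (Pi.single l 1) : ℂ)) * Complex.I_mul_I
  have h2 : P - Complex.I • Q = (-Complex.I) • (hermMatrix η).transpose := by
    ext k l
    have e1 : η (Pi.single l 1) (Pi.single k Complex.I)
        = η (Pi.single k 1) (Pi.single l Complex.I) := by
      rw [single_I, single_I, h.swap, h.I_left, neg_neg]
    simp only [P, Q, hermMatrix, Matrix.sub_apply, Matrix.smul_apply, Matrix.of_apply,
      smul_eq_mul, Matrix.transpose_apply, e1]
    rw [h.swap (Pi.single l 1) (Pi.single k 1)]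
    push_cast
    linear_combination ((η (Pi.single k 1) (Pi.single l 1) : ℂ)) * Complex.I_mul_I
  have hd : (((gram η).det : ℝ) : ℂ) = (hermMatrix η).det ^ 2 := by
    change Complex.ofRealHom _ = _
    rw [RingHom.map_det, RingHom.mapMatrix_apply, hg, det_fromBlocks_rotation, h1, h2,
      Matrix.det_smul, Matrix.det_smul, Matrix.det_transpose]
    have : (Complex.I ^ Fintype.card (Fin n)) * ((-Complex.I) ^ Fintype.card (Fin n)) = 1 := by
      rw [← mul_pow]; simp
    linear_combination (hermMatrix η).det ^ 2 * this
  have hr : (hermMatrix η).det = ((hermMatrix η).det.re : ℂ) :=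
    Complex.ext rfl (by simp [h.det_hermMatrix_im])
  rw [hr] at hd
  exact_mod_cast hd

theorem IsOneOne.topPower_sq {η : BForm n} (h : IsOneOne η) :
    topPower η ^ 2 = (n.factorial : ℝ) ^ 2 * (gram η).det := by
  rw [topPower, mul_pow, h.det_gram]

theorem IsOneOne.hermMatrix_quadratic {η : BForm n} (h : IsOneOne η) (u : Fin n → ℂ) :
    dotProduct (star u) (Matrix.mulVec (hermMatrix η) u)
      = (η (star u) (Complex.I • star u) : ℂ) := by
  -- The sesquilinear form with matrix `hermMatrix η`. It is linear in the first slot and conjugate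
  -- linear in the second, hence `star u` in the result.
  let S : (Fin n → ℂ) → (Fin n → ℂ) → ℂ := fun v w =>
    (η v (Complex.I • w) : ℂ) - Complex.I * (η v w : ℂ)
  have hadd : ∀ v v' w, S (v + v') w = S v w + S v' w := fun v v' w => by
    simp [S]; ring
  have hadd' : ∀ v w w', S v (w + w') = S v w + S v w' := fun v v' w => by
    simp [S]; ring
  have hr : ∀ (c : ℝ) v w, S (c • v) w = c * S v w := fun c v w => by simp [S]; ring
  have hr' : ∀ (c : ℝ) v w, S v (c • w) = c * S v w := fun c v w => by
    simp [S, smul_comm Complex.I c]; ring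
  have hI : ∀ v w, S (Complex.I • v) w = Complex.I * S v w := fun v w => by
    simp only [S, h.type_one_one, h.I_left]
    push_cast
    linear_combination ((η v w : ℂ)) * Complex.I_mul_I
  have hI' : ∀ v w, S v (Complex.I • w) = -Complex.I * S v w := fun v w => by
    simp only [S, I_smul_I_smul, map_neg]
    push_cast
    linear_combination (-(η v w : ℂ)) * Complex.I_mul_I
  have hdec : ∀ (c : ℂ) (v : Fin n → ℂ), c • v = c.re • v + c.im • Complex.I • v := by
    intro c v
    ext k
    simp [Complex.ext_iff, sub_eq_add_neg]
  have hc : ∀ (c : ℂ) v w, S (c • v) w = c * S v w := fun c v w => by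
    rw [hdec, hadd, hr, hr, hI]
    conv_rhs => rw [← Complex.re_add_im c]
    ring
  have hc' : ∀ (c : ℂ) v w, S v (c • w) = star c * S v w := fun c v w => by
    rw [hdec, hadd', hr', hr', hI']
    have : star c = c.re - c.im * Complex.I := by simp [Complex.ext_iff]
    rw [this]
    ring
  have hsum : ∀ (s : Finset (Fin n)) (f : Fin n → Fin n → ℂ) w,
      S (∑ k ∈ s, f k) w = ∑ k ∈ s, S (f k) w := by
    intro s f w
    induction s using Finset.cons_induction with
    | empty => simp [S]
    | cons a s ha ih => rw [Finset.sum_cons, Finset.sum_cons, hadd, ih]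
  have hsum' : ∀ (s : Finset (Fin n)) (f : Fin n → Fin n → ℂ) v,
      S v (∑ k ∈ s, f k) = ∑ k ∈ s, S v (f k) := by
    intro s f w
    induction s using Finset.cons_induction with
    | empty => simp [S]
    | cons a s ha ih => rw [Finset.sum_cons, Finset.sum_cons, hadd', ih]
  have hu : star u = ∑ k, (star u) k • (Pi.single k 1 : Fin n → ℂ) := by
    ext l
    simp [Finset.sum_apply, Pi.single_apply]
  have hherm : ∀ k l, hermMatrix η k l = S (Pi.single k 1) (Pi.single l 1) := fun k l => by
    simp [hermMatrix, S, single_I]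
  have key : S (star u) (star u) = dotProduct (star u) (Matrix.mulVec (hermMatrix η) u) := by
    conv_lhs => rw [hu]
    rw [hsum]
    simp only [dotProduct, Matrix.mulVec, hherm]
    refine Finset.sum_congr rfl fun k _ => ?_
    rw [hc, hsum']
    congr 1
    refine Finset.sum_congr rfl fun l _ => ?_
    rw [hc']
    simp [mul_comm]
  rw [← key]
  simp [S, h.alternating]

open ComplexOrder in
-- The quadratic form of `hermMatrix η` at u is η(ū, iū), so the Hermitian matrix is positive
-- definite.
theorem IsPositive.topPower_pos {η : BForm n} (h : IsPositive η) : 0 < topPower η := by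
  have hpd : (hermMatrix η).PosDef := by
    refine Matrix.PosDef.of_dotProduct_mulVec_pos h.hermMatrix_isHermitian fun u hu => ?_
    rw [h.hermMatrix_quadratic]
    exact_mod_cast h.positive _ (by simpa using hu)
  exact mul_pos (by positivity) (Complex.lt_def.1 hpd.det_pos).1

/-- Both sides are positive, so it is enough to compare squares, which are Gram determinants and
scale by (det A)². This is the Jacobian factor in the change of variables between charts. -/
theorem IsPositive.topPower_pull {η : BForm n} (h : IsPositive η)
    {A : (Fin n → ℂ) →L[ℝ] (Fin n → ℂ)}
    (hA : ∀ u, A (Complex.I • u) = Complex.I • A u) (hi : Function.Injective A) :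
    topPower (WZW.pull A η) = |A.det| * topPower η := by
  have h1 := h.topPower_pos
  have h2 := (h.pull hA hi).topPower_pos
  rw [← abs_of_pos h1, ← abs_of_pos h2, ← abs_mul, ← sq_eq_sq_iff_abs_eq_abs, mul_pow,
    h.topPower_sq, (h.pull hA hi).topPower_sq, gram_pull, Matrix.det_mul, Matrix.det_mul,
    Matrix.det_transpose, LinearMap.det_toMatrix]
  change _ = LinearMap.det _ ^ 2 * _
  ring

theorem contDiff_topPower : ContDiff ℝ ∞ (topPower : BForm n → ℝ) := by
  have hent : ∀ k l, ContDiff ℝ ∞ fun η : BForm n => hermMatrix η k l := fun k l => by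
    have h1 : ∀ v w : Fin n → ℂ, ContDiff ℝ ∞ fun η : BForm n => ((η v w : ℝ) : ℂ) := fun v w =>
      Complex.ofRealCLM.contDiff.comp
        ((contDiff_id.clm_apply contDiff_const).clm_apply contDiff_const)
    exact (h1 _ _).sub (contDiff_const.mul (h1 _ _))
  have hdet : ContDiff ℝ ∞ fun η : BForm n => (hermMatrix η).det := by
    simp only [Matrix.det_apply]
    exact ContDiff.sum fun σ _ => (contDiff_prod fun i _ => hent _ _).const_smul _
  exact contDiff_const.mul (Complex.reCLM.contDiff.comp hdet)

/-- The square of `topPower` along η + tβ is a constant times det(1 + tN) det(gram η), where N is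
the matrix of η⁻¹β. Its derivative at 0 is tr N times its value, and dividing by 2 `topPower η`,
which is positive, leaves the half trace. -/
theorem IsPositive.fderiv_topPower {η β : BForm n} (h : IsPositive η) (hβ : IsOneOne β) :
    fderiv ℝ topPower η β = topPower η * contr η β := by
  have hd : DifferentiableAt ℝ topPower η := contDiff_topPower.differentiable (by simp) η
  have h1 : HasDerivAt (fun t : ℝ => topPower (η + t • β)) (fderiv ℝ topPower η β) 0 :=
    hasDerivAt_line hd β
  let N := LinearMap.toMatrix (realBasis n) (realBasis n) (η.inverse.comp β).toLinearMap
  have hN : gram β = N.transpose * gram η := by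
    rw [← gram_comp]
    congr 1
    ext1 u
    simp [h.apply_inverse]
  have hdet : ∀ t : ℝ, (gram (η + t • β)).det = (1 + t • N).det * (gram η).det := by
    intro t
    rw [gram_add, gram_smul, hN, ← Matrix.det_transpose (1 + t • N), ← Matrix.det_mul]
    simp [add_mul]
  have h2 : HasDerivAt (fun t : ℝ => (1 + t • N).det) N.trace 0 := by
    have := (Matrix.det (1 + (Polynomial.X : Polynomial ℝ) • N.map Polynomial.C)).hasDerivAt 0
    rw [Matrix.derivative_det_one_add_X_smul] at this
    refine this.congr_of_eventuallyEq (Filter.Eventually.of_forall fun t => ?_)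
    change _ = Polynomial.evalRingHom t _
    rw [RingHom.map_det]
    refine congrArg Matrix.det (Matrix.ext fun i j => ?_)
    by_cases hij : i = j <;> simp [hij] <;> exact mul_comm _ _
  have h3 : HasDerivAt (fun t : ℝ => topPower (η + t • β) ^ 2)
      ((n.factorial : ℝ) ^ 2 * (N.trace * (gram η).det)) 0 := by
    refine ((h2.mul_const _).const_mul _).congr_of_eventuallyEq
      (Filter.Eventually.of_forall fun t => ?_)
    simp only
    rw [← hdet, (h.toIsOneOne.add (hβ.smul t)).topPower_sq]
  have h4 := (h1.pow 2).unique h3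
  have htr : N.trace = 2 * contr η β := by
    rw [contr, LinearMap.trace_eq_matrix_trace ℝ (realBasis n)]
    ring
  have hsq := h.topPower_sq
  have hpos := h.topPower_pos
  have h0 : η + (0 : ℝ) • β = η := by ext u v; simp
  simp only [h0, Nat.cast_ofNat, Nat.add_one_sub_one, pow_one] at h4
  rw [htr] at h4
  have h5 : 2 * topPower η * (fderiv ℝ topPower η β)
      = 2 * topPower η * (topPower η * contr η β) := by
    linear_combination h4 - 2 * contr η β * hsq
  exact mul_left_cancel₀ (by positivity) h5

theorem IsPositive.contDiffAt_inverse {η : BForm n} (h : IsPositive η) :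
    ContDiffAt ℝ ∞ (fun β : BForm n => β.inverse) η := by
  obtain ⟨e, rfl⟩ := h.exists_equiv
  exact contDiffAt_map_inverse e

end Linear

/-! ### Partial derivatives of functions on a product -/

section Partial

variable {E V G : Type*} [NormedAddCommGroup E] [NormedSpace ℝ E] [NormedAddCommGroup V]
  [NormedSpace ℝ V] [NormedAddCommGroup G] [NormedSpace ℝ G]

theorem hasFDerivAt_slice_fst {g : E × V → G} {g' : E × V →L[ℝ] G} {w : E} {y : V}
    (h : HasFDerivAt g g' (w, y)) :
    HasFDerivAt (fun w' => g (w', y)) (g'.comp (ContinuousLinearMap.inl ℝ E V)) w :=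
  h.comp w (hasFDerivAt_prodMk_left w y)

theorem hasFDerivAt_slice_snd {g : E × V → G} {g' : E × V →L[ℝ] G} {w : E} {y : V}
    (h : HasFDerivAt g g' (w, y)) :
    HasFDerivAt (fun y' => g (w, y')) (g'.comp (ContinuousLinearMap.inr ℝ E V)) y :=
  h.comp y (hasFDerivAt_prodMk_right w y)

theorem fderiv_snd_eq {g : E × V → G} {w : E} {y : V} (h : DifferentiableAt ℝ g (w, y)) :
    fderiv ℝ (fun y' => g (w, y')) y
      = (fderiv ℝ g (w, y)).comp (ContinuousLinearMap.inr ℝ E V) :=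
  (hasFDerivAt_slice_snd h.hasFDerivAt).fderiv

theorem fderiv_fst_eq {g : E × V → G} {w : E} {y : V} (h : DifferentiableAt ℝ g (w, y)) :
    fderiv ℝ (fun w' => g (w', y)) w
      = (fderiv ℝ g (w, y)).comp (ContinuousLinearMap.inl ℝ E V) :=
  (hasFDerivAt_slice_fst h.hasFDerivAt).fderiv

theorem _root_.ContDiffOn.differentiableAt_of_isOpen {g : E → G} {U : Set E}
    (h : ContDiffOn ℝ ∞ g U) (hU : IsOpen U) {q : E} (hq : q ∈ U) : DifferentiableAt ℝ g q :=
  (h.contDiffAt (hU.mem_nhds hq)).differentiableAt (by simp)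

theorem _root_.ContDiffOn.fderiv_infty {g : E → G} {U : Set E} (h : ContDiffOn ℝ ∞ g U)
    (hU : IsOpen U) : ContDiffOn ℝ ∞ (fderiv ℝ g) U :=
  h.fderiv_of_isOpen hU (by simp)

theorem contDiffOn_fderiv_snd {g : E × V → G} {U : Set (E × V)} (hU : IsOpen U)
    (h : ContDiffOn ℝ ∞ g U) :
    ContDiffOn ℝ ∞ (fun q : E × V => fderiv ℝ (fun y => g (q.1, y)) q.2) U :=
  ((h.fderiv_infty hU).clm_comp contDiffOn_const).congr fun _ hq =>
    fderiv_snd_eq (h.differentiableAt_of_isOpen hU hq)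

theorem contDiffOn_fderiv_fst {g : E × V → G} {U : Set (E × V)} (hU : IsOpen U)
    (h : ContDiffOn ℝ ∞ g U) (v : E) :
    ContDiffOn ℝ ∞ (fun q : E × V => fderiv ℝ (fun w => g (w, q.2)) q.1 v) U :=
  ((h.fderiv_infty hU).clm_apply contDiffOn_const (g := fun _ => (v, (0 : V)))).congr
    fun q hq => by
      rw [fderiv_fst_eq (h.differentiableAt_of_isOpen hU hq)]
      rfl

theorem fderiv_fst_snd_comm {g : E × V → G} {U : Set (E × V)} (hU : IsOpen U)
    (h : ContDiffOn ℝ ∞ g U) (v : E) {w : E} {y : V} (hq : (w, y) ∈ U) :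
    fderiv ℝ (fun w' => fderiv ℝ (fun y' => g (w', y')) y) w v
      = fderiv ℝ (fun y' => fderiv ℝ (fun w' => g (w', y')) w v) y := by
  have hd := (h.fderiv_infty hU).differentiableAt_of_isOpen hU hq
  have hsym : IsSymmSndFDerivAt ℝ g (w, y) :=
    (h.contDiffAt (hU.mem_nhds hq)).isSymmSndFDerivAt (by simp; exact WithTop.coe_le_coe.2 (le_top : (2 : ℕ∞) ≤ ⊤))
  have e1 : (fun w' => fderiv ℝ (fun y' => g (w', y')) y) =ᶠ[nhds w]
      fun w' => (fderiv ℝ g (w', y)).comp (ContinuousLinearMap.inr ℝ E V) := by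
    have : ∀ᶠ w' in nhds w, (w', y) ∈ U :=
      (Continuous.prodMk_left y).continuousAt.eventually (hU.mem_nhds hq)
    filter_upwards [this] with w' hw'
    exact fderiv_snd_eq (h.differentiableAt_of_isOpen hU hw')
  have e2 : (fun y' => fderiv ℝ (fun w' => g (w', y')) w v) =ᶠ[nhds y]
      fun y' => fderiv ℝ g (w, y') (v, 0) := by
    have : ∀ᶠ y' in nhds y, (w, y') ∈ U :=
      (Continuous.prodMk_right w).continuousAt.eventually (hU.mem_nhds hq)
    filter_upwards [this] with y' hy'
    rw [fderiv_fst_eq (h.differentiableAt_of_isOpen hU hy')]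
    rfl
  rw [e1.fderiv_eq, e2.fderiv_eq]
  have h1 := hasFDerivAt_slice_fst hd.hasFDerivAt
  have h2 := hasFDerivAt_slice_snd hd.hasFDerivAt
  have h1' := h1.clm_comp (hasFDerivAt_const (ContinuousLinearMap.inr ℝ E V) w)
  have h2' := h2.clm_apply (hasFDerivAt_const ((v, 0) : E × V) y)
  refine (congrArg (fun L : E →L[ℝ] (V →L[ℝ] G) => L v) h1'.fderiv).trans
    (Eq.trans ?_ h2'.fderiv.symm)
  ext u
  simp [hsym.eq (v, 0) (0, u)]

theorem contDiffOn_iteratedFDeriv_snd {g : E × V → G} {U : Set (E × V)} (hU : IsOpen U)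
    (h : ContDiffOn ℝ ∞ g U) (k : ℕ) :
    ContDiffOn ℝ ∞ (fun q : E × V => iteratedFDeriv ℝ k (fun y => g (q.1, y)) q.2) U := by
  induction k with
  | zero =>
    have := (continuousMultilinearCurryFin0 ℝ V G).symm.contDiff (n := ∞).comp_contDiffOn h
    exact this.congr fun q _ => by rw [iteratedFDeriv_zero_eq_comp]; rfl
  | succ k ih =>
    have := (continuousMultilinearCurryLeftEquiv ℝ (fun _ : Fin (k + 1) => V) G).symm.contDiff
      (n := ∞).comp_contDiffOn (contDiffOn_fderiv_snd hU ih)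
    exact this.congr fun q _ => by rw [iteratedFDeriv_succ_eq_comp_left]; rfl

/-- Identifies the limit of the spatial derivatives of difference quotients in the parameter, hence
the limit of those quotients in the Fréchet topology. -/
theorem fderiv_iteratedFDeriv_comm {g : E × V → G} {U : Set (E × V)} (hU : IsOpen U)
    (h : ContDiffOn ℝ ∞ g U) (v : E) (k : ℕ) {w : E} {y : V} (hq : (w, y) ∈ U) :
    fderiv ℝ (fun w' => iteratedFDeriv ℝ k (fun y' => g (w', y')) y) w v
      = iteratedFDeriv ℝ k (fun y' => fderiv ℝ (fun w' => g (w', y')) w v) y := by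
  induction k generalizing w y with
  | zero =>
    have hg := hasFDerivAt_slice_fst (h.differentiableAt_of_isOpen hU hq).hasFDerivAt
    have := (continuousMultilinearCurryFin0 ℝ V G).symm.toContinuousLinearEquiv.hasFDerivAt.comp w hg
    simp only [iteratedFDeriv_zero_eq_comp]
    have e := (congrArg (fun L : E →L[ℝ] _ => L v) this.fderiv)
    have e' := (congrArg (fun L : E →L[ℝ] _ => L v) hg.fderiv)
    simp only [Function.comp_def] at e e' ⊢
    refine e.trans ?_
    rw [e']
    rfl
  | succ k ih =>
    have hk := contDiffOn_iteratedFDeriv_snd hU h k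
    have hd := hasFDerivAt_slice_fst
      ((contDiffOn_fderiv_snd hU hk).differentiableAt_of_isOpen hU hq).hasFDerivAt
    have := (continuousMultilinearCurryLeftEquiv ℝ (fun _ : Fin (k + 1) => V)
      G).symm.toContinuousLinearEquiv.hasFDerivAt.comp w hd
    simp only [iteratedFDeriv_succ_eq_comp_left]
    have e := (congrArg (fun L : E →L[ℝ] _ => L v) this.fderiv)
    have e' := (congrArg (fun L : E →L[ℝ] _ => L v) hd.fderiv)
    have hc := fderiv_fst_snd_comm hU hk v hq
    simp only [Function.comp_def] at e e' hc ⊢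
    refine e.trans ?_
    have hev : (fun y' => fderiv ℝ (fun w' => iteratedFDeriv ℝ k (fun y' => g (w', y')) y') w v)
        =ᶠ[nhds y] iteratedFDeriv ℝ k (fun y' => fderiv ℝ (fun w' => g (w', y')) w v) := by
      have : ∀ᶠ y' in nhds y, (w, y') ∈ U :=
        (Continuous.prodMk_right w).continuousAt.eventually (hU.mem_nhds hq)
      filter_upwards [this] with y' hy' using ih hy'
    rw [hev.fderiv_eq] at hc
    rw [← hc]
    exact congrArg (continuousMultilinearCurryLeftEquiv ℝ (fun _ : Fin (k + 1) => V) G).symm e'.symm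

/-- The difference quotients of a `C¹` function converge locally uniformly in the parameters. -/
theorem tendsto_differenceQuotient {g : E × V → G} {U : Set (E × V)} (hU : IsOpen U)
    (h : ContDiffOn ℝ ∞ g U) (v : E) {w : E} {y : V} (hq : (w, y) ∈ U) :
    Filter.Tendsto (fun p : ℝ × V => p.1⁻¹ • (g (w + p.1 • v, p.2) - g (w, p.2)))
      (nhdsWithin 0 {0}ᶜ ×ˢ nhds y) (nhds (fderiv ℝ (fun w' => g (w', y)) w v)) := by
  -- Strict differentiability controls g at two moving points near (w, y), which is what allows the
  -- second variable to move while the step tends to 0.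
  have hs : HasStrictFDerivAt g (fderiv ℝ g (w, y)) (w, y) :=
    (h.contDiffAt (hU.mem_nhds hq)).hasStrictFDerivAt (by simp)
  have hl := hs.isLittleO
  rw [fderiv_fst_eq (h.differentiableAt_of_isOpen hU hq)]
  have hm : Filter.Tendsto (fun p : ℝ × V => (((w + p.1 • v, p.2) : E × V), ((w, p.2) : E × V)))
      (nhdsWithin 0 {0}ᶜ ×ˢ nhds y) (nhds ((w, y), (w, y))) := by
    have hc : Continuous fun p : ℝ × V =>
        (((w + p.1 • v, p.2) : E × V), ((w, p.2) : E × V)) := by fun_prop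
    have := hc.tendsto ((0 : ℝ), y)
    simp only [zero_smul, add_zero] at this
    refine this.mono_left ?_
    rw [nhds_prod_eq]
    exact Filter.prod_mono nhdsWithin_le_nhds le_rfl
  have h2 := hl.comp_tendsto hm
  rw [tendsto_iff_norm_sub_tendsto_zero]
  have hne : ∀ᶠ p : ℝ × V in nhdsWithin 0 {0}ᶜ ×ˢ nhds y, p.1 ≠ 0 :=
    Filter.Eventually.prod_inl (self_mem_nhdsWithin) _
  have h3 := h2.norm_left
  have h4 : (fun p : ℝ × V => ‖p.1⁻¹ • (g (w + p.1 • v, p.2) - g (w, p.2))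
      - (fderiv ℝ g (w, y)).comp (ContinuousLinearMap.inl ℝ E V) v‖)
      =o[nhdsWithin 0 {0}ᶜ ×ˢ nhds y] fun _ => (‖v‖ : ℝ) := by
    rw [Asymptotics.isLittleO_iff] at h3 ⊢
    intro c hc
    filter_upwards [h3 hc, hne] with p hp hp0
    simp only [Function.comp_def, norm_norm, Prod.mk_sub_mk, add_sub_cancel_left, sub_self] at hp ⊢
    have e : p.1⁻¹ • (g (w + p.1 • v, p.2) - g (w, p.2))
        - (fderiv ℝ g (w, y)).comp (ContinuousLinearMap.inl ℝ E V) v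
        = p.1⁻¹ • (g (w + p.1 • v, p.2) - g (w, p.2) - fderiv ℝ g (w, y) (p.1 • v, 0)) := by
      have : ((p.1 • v, 0) : E × V) = p.1 • (v, 0) := by simp
      rw [this, map_smul, smul_sub p.1⁻¹ (_ - _), smul_smul, inv_mul_cancel₀ hp0, one_smul]
      rfl
    rw [e, norm_smul, norm_inv]
    have hv : ‖((p.1 • v, 0) : E × V)‖ = ‖p.1‖ * ‖v‖ := by
      rw [Prod.norm_mk, norm_zero, max_eq_left (norm_nonneg _), norm_smul]
    rw [hv] at hp
    have hpos : 0 < ‖p.1‖ := norm_pos_iff.2 hp0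
    calc ‖p.1‖⁻¹ * _ ≤ ‖p.1‖⁻¹ * (c * (‖p.1‖ * ‖v‖)) := by gcongr
      _ = c * ‖v‖ := by field_simp
  exact h4.trans_isBigO (Asymptotics.isBigO_const_const _ one_ne_zero _)
    |>.tendsto_div_nhds_zero.congr fun p => by simp

end Partial

/-! ### Integrals depending on parameters -/

section Parametric

open MeasureTheory

variable {V : Type*} [NormedAddCommGroup V] [MeasurableSpace V] [BorelSpace V]
  {μ : Measure V} [IsFiniteMeasureOnCompacts μ]

omit [MeasurableSpace V] [BorelSpace V] in
-- Continuity on W × k is uniform along the compact k. The bound `‖g w y‖ + 1` then serves as the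
-- dominating function for integrals over k.
theorem exists_norm_le_of_compact {Z : Type*} [TopologicalSpace Z] {g : Z → V → ℝ} {W : Set Z}
    {k : Set V} (hk : IsCompact k) (hg : ContinuousOn g.uncurry (W ×ˢ k)) {w : Z} (hw : w ∈ W) :
    ∀ᶠ z in nhdsWithin w W, ∀ y ∈ k, ‖g z y‖ ≤ ‖g w y‖ + 1 := by
  obtain ⟨v, hv, hb⟩ := hk.mem_uniformity_of_prod hg hw (Metric.dist_mem_uniformity one_pos)
  filter_upwards [hv] with z hz y hy
  have h1 : dist (g z y) (g w y) < 1 := hb z hz y hy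
  rw [dist_eq_norm] at h1
  have := norm_le_norm_add_norm_sub (g w y) (g z y)
  rw [norm_sub_rev] at this
  linarith

omit [MeasurableSpace V] [BorelSpace V] in
theorem continuousOn_slice {Z : Type*} [TopologicalSpace Z] {g : Z → V → ℝ} {W : Set Z}
    {k : Set V} (hg : ContinuousOn g.uncurry (W ×ˢ k)) {w : Z} (hw : w ∈ W) :
    ContinuousOn (g w) k :=
  hg.comp (Continuous.prodMk_right w).continuousOn fun _ hy => ⟨hw, hy⟩

theorem continuousOn_setIntegral_of_compact {Z : Type*} [TopologicalSpace Z]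
    [FirstCountableTopology Z] {g : Z → V → ℝ} {W : Set Z}
    {k : Set V} (hk : IsCompact k) (hg : ContinuousOn g.uncurry (W ×ˢ k)) :
    ContinuousOn (fun z => ∫ y in k, g z y ∂μ) W := by
  intro w hw
  refine continuousWithinAt_of_dominated (bound := fun y => ‖g w y‖ + 1) ?_ ?_ ?_ ?_
  · filter_upwards [self_mem_nhdsWithin] with z hz
    exact ((continuousOn_slice hg hz).integrableOn_compact hk).aestronglyMeasurable
  · filter_upwards [exists_norm_le_of_compact hk hg hw] with z hz
    exact (ae_restrict_mem hk.measurableSet).mono fun y hy => hz y hy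
  · exact (((continuousOn_slice hg hw).norm.add continuousOn_const).integrableOn_compact hk)
  · refine (ae_restrict_mem hk.measurableSet).mono fun y hy => ?_
    have h1 : ContinuousWithinAt (fun z : Z => (z, y)) W w :=
      (Continuous.prodMk_left y).continuousWithinAt
    exact ContinuousWithinAt.comp (f := fun z : Z => (z, y)) (s := W) (x := w) (g := g.uncurry) (hg (w, y) ⟨hw, hy⟩) h1 fun z hz => ⟨hz, hy⟩

theorem hasDerivAt_setIntegral_of_compact {g g' : ℝ → V → ℝ} {S : Set ℝ} (hS : S ∈ nhds 0)
    {k : Set V} (hk : IsCompact k) (hg : ∀ s ∈ S, ContinuousOn (g s) k)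
    (hg' : ContinuousOn g'.uncurry (S ×ˢ k))
    (hd : ∀ s ∈ S, ∀ y ∈ k, HasDerivAt (fun r => g r y) (g' s y) s) :
    HasDerivAt (fun s => ∫ y in k, g s y ∂μ) (∫ y in k, g' 0 y ∂μ) 0 := by
  have h0 : (0 : ℝ) ∈ S := mem_of_mem_nhds hS
  have hN := exists_norm_le_of_compact hk hg' h0
  rw [nhdsWithin_eq_nhds.2 hS] at hN
  refine (hasDerivAt_integral_of_dominated_loc_of_deriv_le
    (s := S ∩ {z | ∀ y ∈ k, ‖g' z y‖ ≤ ‖g' 0 y‖ + 1}) (bound := fun y => ‖g' 0 y‖ + 1)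
    (Filter.inter_mem hS hN) ?_ ?_ ?_ ?_ ?_ ?_).2
  · filter_upwards [hS] with s hs
    exact ((hg s hs).integrableOn_compact hk).aestronglyMeasurable
  · exact (hg 0 h0).integrableOn_compact hk
  · exact ((continuousOn_slice hg' h0).integrableOn_compact hk).aestronglyMeasurable
  · exact (ae_restrict_mem hk.measurableSet).mono fun y hy s hs => hs.2 y hy
  · exact (((continuousOn_slice hg' h0).norm.add continuousOn_const).integrableOn_compact hk)
  · exact (ae_restrict_mem hk.measurableSet).mono fun y hy s hs => hd s hs.1 y hy

end Parametric

/-! ### The divergence theorem for compactly supported vector fields -/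

section Divergence

open MeasureTheory

variable {V : Type*} [NormedAddCommGroup V] [NormedSpace ℝ V] [FiniteDimensional ℝ V]

omit [FiniteDimensional ℝ V] in
theorem trace_eq_sum {ι : Type*} [Fintype ι] (b : Module.Basis ι ℝ V) (M : V →L[ℝ] V) :
    LinearMap.trace ℝ V M.toLinearMap = ∑ i, b.coord i (M (b i)) := by
  classical
  rw [LinearMap.trace_eq_matrix_trace ℝ b]
  simp [Matrix.trace, LinearMap.toMatrix_apply]

theorem integral_lineDeriv_eq_zero [MeasurableSpace V] [BorelSpace V] {μ : Measure V}
    [μ.IsAddHaarMeasure] {h h' : V → ℝ} {v : V} (hd : ∀ x, HasLineDerivAt ℝ h (h' x) x v)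
    (hi : Integrable h μ) (hi' : Integrable h' μ) : ∫ x, h' x ∂μ = 0 := by
  -- Integration by parts against the constant function 1, whose derivative is 0.
  have := integral_bilinear_hasLineDerivAt_right_eq_neg_left_of_integrable (μ := μ)
    (f := fun _ => (1 : ℝ)) (f' := fun _ => (0 : ℝ)) (g := h) (g' := h') (v := v)
    (B := ContinuousLinearMap.mul ℝ ℝ) (by simp) (by simpa using hi') (by simpa using hi)
    (fun x _ => by simpa using (hasFDerivAt_const (1 : ℝ) x).hasLineDerivAt v)
    (fun x _ => hd x)
  simpa using this

theorem integral_divergence_eq_zero [MeasurableSpace V] [BorelSpace V] {μ : Measure V}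
    [μ.IsAddHaarMeasure] {T k : Set V} (hT : IsOpen T) (hk : IsCompact k) (hkT : k ⊆ T)
    {Y : V → V} (hY : ContDiffOn ℝ ∞ Y T) (h0 : ∀ y ∈ T, y ∉ k → Y y = 0) :
    ∫ y in T, LinearMap.trace ℝ V (fderiv ℝ Y y).toLinearMap ∂μ = 0 := by
  -- The field extended by zero is smooth on the whole space, since `k` is compact inside the open
  -- set `T`. The divergence then integrates to zero coordinate by coordinate.
  let Z : V → V := T.indicator Y
  have hZ0 : ∀ y ∉ k, Z y = 0 := fun y hy => by
    by_cases hyT : y ∈ T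
    · simp [Z, hyT, h0 y hyT hy]
    · simp [Z, hyT]
  have hZT : ∀ y ∈ T, Z =ᶠ[nhds y] Y := fun y hy =>
    Filter.eventuallyEq_of_mem (hT.mem_nhds hy) fun x hx => by simp [Z, hx]
  have hZk : ∀ y ∉ k, Z =ᶠ[nhds y] fun _ => 0 := fun y hy =>
    Filter.eventuallyEq_of_mem (hk.isClosed.isOpen_compl.mem_nhds hy) fun x hx => hZ0 x hx
  have hZ : ContDiff ℝ ∞ Z := by
    rw [contDiff_iff_contDiffAt]
    intro y
    by_cases hy : y ∈ k
    · exact (hY.contDiffAt (hT.mem_nhds (hkT hy))).congr_of_eventuallyEq (hZT y (hkT hy))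
    · exact contDiffAt_const.congr_of_eventuallyEq (hZk y hy)
  let b := Module.finBasis ℝ V
  have hcoord : ∀ i, Continuous (b.coord i) := fun i => LinearMap.continuous_of_finiteDimensional _
  have hZ' : ∀ y ∉ k, fderiv ℝ Z y = 0 := fun y hy => by
    rw [(hZk y hy).fderiv_eq]; simp
  have hsupp : ∀ {f : V → ℝ}, Continuous f → (∀ y ∉ k, f y = 0) → Integrable f μ := fun hf hf0 =>
    hf.integrable_of_hasCompactSupport (HasCompactSupport.intro hk hf0)
  have hdiff : Continuous fun y => fderiv ℝ Z y := hZ.continuous_fderiv (by simp)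
  have hi : ∀ i, Integrable (fun y => b.coord i (fderiv ℝ Z y (b i))) μ := fun i =>
    hsupp ((hcoord i).comp (hdiff.clm_apply continuous_const)) fun y hy => by simp [hZ' y hy]
  have hz : ∀ i, ∫ y, b.coord i (fderiv ℝ Z y (b i)) ∂μ = 0 := fun i => by
    refine integral_lineDeriv_eq_zero (h := fun y => b.coord i (Z y)) (v := b i) (fun y => ?_)
      (hsupp ((hcoord i).comp hZ.continuous) fun y hy => by simp [hZ0 y hy]) (hi i)
    have h1 := (hZ.differentiable (by simp) y).hasFDerivAt
    have h2 := (LinearMap.toContinuousLinearMap (b.coord i)).hasFDerivAt.comp y h1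
    exact h2.hasLineDerivAt (b i)
  have hext : ∫ y in T, LinearMap.trace ℝ V (fderiv ℝ Y y).toLinearMap ∂μ
      = ∫ y, LinearMap.trace ℝ V (fderiv ℝ Z y).toLinearMap ∂μ := by
    rw [← setIntegral_eq_integral_of_forall_compl_eq_zero (s := T)
      (f := fun y => LinearMap.trace ℝ V (fderiv ℝ Z y).toLinearMap) (fun y hy => by rw [hZ' y fun h => hy (hkT h)]; simp)]
    refine setIntegral_congr_fun hT.measurableSet fun y hy => ?_
    simp only [(hZT y hy).fderiv_eq]
  rw [hext]
  simp only [trace_eq_sum b]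
  rw [integral_finsetSum _ fun i _ => hi i]
  exact Finset.sum_eq_zero fun i _ => hz i

/-- If `W` is antisymmetric, transposing `S` changes the sign of the trace of `W S`. -/
theorem trace_comp_flip {W : (V →L[ℝ] ℝ) →L[ℝ] V} (hW : ∀ a c : V →L[ℝ] ℝ, a (W c) = -c (W a))
    (S : V →L[ℝ] V →L[ℝ] ℝ) :
    LinearMap.trace ℝ V (W.comp S.flip).toLinearMap
      = -LinearMap.trace ℝ V (W.comp S).toLinearMap := by
  let b := Module.finBasis ℝ V
  let ε : ∀ i, V →L[ℝ] ℝ := fun i => LinearMap.toContinuousLinearMap (b.coord i)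
  have key : ∀ S : V →L[ℝ] V →L[ℝ] ℝ, LinearMap.trace ℝ V (W.comp S).toLinearMap
      = ∑ i, ∑ j, S (b i) (b j) * ε i (W (ε j)) := fun S => by
    rw [trace_eq_sum b]
    refine Finset.sum_congr rfl fun i _ => ?_
    have : S (b i) = ∑ j, S (b i) (b j) • ε j := by
      ext v
      conv_lhs => rw [← b.sum_repr v]
      simp only [map_sum, map_smul, smul_eq_mul, sum_apply, smul_apply]
      exact Finset.sum_congr rfl fun j _ => mul_comm _ _
    change ε i (W (S (b i))) = _
    conv_lhs => rw [this]
    simp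
  rw [key, key, Finset.sum_comm, ← Finset.sum_neg_distrib]
  refine Finset.sum_congr rfl fun i _ => ?_
  rw [← Finset.sum_neg_distrib]
  refine Finset.sum_congr rfl fun j _ => ?_
  rw [hW (ε j)]
  simp

/-- The identity behind the fact that the Poisson tensor times the Liouville density has
vanishing divergence. -/
theorem trace_of_closed {W : (V →L[ℝ] ℝ) →L[ℝ] V} (hW : ∀ a c : V →L[ℝ] ℝ, a (W c) = -c (W a))
    {R : V →L[ℝ] V →L[ℝ] V →L[ℝ] ℝ} (halt : ∀ u v w, R u v w = -R u w v)
    (hcl : ∀ u v w, R u v w + R v w u + R w u v = 0) (u : V) :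
    LinearMap.trace ℝ V (W.comp (R u)).toLinearMap
      = 2 * LinearMap.trace ℝ V (W.comp (R.flip u)).toLinearMap := by
  -- Closedness writes R(u) as S - Sᵀ with S = R(·)(u). Against the antisymmetric W the two parts
  -- have opposite traces, which gives the factor 2.
  have h : R u = R.flip u - (R.flip u).flip := by
    ext v w
    simp only [sub_apply, ContinuousLinearMap.flip_apply]
    linarith [hcl u v w, halt v u w]
  have h2 := trace_comp_flip hW (R.flip u)
  rw [h, ContinuousLinearMap.comp_sub, ContinuousLinearMap.toLinearMap_sub, map_sub, h2]
  ring

theorem trace_weighted_field {ρ : V → ℝ} {Z : V → V} {y : V} (hρ : DifferentiableAt ℝ ρ y)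
    (hZ : DifferentiableAt ℝ Z y) :
    LinearMap.trace ℝ V (fderiv ℝ (fun x => ρ x • Z x) y).toLinearMap
      = fderiv ℝ ρ y (Z y) + ρ y * LinearMap.trace ℝ V (fderiv ℝ Z y).toLinearMap := by
  let b := Module.finBasis ℝ V
  rw [fderiv_fun_smul hρ hZ, trace_eq_sum b, trace_eq_sum b]
  have : fderiv ℝ ρ y (Z y) = ∑ i, b.coord i (Z y) * fderiv ℝ ρ y (b i) := by
    conv_lhs => rw [← b.sum_repr (Z y)]
    simp only [map_sum, map_smul, smul_eq_mul]
    rfl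
  rw [this, Finset.mul_sum, ← Finset.sum_add_distrib]
  refine Finset.sum_congr rfl fun i _ => ?_
  simp
  ring

/-- Divergence of P f W(b), with P the Liouville density and W = η⁻¹. Differentiating W produces
-tr(W Dη(·)(Wb)), which by `trace_of_closed` is -½ tr(W Dη(Wb)), and this cancels the derivative of
P along Wb. Only derivatives of f and b survive. Later b = dg gives the Poisson bracket and b =
-dg∘i gives the gradient. -/
theorem trace_hamiltonian_field {T : Set V} (hT : IsOpen T) {y : V} (hy : y ∈ T)
    {η : V → V →L[ℝ] V →L[ℝ] ℝ} {W : V → (V →L[ℝ] ℝ) →L[ℝ] V} {P f : V → ℝ} {b : V → V →L[ℝ] ℝ}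
    (hη : DifferentiableAt ℝ η y) (hWd : DifferentiableAt ℝ W y) (hP : DifferentiableAt ℝ P y)
    (hf : DifferentiableAt ℝ f y) (hb : DifferentiableAt ℝ b y)
    (hηW : ∀ x ∈ T, ∀ a, η x (W x a) = a) (hWη : ∀ u, W y (η y u) = u)
    (hW : ∀ a c : V →L[ℝ] ℝ, a (W y c) = -c (W y a))
    (halt : ∀ u v w, fderiv ℝ η y u v w = -fderiv ℝ η y u w v)
    (hcl : ∀ u v w, fderiv ℝ η y u v w + fderiv ℝ η y v w u + fderiv ℝ η y w u v = 0)
    (hPd : ∀ u, fderiv ℝ P y u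
      = P y * ((1 / 2) * LinearMap.trace ℝ V ((W y).comp (fderiv ℝ η y u)).toLinearMap)) :
    LinearMap.trace ℝ V (fderiv ℝ (fun x => (P x * f x) • W x (b x)) y).toLinearMap
      = P y * (fderiv ℝ f y (W y (b y))
        + f y * LinearMap.trace ℝ V ((W y).comp (fderiv ℝ b y)).toLinearMap) := by
  have hZ : DifferentiableAt ℝ (fun x => W x (b x)) y := hWd.clm_apply hb
  -- The derivative of the field is read off by differentiating η(W b) = b.
  have hη_Z : (fun x => η x (W x (b x))) =ᶠ[nhds y] b :=
    Filter.eventuallyEq_of_mem (hT.mem_nhds hy) fun x hx => hηW x hx _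
  have hDb := hη_Z.fderiv_eq (𝕜 := ℝ)
  rw [fderiv_clm_apply hη hZ] at hDb
  have hDZ : fderiv ℝ (fun x => W x (b x)) y
      = (W y).comp (fderiv ℝ b y) - (W y).comp ((fderiv ℝ η y).flip (W y (b y))) := by
    ext1 v
    have := congrArg (fun L : V →L[ℝ] V →L[ℝ] ℝ => W y (L v)) hDb
    simp only [add_apply, ContinuousLinearMap.comp_apply, ContinuousLinearMap.flip_apply,
      map_add, hWη] at this
    simp only [sub_apply, ContinuousLinearMap.comp_apply, ContinuousLinearMap.flip_apply, ← this]
    abel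
  have htr := trace_of_closed hW halt hcl (W y (b y))
  rw [trace_weighted_field (ρ := fun x => P x * f x) (hP.mul hf) hZ, hDZ,
    ContinuousLinearMap.toLinearMap_sub, map_sub, fderiv_fun_mul hP hf]
  simp only [add_apply, smul_apply, smul_eq_mul, hPd, htr]
  ring

end Divergence

/-! ### Charts of a complex manifold -/

section Charts

variable {n : ℕ} {X : Type*} [TopologicalSpace X] [ChartedSpace (Fin n → ℂ) X]
  [IsManifold 𝓘(ℂ, Fin n → ℂ) ω X]

variable (n X) in
theorem isManifold_real_one : IsManifold 𝓘(ℝ, Fin n → ℂ) 1 X :=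
  IsManifold.of_le (n := ∞) (WithTop.coe_le_coe.2 (le_top : (1 : ℕ∞) ≤ ⊤))

/-- The differential of a chart inverse. -/
def chartFrame (p : X) (y : Fin n → ℂ) : (Fin n → ℂ) →L[ℝ] (Fin n → ℂ) :=
  mfderiv 𝓘(ℝ, Fin n → ℂ) 𝓘(ℝ, Fin n → ℂ) (chartAt (Fin n → ℂ) p).symm y

omit [IsManifold 𝓘(ℂ, Fin n → ℂ) ω X] in
theorem inChart_eq_pull (η : X → BForm n) (p : X) (y : Fin n → ℂ) :
    inChart η p y = pull (chartFrame p y) (η ((chartAt (Fin n → ℂ) p).symm y)) := rfl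

theorem exists_equiv_chartFrame (p : X) {y : Fin n → ℂ}
    (hy : y ∈ (chartAt (Fin n → ℂ) p).target) :
    ∃ A : (Fin n → ℂ) ≃L[ℝ] (Fin n → ℂ), A.toContinuousLinearMap = chartFrame p y := by
  have := isManifold_real_one n X
  exact ⟨(mdifferentiable_chart (I := 𝓘(ℝ, Fin n → ℂ)) p).symm.mfderiv hy, rfl⟩

theorem contDiffOn_transition (p q : X) :
    ContDiffOn ℂ ω (chartAt (Fin n → ℂ) q ∘ (chartAt (Fin n → ℂ) p).symm)
      ((chartAt (Fin n → ℂ) p).symm.trans (chartAt (Fin n → ℂ) q)).source := by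
  have h := (contDiffGroupoid ω 𝓘(ℂ, Fin n → ℂ)).compatible
    (chart_mem_atlas (Fin n → ℂ) p) (chart_mem_atlas (Fin n → ℂ) q)
  rw [contDiffGroupoid, mem_groupoid_of_pregroupoid] at h
  have h1 : ContDiffOn ℂ ω _ _ := h.1
  simpa using h1

theorem contDiffOn_transition_real (p q : X) :
    ContDiffOn ℝ ∞ (chartAt (Fin n → ℂ) q ∘ (chartAt (Fin n → ℂ) p).symm)
      ((chartAt (Fin n → ℂ) p).symm.trans (chartAt (Fin n → ℂ) q)).source :=
  ((contDiffOn_transition p q).restrict_scalars ℝ).of_le le_top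

theorem fderiv_transition_I (p q : X) {y : Fin n → ℂ}
    (hy : y ∈ ((chartAt (Fin n → ℂ) p).symm.trans (chartAt (Fin n → ℂ) q)).source)
    (u : Fin n → ℂ) :
    fderiv ℝ (chartAt (Fin n → ℂ) q ∘ (chartAt (Fin n → ℂ) p).symm) y (Complex.I • u)
      = Complex.I • fderiv ℝ (chartAt (Fin n → ℂ) q ∘ (chartAt (Fin n → ℂ) p).symm) y u := by
  have hd : DifferentiableAt ℂ (chartAt (Fin n → ℂ) q ∘ (chartAt (Fin n → ℂ) p).symm) y :=
    ((contDiffOn_transition p q).contDiffAt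
      ((OpenPartialHomeomorph.open_source _).mem_nhds hy)).differentiableAt (by simp)
  rw [hd.fderiv_restrictScalars ℝ]
  exact map_smul (fderiv ℂ (chartAt (Fin n → ℂ) q ∘ (chartAt (Fin n → ℂ) p).symm) y) Complex.I u

/-- The tangent space at x is trivialised by the preferred chart of x itself, so the frame is the
derivative of a transition map into a chart that changes with y. The frame need not be continuous in
y; only the forms read in a fixed chart are treated as smooth. -/
theorem chartFrame_eq (p : X) {y : Fin n → ℂ} (hy : y ∈ (chartAt (Fin n → ℂ) p).target) :
    chartFrame p y = fderiv ℝ (chartAt (Fin n → ℂ) ((chartAt (Fin n → ℂ) p).symm y)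
          ∘ (chartAt (Fin n → ℂ) p).symm) y := by
  have := isManifold_real_one n X
  have hd : MDifferentiableAt 𝓘(ℝ, Fin n → ℂ) 𝓘(ℝ, Fin n → ℂ) (chartAt (Fin n → ℂ) p).symm y :=
    mdifferentiableAt_atlas_symm (chart_mem_atlas _ p) hy
  rw [chartFrame, hd.mfderiv, ← fderivWithin_univ]
  simp only [writtenInExtChartAt, extChartAt, OpenPartialHomeomorph.extend,
    modelWithCornersSelf_partialEquiv, PartialEquiv.trans_refl, modelWithCornersSelf_coe,
    Set.range_id]
  rfl

omit [IsManifold 𝓘(ℂ, Fin n → ℂ) ω X] in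
theorem mem_transition_source (p q : X) {y : Fin n → ℂ}
    (hy : y ∈ (chartAt (Fin n → ℂ) p).target)
    (hq : (chartAt (Fin n → ℂ) p).symm y ∈ (chartAt (Fin n → ℂ) q).source) :
    y ∈ ((chartAt (Fin n → ℂ) p).symm.trans (chartAt (Fin n → ℂ) q)).source := by
  simp [hy, hq]

theorem chartFrame_I (p : X) {y : Fin n → ℂ} (hy : y ∈ (chartAt (Fin n → ℂ) p).target)
    (u : Fin n → ℂ) : chartFrame p y (Complex.I • u) = Complex.I • chartFrame p y u := by
  rw [chartFrame_eq p hy]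
  exact fderiv_transition_I p _ (mem_transition_source p _ hy (mem_chart_source _ _)) u

theorem fderiv_chart {f : X → ℝ} (p : X) {y : Fin n → ℂ}
    (hy : y ∈ (chartAt (Fin n → ℂ) p).target)
    (hf : MDifferentiableAt 𝓘(ℝ, Fin n → ℂ) 𝓘(ℝ, ℝ) f ((chartAt (Fin n → ℂ) p).symm y)) :
    fderiv ℝ (f ∘ (chartAt (Fin n → ℂ) p).symm) y
      = (dAt n f ((chartAt (Fin n → ℂ) p).symm y)).comp (chartFrame p y) := by
  have := isManifold_real_one n X
  rw [← mfderiv_eq_fderiv, mfderiv_comp y hf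
    (mdifferentiableAt_atlas_symm (chart_mem_atlas _ p) hy)]
  rfl

/-- The expression `i∂∂̄` of a Hessian. -/
def ddc (n : ℕ) (B : BForm n) : BForm n :=
  (1 / 2 : ℝ) • (B.flip.bilinearComp (cplxJ n) (ContinuousLinearMap.id ℝ _)
    - B.bilinearComp (ContinuousLinearMap.id ℝ _) (cplxJ n))

theorem ddc_apply (B : BForm n) (u v : Fin n → ℂ) :
    ddc n B u v = (B v (Complex.I • u) - B u (Complex.I • v)) / 2 := by
  simp [ddc]
  ring

theorem ddc_isOneOne {B : BForm n} (hB : ∀ u v, B u v = B v u) : IsOneOne (ddc n B) := by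
  refine ⟨fun u => by simp [ddc_apply], fun u v => ?_⟩
  simp only [ddc_apply, I_smul_I_smul, map_neg]
  rw [hB (Complex.I • v), hB (Complex.I • u)]
  ring

omit [IsManifold 𝓘(ℂ, Fin n → ℂ) ω X] in
theorem iddbar_eq (φ : X → ℝ) (x : X) :
    iddbar n φ x = ddc n (fderiv ℝ (fderiv ℝ (φ ∘ (chartAt (Fin n → ℂ) x).symm))
      (chartAt (Fin n → ℂ) x x)) := rfl

theorem infty_two : (2 : ℕ∞ω) ≤ ∞ := WithTop.coe_le_coe.2 (le_top : (2 : ℕ∞) ≤ ⊤)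

theorem contDiffOn_chart {f : X → ℝ} (hf : ContMDiff 𝓘(ℝ, Fin n → ℂ) 𝓘(ℝ, ℝ) ∞ f) (p : X) :
    ContDiffOn ℝ ∞ (f ∘ (chartAt (Fin n → ℂ) p).symm) (chartAt (Fin n → ℂ) p).target :=
  contMDiffOn_iff_contDiffOn.1
    (hf.comp_contMDiffOn (contMDiffOn_chart_symm (I := 𝓘(ℝ, Fin n → ℂ))))

theorem contMDiff_of_contDiffOn_chart {f : X → ℝ} (hf : ∀ p : X,
    ContDiffOn ℝ ∞ (f ∘ (chartAt (Fin n → ℂ) p).symm) (chartAt (Fin n → ℂ) p).target) :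
    ContMDiff 𝓘(ℝ, Fin n → ℂ) 𝓘(ℝ, ℝ) ∞ f := by
  intro x
  have h1 : ContMDiffAt 𝓘(ℝ, Fin n → ℂ) 𝓘(ℝ, ℝ) ∞ (f ∘ (chartAt (Fin n → ℂ) x).symm)
      (chartAt (Fin n → ℂ) x x) :=
    contMDiffAt_iff_contDiffAt.2 ((hf x).contDiffAt
      ((chartAt (Fin n → ℂ) x).open_target.mem_nhds (mem_chart_target _ x)))
  have h2 : ContMDiffAt 𝓘(ℝ, Fin n → ℂ) 𝓘(ℝ, Fin n → ℂ) ∞ (chartAt (Fin n → ℂ) x) x :=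
    (contMDiffOn_chart (I := 𝓘(ℝ, Fin n → ℂ))).contMDiffAt
      ((chartAt (Fin n → ℂ) x).open_source.mem_nhds (mem_chart_source _ x))
  refine (h1.comp x h2).congr_of_eventuallyEq ?_
  filter_upwards [(chartAt (Fin n → ℂ) x).open_source.mem_nhds (mem_chart_source _ x)] with z hz
  simp [(chartAt (Fin n → ℂ) x).left_inv hz]

/-- Second derivatives of a composition. -/
theorem fderiv_fderiv_comp {V V' : Type*} [NormedAddCommGroup V] [NormedSpace ℝ V]
    [NormedAddCommGroup V'] [NormedSpace ℝ V'] {g : V' → ℝ} {τ : V → V'} {y : V}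
    (hg : ContDiffAt ℝ ∞ g (τ y)) (hτ : ContDiffAt ℝ ∞ τ y) (u v : V) :
    fderiv ℝ (fderiv ℝ (g ∘ τ)) y u v
      = fderiv ℝ (fderiv ℝ g) (τ y) (fderiv ℝ τ y u) (fderiv ℝ τ y v)
        + fderiv ℝ g (τ y) (fderiv ℝ (fderiv ℝ τ) y u v) := by
  have hg1 : ∀ᶠ x in nhds y, DifferentiableAt ℝ g (τ x) := by
    have := hτ.continuousAt.eventually ((hg.of_le infty_two).eventually (by simp))
    filter_upwards [this] with x hx using hx.differentiableAt (by simp)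
  have hτ1 : ∀ᶠ x in nhds y, DifferentiableAt ℝ τ x := by
    filter_upwards [(hτ.of_le infty_two).eventually (by simp)] with x hx
      using hx.differentiableAt (by simp)
  have hev : fderiv ℝ (g ∘ τ) =ᶠ[nhds y] fun x => (fderiv ℝ g (τ x)).comp (fderiv ℝ τ x) := by
    filter_upwards [hg1, hτ1] with x hx hx' using fderiv_comp x hx hx'
  have hdg : DifferentiableAt ℝ (fderiv ℝ g) (τ y) :=
    (hg.fderiv_right (m := 1) infty_two).differentiableAt (by simp)
  have hdτ : DifferentiableAt ℝ (fderiv ℝ τ) y :=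
    (hτ.fderiv_right (m := 1) infty_two).differentiableAt (by simp)
  have h1 := (hdg.hasFDerivAt.comp y (hτ.differentiableAt (by simp)).hasFDerivAt).clm_comp
    hdτ.hasFDerivAt
  rw [hev.fderiv_eq]
  refine (congrArg (fun L : V →L[ℝ] V →L[ℝ] ℝ => L u v) h1.fderiv).trans ?_
  simp
  ring

theorem fderiv_fderiv_I {τ : (Fin n → ℂ) → (Fin n → ℂ)} {y : Fin n → ℂ}
    (hτ : ContDiffAt ℝ ∞ τ y)
    (hI : ∀ᶠ x in nhds y, ∀ u, fderiv ℝ τ x (Complex.I • u) = Complex.I • fderiv ℝ τ x u)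
    (u v : Fin n → ℂ) :
    fderiv ℝ (fderiv ℝ τ) y u (Complex.I • v) = Complex.I • fderiv ℝ (fderiv ℝ τ) y u v := by
  have hdτ : DifferentiableAt ℝ (fderiv ℝ τ) y :=
    (hτ.fderiv_right (m := 1) infty_two).differentiableAt (by simp)
  have h1 := hdτ.hasFDerivAt.clm_apply (hasFDerivAt_const (Complex.I • v) y)
  have h2 := ((cplxJ n).hasFDerivAt (x := fderiv ℝ τ y v)).comp y
    (hdτ.hasFDerivAt.clm_apply (hasFDerivAt_const v y))
  have hev : (fun x => fderiv ℝ τ x (Complex.I • v))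
      =ᶠ[nhds y] (fun w => cplxJ n w) ∘ fun x => fderiv ℝ τ x v := by
    filter_upwards [hI] with x hx using hx v
  have := congrArg (fun L : (Fin n → ℂ) →L[ℝ] (Fin n → ℂ) => L u)
    (h1.unique (h2.congr_of_eventuallyEq hev))
  simpa using this

/-- The chain rule adds terms dg(D²τ(v, iu)) and -dg(D²τ(u, iv)). They cancel because D²τ is
symmetric and complex linear in each slot, the map τ being holomorphic. -/
theorem ddc_comp {g : (Fin n → ℂ) → ℝ} {τ : (Fin n → ℂ) → (Fin n → ℂ)} {y : Fin n → ℂ}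
    (hg : ContDiffAt ℝ ∞ g (τ y)) (hτ : ContDiffAt ℝ ∞ τ y)
    (hI : ∀ᶠ x in nhds y, ∀ u, fderiv ℝ τ x (Complex.I • u) = Complex.I • fderiv ℝ τ x u) :
    ddc n (fderiv ℝ (fderiv ℝ (g ∘ τ)) y)
      = pull (fderiv ℝ τ y) (ddc n (fderiv ℝ (fderiv ℝ g) (τ y))) := by
  have hsym : ∀ u v, fderiv ℝ (fderiv ℝ τ) y u v = fderiv ℝ (fderiv ℝ τ) y v u :=
    (hτ.isSymmSndFDerivAt (by simp; exact infty_two)).eq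
  ext u v
  simp only [ddc_apply, pull_apply, fderiv_fderiv_comp hg hτ, hI.self_of_nhds,
    fderiv_fderiv_I hτ hI, hsym v u]
  ring

/-- The definition of `iddbar` uses a different chart at each point. Holomorphic invariance replaces
all of them near a point by the single chart at `p`, where smoothness in y is visible. -/
theorem inChart_iddbar {φ : X → ℝ} (hφ : ContMDiff 𝓘(ℝ, Fin n → ℂ) 𝓘(ℝ, ℝ) ∞ φ) (p : X)
    {y : Fin n → ℂ} (hy : y ∈ (chartAt (Fin n → ℂ) p).target) :
    inChart (iddbar n φ) p y
      = ddc n (fderiv ℝ (fderiv ℝ (φ ∘ (chartAt (Fin n → ℂ) p).symm)) y) := by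
  have hA := chartFrame_eq p hy
  set x := (chartAt (Fin n → ℂ) p).symm y with hx
  have hyx := mem_transition_source p x hy (mem_chart_source _ x)
  have hopen := ((chartAt (Fin n → ℂ) p).symm.trans (chartAt (Fin n → ℂ) x)).open_source
  have hev : φ ∘ (chartAt (Fin n → ℂ) p).symm =ᶠ[nhds y]
      (φ ∘ (chartAt (Fin n → ℂ) x).symm)
        ∘ (chartAt (Fin n → ℂ) x ∘ (chartAt (Fin n → ℂ) p).symm) := by
    filter_upwards [hopen.mem_nhds hyx] with z hz
    rw [OpenPartialHomeomorph.trans_source] at hz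
    simp [(chartAt (Fin n → ℂ) x).left_inv hz.2]
  have hτy : (chartAt (Fin n → ℂ) x ∘ (chartAt (Fin n → ℂ) p).symm) y = chartAt (Fin n → ℂ) x x :=
    by simp [hx]
  rw [hev.fderiv.fderiv_eq, ddc_comp, inChart_eq_pull, iddbar_eq, hτy, hA]
  · rw [hτy]
    exact (contDiffOn_chart hφ x).contDiffAt
      ((chartAt (Fin n → ℂ) x).open_target.mem_nhds (mem_chart_target _ x))
  · exact (contDiffOn_transition_real p x).contDiffAt (hopen.mem_nhds hyx)
  · filter_upwards [hopen.mem_nhds hyx] with z hz using fderiv_transition_I p x hz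

theorem chartFrame_transition (p q : X) {y : Fin n → ℂ}
    (hy : y ∈ ((chartAt (Fin n → ℂ) p).symm.trans (chartAt (Fin n → ℂ) q)).source) :
    chartFrame p y = (chartFrame q ((chartAt (Fin n → ℂ) q) ((chartAt (Fin n → ℂ) p).symm y))).comp
      (fderiv ℝ (chartAt (Fin n → ℂ) q ∘ (chartAt (Fin n → ℂ) p).symm) y) := by
  have hopen := ((chartAt (Fin n → ℂ) p).symm.trans (chartAt (Fin n → ℂ) q)).open_source
  have hs := hy
  rw [OpenPartialHomeomorph.trans_source] at hs
  have hq : (chartAt (Fin n → ℂ) q) ((chartAt (Fin n → ℂ) p).symm y)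
      ∈ (chartAt (Fin n → ℂ) q).target := (chartAt (Fin n → ℂ) q).map_source hs.2
  have hx : (chartAt (Fin n → ℂ) q).symm ((chartAt (Fin n → ℂ) q)
      ((chartAt (Fin n → ℂ) p).symm y)) = (chartAt (Fin n → ℂ) p).symm y :=
    (chartAt (Fin n → ℂ) q).left_inv hs.2
  rw [chartFrame_eq p hs.1, chartFrame_eq q hq, hx]
  set x := (chartAt (Fin n → ℂ) p).symm y
  have hev : chartAt (Fin n → ℂ) x ∘ (chartAt (Fin n → ℂ) p).symm =ᶠ[nhds y]
      (chartAt (Fin n → ℂ) x ∘ (chartAt (Fin n → ℂ) q).symm)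
        ∘ (chartAt (Fin n → ℂ) q ∘ (chartAt (Fin n → ℂ) p).symm) := by
    filter_upwards [hopen.mem_nhds hy] with z hz
    rw [OpenPartialHomeomorph.trans_source] at hz
    simp [(chartAt (Fin n → ℂ) q).left_inv hz.2]
  rw [hev.fderiv_eq]
  exact fderiv_comp y ((contDiffOn_transition_real q x).differentiableAt_of_isOpen
      (OpenPartialHomeomorph.open_source _)
      (mem_transition_source q x hq (by rw [Function.comp_apply, hx]; exact mem_chart_source _ x)))
    ((contDiffOn_transition_real p q).differentiableAt_of_isOpen hopen hy)

/-- The expressions of a field of forms in two charts. -/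
theorem inChart_transition (η : X → BForm n) (p q : X) {y : Fin n → ℂ}
    (hy : y ∈ ((chartAt (Fin n → ℂ) p).symm.trans (chartAt (Fin n → ℂ) q)).source) :
    inChart η p y = pull (fderiv ℝ (chartAt (Fin n → ℂ) q ∘ (chartAt (Fin n → ℂ) p).symm) y)
      (inChart η q ((chartAt (Fin n → ℂ) q) ((chartAt (Fin n → ℂ) p).symm y))) := by
  have hs := hy
  rw [OpenPartialHomeomorph.trans_source] at hs
  rw [inChart_eq_pull, inChart_eq_pull, chartFrame_transition p q hy,
    (chartAt (Fin n → ℂ) q).left_inv hs.2, pull_pull]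

end Charts

/-! ### Smooth families of functions -/

section Families

variable {n : ℕ} {X : Type*} [TopologicalSpace X] [ChartedSpace (Fin n → ℂ) X]
  {E : Type*} [NormedAddCommGroup E] [NormedSpace ℝ E]
  {E' : Type*} [NormedAddCommGroup E'] [NormedSpace ℝ E']

variable (n) in
/-- A family of functions on `X` depending smoothly on a parameter `w ∈ W`. -/
def SmoothFam (W : Set E) (f : E → X → ℝ) : Prop :=
  ∀ p : X, ContDiffOn ℝ ∞
    (fun q : E × (Fin n → ℂ) => f q.1 ((chartAt (Fin n → ℂ) p).symm q.2))
    (W ×ˢ (chartAt (Fin n → ℂ) p).target)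

/-- The derivative of a family in the direction `v` of the space of parameters. -/
def famDeriv (f : E → X → ℝ) (v : E) : E → X → ℝ :=
  fun w x => fderiv ℝ (fun w' => f w' x) w v

variable {W : Set E} {f g : E → X → ℝ}

theorem SmoothFam.slice_chart (hf : SmoothFam n W f) {w : E} (hw : w ∈ W) (p : X) :
    ContDiffOn ℝ ∞ (f w ∘ (chartAt (Fin n → ℂ) p).symm) (chartAt (Fin n → ℂ) p).target :=
  (hf p).comp (contDiff_prodMk_right w).contDiffOn fun _ hy => ⟨hw, hy⟩

theorem SmoothFam.add (hf : SmoothFam n W f) (hg : SmoothFam n W g) :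
    SmoothFam n W fun w x => f w x + g w x := fun p => (hf p).add (hg p)

theorem SmoothFam.sub (hf : SmoothFam n W f) (hg : SmoothFam n W g) :
    SmoothFam n W fun w x => f w x - g w x := fun p => (hf p).sub (hg p)

theorem SmoothFam.mul (hf : SmoothFam n W f) (hg : SmoothFam n W g) :
    SmoothFam n W fun w x => f w x * g w x := fun p => (hf p).mul (hg p)

theorem SmoothFam.scalar_mul {c : E → ℝ} (hc : ContDiffOn ℝ ∞ c W) (hg : SmoothFam n W g) :
    SmoothFam n W fun w x => c w * g w x := fun p =>
  (hc.comp contDiff_fst.contDiffOn fun _ hq => hq.1).mul (hg p)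

theorem SmoothFam.sum {ι : Type*} {s : Finset ι} {h : ι → E → X → ℝ}
    (hh : ∀ i ∈ s, SmoothFam n W (h i)) : SmoothFam n W fun w x => ∑ i ∈ s, h i w x :=
  fun p => ContDiffOn.sum fun i hi => hh i hi p

theorem SmoothFam.comp {W' : Set E'} {c : E' → E} (hf : SmoothFam n W f)
    (hc : ContDiffOn ℝ ∞ c W') (hm : Set.MapsTo c W' W) : SmoothFam n W' fun w => f (c w) :=
  fun p => ContDiffOn.comp (g := fun q : E × (Fin n → ℂ) =>
      f q.1 ((chartAt (Fin n → ℂ) p).symm q.2)) (hf p)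
    ((hc.comp contDiff_fst.contDiffOn fun q (hq : q ∈ W' ×ˢ _) => hq.1).prodMk
      contDiff_snd.contDiffOn) fun _ hq => ⟨hm hq.1, hq.2⟩

theorem SmoothFam.mono {W' : Set E} (hf : SmoothFam n W f) (h : W' ⊆ W) : SmoothFam n W' f :=
  fun p => (hf p).mono (Set.prod_mono_left h)

theorem SmoothFam.congr (hf : SmoothFam n W f) (h : ∀ w ∈ W, ∀ x, g w x = f w x) :
    SmoothFam n W g := fun p => (hf p).congr fun q hq => h q.1 hq.1 _

theorem SmoothFam.famDeriv (hf : SmoothFam n W f) (hW : IsOpen W) (v : E) :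
    SmoothFam n W (famDeriv f v) := fun p =>
  contDiffOn_fderiv_fst (hW.prod (chartAt (Fin n → ℂ) p).open_target) (hf p) v

theorem SmoothFam.contDiffOn_param (hf : SmoothFam n W f) (x : X) :
    ContDiffOn ℝ ∞ (fun w => f w x) W := by
  have h : ContDiff ℝ ∞ fun w : E => (w, chartAt (Fin n → ℂ) x x) := contDiff_prodMk_left _
  have := (hf x).comp h.contDiffOn fun w hw => ⟨hw, mem_chart_target (Fin n → ℂ) x⟩
  simpa [Function.comp_def] using this

theorem SmoothFam.hasFDerivAt (hf : SmoothFam n W f) (hW : IsOpen W) {w : E} (hw : w ∈ W) (x : X) :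
    HasFDerivAt (fun w => f w x) (fderiv ℝ (fun w => f w x) w) w :=
  ((hf.contDiffOn_param x).differentiableAt_of_isOpen hW hw).hasFDerivAt

theorem SmoothFam.famDeriv_comm (hf : SmoothFam n W f) (hW : IsOpen W) (u v : E) {w : E}
    (hw : w ∈ W) (x : X) :
    WZW.famDeriv (WZW.famDeriv f u) v w x = WZW.famDeriv (WZW.famDeriv f v) u w x := by
  have hc := (hf.contDiffOn_param x).contDiffAt (hW.mem_nhds hw)
  have hd : DifferentiableAt ℝ (fderiv ℝ fun w => f w x) w :=
    (hc.fderiv_right (m := 1) infty_two).differentiableAt (by simp)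
  have key : ∀ u v, WZW.famDeriv (WZW.famDeriv f u) v w x
      = fderiv ℝ (fderiv ℝ fun w => f w x) w v u := fun u v =>
    (congrArg (fun L : E →L[ℝ] ℝ => L v)
      (hd.hasFDerivAt.clm_apply (hasFDerivAt_const u w)).fderiv).trans (by simp)
  rw [key, key]
  exact (hc.isSymmSndFDerivAt (by simp; exact infty_two)).eq v u

theorem smoothFam_of_contMDiffOn {F : E → X → ℝ} [IsManifold 𝓘(ℂ, Fin n → ℂ) ω X]
    (hF : ContMDiffOn (𝓘(ℝ, E).prod 𝓘(ℝ, Fin n → ℂ)) 𝓘(ℝ, ℝ) ∞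
      (fun q : E × X => F q.1 q.2) (W ×ˢ Set.univ)) : SmoothFam n W F := by
  intro p
  have h1 : ContMDiffOn 𝓘(ℝ, E × (Fin n → ℂ)) (𝓘(ℝ, E).prod 𝓘(ℝ, Fin n → ℂ)) ∞
      (fun q : E × (Fin n → ℂ) => (q.1, (chartAt (Fin n → ℂ) p).symm q.2))
      (W ×ˢ (chartAt (Fin n → ℂ) p).target) := by
    refine ContMDiffOn.prodMk (contDiff_fst.contDiffOn.contMDiffOn) ?_
    exact (contMDiffOn_chart_symm (I := 𝓘(ℝ, Fin n → ℂ)) (n := ∞)).comp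
      (contDiff_snd.contDiffOn.contMDiffOn) fun q hq => hq.2
  exact contMDiffOn_iff_contDiffOn.1 (hF.comp h1 fun q hq => ⟨hq.1, trivial⟩)

theorem SmoothFam.contMDiffOn [IsManifold 𝓘(ℂ, Fin n → ℂ) ω X] (hf : SmoothFam n W f)
    (hW : IsOpen W) : ContMDiffOn (𝓘(ℝ, E).prod 𝓘(ℝ, Fin n → ℂ)) 𝓘(ℝ, ℝ) ∞
      (fun q : E × X => f q.1 q.2) (W ×ˢ Set.univ) := by
  rintro ⟨w, x⟩ ⟨hw, -⟩
  refine ContMDiffAt.contMDiffWithinAt ?_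
  have h1 : ContMDiffAt 𝓘(ℝ, E × (Fin n → ℂ)) 𝓘(ℝ, ℝ) ∞
      (fun q : E × (Fin n → ℂ) => f q.1 ((chartAt (Fin n → ℂ) x).symm q.2))
      (w, chartAt (Fin n → ℂ) x x) :=
    contMDiffAt_iff_contDiffAt.2 ((hf x).contDiffAt
      ((hW.prod (chartAt (Fin n → ℂ) x).open_target).mem_nhds ⟨hw, mem_chart_target _ x⟩))
  have h2 : ContMDiffAt (𝓘(ℝ, E).prod 𝓘(ℝ, Fin n → ℂ)) 𝓘(ℝ, E × (Fin n → ℂ)) ∞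
      (fun q : E × X => (q.1, chartAt (Fin n → ℂ) x q.2)) (w, x) := by
    refine ContMDiffAt.prodMk_space contMDiffAt_fst ?_
    exact ((contMDiffOn_chart (I := 𝓘(ℝ, Fin n → ℂ))).contMDiffAt
      ((chartAt (Fin n → ℂ) x).open_source.mem_nhds (mem_chart_source _ x))).comp (w, x)
      contMDiffAt_snd
  refine (h1.comp (w, x) h2).congr_of_eventuallyEq ?_
  have : ∀ᶠ q : E × X in nhds (w, x), q.2 ∈ (chartAt (Fin n → ℂ) x).source :=
    continuous_snd.continuousAt.eventually
      ((chartAt (Fin n → ℂ) x).open_source.mem_nhds (mem_chart_source _ x))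
  filter_upwards [this] with q hq
  simp [(chartAt (Fin n → ℂ) x).left_inv hq]

variable [IsManifold 𝓘(ℂ, Fin n → ℂ) ω X]

theorem SmoothFam.slice (hf : SmoothFam n W f) {w : E} (hw : w ∈ W) :
    ContMDiff 𝓘(ℝ, Fin n → ℂ) 𝓘(ℝ, ℝ) ∞ (f w) :=
  contMDiff_of_contDiffOn_chart fun p => hf.slice_chart hw p

theorem SmoothFam.const {h : X → ℝ} (hh : ContMDiff 𝓘(ℝ, Fin n → ℂ) 𝓘(ℝ, ℝ) ∞ h) :
    SmoothFam n W fun _ => h := fun p =>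
  ContDiffOn.comp (g := h ∘ (chartAt (Fin n → ℂ) p).symm) (contDiffOn_chart hh p)
    contDiff_snd.contDiffOn fun _ hq => hq.2

/-- With a dummy real parameter, statements about smooth families specialise to statements about
single functions. -/
theorem smoothFam_const_iff {h : X → ℝ} :
    SmoothFam n (Set.univ : Set ℝ) (fun _ => h) ↔ ContMDiff 𝓘(ℝ, Fin n → ℂ) 𝓘(ℝ, ℝ) ∞ h :=
  ⟨fun H => H.slice (Set.mem_univ 0), SmoothFam.const⟩

end Families

/-! ### Kähler forms of families of potentials -/

section Generic

variable {Z F G : Type*} [NormedAddCommGroup Z] [NormedSpace ℝ Z] [NormedAddCommGroup F]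
  [NormedSpace ℝ F] [NormedAddCommGroup G] [NormedSpace ℝ G]

theorem contDiff_linear [FiniteDimensional ℝ F] (L : F →ₗ[ℝ] G) : ContDiff ℝ ∞ L :=
  (LinearMap.toContinuousLinearMap L).contDiff

theorem fderiv_linear_comp [FiniteDimensional ℝ F] (L : F →ₗ[ℝ] G) {B : Z → F} {z : Z}
    (hB : DifferentiableAt ℝ B z) (v : Z) :
    fderiv ℝ (fun z => L (B z)) z v = L (fderiv ℝ B z v) :=
  congrArg (fun M : Z →L[ℝ] G => M v)
    ((LinearMap.toContinuousLinearMap L).hasFDerivAt.comp z hB.hasFDerivAt).fderiv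

theorem fderiv_comp_apply {h : F → G} {B : Z → F} {z : Z} (hh : DifferentiableAt ℝ h (B z))
    (hB : DifferentiableAt ℝ B z) (v : Z) :
    fderiv ℝ (fun z => h (B z)) z v = fderiv ℝ h (B z) (fderiv ℝ B z v) :=
  congrArg (fun M : Z →L[ℝ] G => M v) (hh.hasFDerivAt.comp z hB.hasFDerivAt).fderiv

theorem fderiv_add_apply {a b : Z → F} {z : Z} (ha : DifferentiableAt ℝ a z)
    (hb : DifferentiableAt ℝ b z) (v : Z) :
    fderiv ℝ (fun z => a z + b z) z v = fderiv ℝ a z v + fderiv ℝ b z v :=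
  congrArg (fun M : Z →L[ℝ] F => M v) (ha.hasFDerivAt.add hb.hasFDerivAt).fderiv

theorem fderiv_const_add_apply (c : F) {b : Z → F} {z : Z} (v : Z) :
    fderiv ℝ (fun z => c + b z) z v = fderiv ℝ b z v := by rw [fderiv_const_add]

end Generic

/-! ### Differentiating and inverting functions with values in (1,1)-forms. -/

section FormCalculus

variable {n : ℕ}

/-- `ddc` as a linear map. -/
def ddcLin (n : ℕ) : BForm n →ₗ[ℝ] BForm n where
  toFun := ddc n
  map_add' B C := by ext u v; simp [ddc_apply]; ring
  map_smul' c B := by ext u v; simp [ddc_apply]; ring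

theorem contDiff_ddc : ContDiff ℝ ∞ (ddc n) :=
  contDiff_linear (F := BForm n) (G := BForm n) (ddcLin n)

theorem fderiv_ddc_comp {Z : Type*} [NormedAddCommGroup Z] [NormedSpace ℝ Z] {B : Z → BForm n}
    {z : Z} (hB : DifferentiableAt ℝ B z) (v : Z) :
    fderiv ℝ (fun z => ddc n (B z)) z v = ddc n (fderiv ℝ B z v) :=
  fderiv_linear_comp (F := BForm n) (G := BForm n) (ddcLin n) hB v

theorem fderiv_apply₂ {Z V V' : Type*} [NormedAddCommGroup Z] [NormedSpace ℝ Z]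
    [NormedAddCommGroup V] [NormedSpace ℝ V] [NormedAddCommGroup V'] [NormedSpace ℝ V']
    {B : Z → V →L[ℝ] V' →L[ℝ] ℝ}
    {z : Z} (hB : DifferentiableAt ℝ B z) (v : Z) (a : V) (b : V') :
    fderiv ℝ (fun z => B z a b) z v = fderiv ℝ B z v a b := by
  have := (hB.hasFDerivAt.clm_apply (hasFDerivAt_const a z)).clm_apply (hasFDerivAt_const b z)
  refine (congrArg (fun L : Z →L[ℝ] ℝ => L v) this.fderiv).trans ?_
  simp

/-- Being alternating and of type (1,1) are linear conditions, so they pass to derivatives. This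
makes `IsPositive.fderiv_topPower` applicable to families of forms. -/
theorem isOneOne_fderiv {Z : Type*} [NormedAddCommGroup Z] [NormedSpace ℝ Z] {B : Z → BForm n}
    {z : Z} (hB : DifferentiableAt ℝ B z) (h : ∀ᶠ x in nhds z, IsOneOne (B x)) (v : Z) :
    IsOneOne (fderiv ℝ B z v) := by
  refine ⟨fun u => ?_, fun u w => ?_⟩
  · rw [← fderiv_apply₂ hB]
    have : (fun x => B x u u) =ᶠ[nhds z] fun _ => 0 := by
      filter_upwards [h] with x hx using hx.alternating u
    rw [this.fderiv_eq]
    simp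
  · rw [← fderiv_apply₂ hB, ← fderiv_apply₂ hB]
    have : (fun x => B x (Complex.I • u) (Complex.I • w)) =ᶠ[nhds z] fun x => B x u w := by
      filter_upwards [h] with x hx using hx.type_one_one u w
    rw [this.fderiv_eq]

theorem fderiv_topPower_comp {Z : Type*} [NormedAddCommGroup Z] [NormedSpace ℝ Z]
    {B : Z → BForm n} {z : Z} (hB : DifferentiableAt ℝ B z) (hp : IsPositive (B z))
    (h : ∀ᶠ x in nhds z, IsOneOne (B x)) (v : Z) :
    fderiv ℝ (fun x => topPower (B x)) z v
      = topPower (B z) * contr (B z) (fderiv ℝ B z v) := by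
  have hd : DifferentiableAt ℝ topPower (B z) := contDiff_topPower.differentiable (by simp) _
  rw [← hp.fderiv_topPower (isOneOne_fderiv hB h v)]
  exact fderiv_comp_apply (F := BForm n) hd hB v

theorem contDiffOn_inverse {Z : Type*} [NormedAddCommGroup Z] [NormedSpace ℝ Z]
    {B : Z → BForm n} {U : Set Z} (hB : ContDiffOn ℝ ∞ B U) (hp : ∀ z ∈ U, IsPositive (B z)) :
    ContDiffOn ℝ ∞ (fun z => (B z).inverse) U := fun z hz =>
  ContDiffAt.comp_contDiffWithinAt (g := fun β : BForm n => β.inverse) z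
    (hp z hz).contDiffAt_inverse (hB z hz)

theorem contDiffOn_bracketR {Z : Type*} [NormedAddCommGroup Z] [NormedSpace ℝ Z]
    {B : Z → BForm n} {U : Set Z} {a b : Z → (Fin n → ℂ) →L[ℝ] ℝ} (hB : ContDiffOn ℝ ∞ B U)
    (hp : ∀ z ∈ U, IsPositive (B z)) (ha : ContDiffOn ℝ ∞ a U) (hb : ContDiffOn ℝ ∞ b U) :
    ContDiffOn ℝ ∞ (fun z => bracketR (B z) (a z) (b z)) U :=
  (ha.clm_apply ((contDiffOn_inverse hB hp).clm_apply hb)).congr fun z hz =>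
    (hp z hz).bracketR_eq _ _

theorem contDiffOn_dotR {Z : Type*} [NormedAddCommGroup Z] [NormedSpace ℝ Z]
    {B : Z → BForm n} {U : Set Z} {a b : Z → (Fin n → ℂ) →L[ℝ] ℝ} (hB : ContDiffOn ℝ ∞ B U)
    (hp : ∀ z ∈ U, IsPositive (B z)) (ha : ContDiffOn ℝ ∞ a U) (hb : ContDiffOn ℝ ∞ b U) :
    ContDiffOn ℝ ∞ (fun z => dotR (B z) (a z) (b z)) U :=
  ha.clm_apply ((contDiffOn_inverse hB hp).clm_apply (hb.clm_comp contDiffOn_const).neg)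

theorem contDiffOn_contr {Z : Type*} [NormedAddCommGroup Z] [NormedSpace ℝ Z]
    {B C : Z → BForm n} {U : Set Z} (hB : ContDiffOn ℝ ∞ B U)
    (hp : ∀ z ∈ U, IsPositive (B z)) (hC : ContDiffOn ℝ ∞ C U) :
    ContDiffOn ℝ ∞ (fun z => contr (B z) (C z)) U := by
  simp only [contr, trace_eq_sum (realBasis n)]
  refine contDiffOn_const.mul (ContDiffOn.sum fun i _ => ?_)
  exact (LinearMap.toContinuousLinearMap ((realBasis n).coord i)).contDiff.comp_contDiffOn
    ((contDiffOn_inverse hB hp).clm_apply (hC.clm_apply contDiffOn_const))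

end FormCalculus

/-! ### Laplacian, gradient and bracket of ω_φ, and their smoothness along families of potentials.
-/

section KahlerFamilies

variable {n : ℕ} {X : Type*} [TopologicalSpace X] [ChartedSpace (Fin n → ℂ) X]
  [IsManifold 𝓘(ℂ, Fin n → ℂ) ω X] (K : KahlerForm n X)

/-- The Laplacian of `ω_φ`, normalised by `n i∂∂̄f ∧ ω_φⁿ⁻¹ = (lap f) ω_φⁿ`. -/
def KahlerForm.lap (K : KahlerForm n X) (φ f : X → ℝ) (x : X) : ℝ :=
  contr (K.perturb φ x) (iddbar n f x)

/-- The scalar product of the gradients for the metric of `ω_φ`. -/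
def KahlerForm.gradDot (K : KahlerForm n X) (φ f g : X → ℝ) (x : X) : ℝ :=
  dotR (K.perturb φ x) (dAt n f x) (dAt n g x)

theorem iddbar_isOneOne {φ : X → ℝ} (hφ : ContMDiff 𝓘(ℝ, Fin n → ℂ) 𝓘(ℝ, ℝ) ∞ φ) (x : X) :
    IsOneOne (iddbar n φ x) := by
  rw [iddbar_eq]
  have h := (contDiffOn_chart hφ x).contDiffAt
    ((chartAt (Fin n → ℂ) x).open_target.mem_nhds (mem_chart_target _ x))
  exact ddc_isOneOne (h.isSymmSndFDerivAt (by simp; exact infty_two)).eq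

theorem KahlerForm.perturb_isOneOne {φ : X → ℝ}
    (hφ : ContMDiff 𝓘(ℝ, Fin n → ℂ) 𝓘(ℝ, ℝ) ∞ φ) (x : X) : IsOneOne (K.perturb φ x) :=
  IsOneOne.add ⟨K.alternating x, K.type_one_one x⟩ (iddbar_isOneOne hφ x)

theorem KahlerForm.perturb_isPositive {φ : Smooth n X} (hφ : φ ∈ K.potentials) (x : X) :
    IsPositive (K.perturb φ x) :=
  ⟨K.perturb_isOneOne φ.contMDiff x, hφ x⟩

theorem KahlerForm.inChart_perturb_isOneOne {φ : X → ℝ}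
    (hφ : ContMDiff 𝓘(ℝ, Fin n → ℂ) 𝓘(ℝ, ℝ) ∞ φ) (p : X) {y : Fin n → ℂ}
    (hy : y ∈ (chartAt (Fin n → ℂ) p).target) : IsOneOne (inChart (K.perturb φ) p y) :=
  (K.perturb_isOneOne hφ _).pull (chartFrame_I p hy)

theorem inChart_isPositive {η : X → BForm n} (p : X) {y : Fin n → ℂ}
    (hy : y ∈ (chartAt (Fin n → ℂ) p).target)
    (h : IsPositive (η ((chartAt (Fin n → ℂ) p).symm y))) : IsPositive (inChart η p y) := by
  obtain ⟨A, hA⟩ := exists_equiv_chartFrame p hy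
  have hi : Function.Injective (chartFrame p y) := by
    rw [← hA]
    exact A.injective
  exact h.pull (chartFrame_I p hy) hi

theorem KahlerForm.inChart_perturb_isPositive {φ : Smooth n X} (hφ : φ ∈ K.potentials) (p : X)
    {y : Fin n → ℂ} (hy : y ∈ (chartAt (Fin n → ℂ) p).target) :
    IsPositive (inChart (K.perturb φ) p y) :=
  inChart_isPositive p hy (K.perturb_isPositive hφ _)

theorem KahlerForm.inChart_perturb {φ : X → ℝ}
    (hφ : ContMDiff 𝓘(ℝ, Fin n → ℂ) 𝓘(ℝ, ℝ) ∞ φ) (p : X) {y : Fin n → ℂ}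
    (hy : y ∈ (chartAt (Fin n → ℂ) p).target) :
    inChart (K.perturb φ) p y = inChart K.form p y
      + ddc n (fderiv ℝ (fderiv ℝ (φ ∘ (chartAt (Fin n → ℂ) p).symm)) y) := by
  rw [← inChart_iddbar hφ p hy]
  rfl

/-- The frame of a chart is a complex linear isomorphism, so naturality of the bracket applies. The
right side is built from objects smooth in y. -/
theorem bracketR_chart {η : X → BForm n} {f g : X → ℝ} (p : X) {y : Fin n → ℂ}
    (hy : y ∈ (chartAt (Fin n → ℂ) p).target)
    (h : IsPositive (η ((chartAt (Fin n → ℂ) p).symm y)))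
    (hf : ContMDiff 𝓘(ℝ, Fin n → ℂ) 𝓘(ℝ, ℝ) ∞ f) (hg : ContMDiff 𝓘(ℝ, Fin n → ℂ) 𝓘(ℝ, ℝ) ∞ g) :
    bracketR (η ((chartAt (Fin n → ℂ) p).symm y)) (dAt n f ((chartAt (Fin n → ℂ) p).symm y))
        (dAt n g ((chartAt (Fin n → ℂ) p).symm y))
      = bracketR (inChart η p y) (fderiv ℝ (f ∘ (chartAt (Fin n → ℂ) p).symm) y)
        (fderiv ℝ (g ∘ (chartAt (Fin n → ℂ) p).symm) y) := by
  obtain ⟨A, hA⟩ := exists_equiv_chartFrame p hy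
  rw [fderiv_chart p hy (hf.mdifferentiableAt (by simp)),
    fderiv_chart p hy (hg.mdifferentiableAt (by simp)), inChart_eq_pull, ← hA, h.bracketR_pull]
  intro u
  have := chartFrame_I p hy u
  rwa [← hA] at this

theorem dotR_chart {η : X → BForm n} {f g : X → ℝ} (p : X) {y : Fin n → ℂ}
    (hy : y ∈ (chartAt (Fin n → ℂ) p).target)
    (h : IsPositive (η ((chartAt (Fin n → ℂ) p).symm y)))
    (hf : ContMDiff 𝓘(ℝ, Fin n → ℂ) 𝓘(ℝ, ℝ) ∞ f) (hg : ContMDiff 𝓘(ℝ, Fin n → ℂ) 𝓘(ℝ, ℝ) ∞ g) :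
    dotR (η ((chartAt (Fin n → ℂ) p).symm y)) (dAt n f ((chartAt (Fin n → ℂ) p).symm y))
        (dAt n g ((chartAt (Fin n → ℂ) p).symm y))
      = dotR (inChart η p y) (fderiv ℝ (f ∘ (chartAt (Fin n → ℂ) p).symm) y)
        (fderiv ℝ (g ∘ (chartAt (Fin n → ℂ) p).symm) y) := by
  obtain ⟨A, hA⟩ := exists_equiv_chartFrame p hy
  rw [fderiv_chart p hy (hf.mdifferentiableAt (by simp)),
    fderiv_chart p hy (hg.mdifferentiableAt (by simp)), inChart_eq_pull, ← hA, h.dotR_pull]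
  intro u
  have := chartFrame_I p hy u
  rwa [← hA] at this

theorem contr_chart {η β : X → BForm n} (p : X) {y : Fin n → ℂ}
    (hy : y ∈ (chartAt (Fin n → ℂ) p).target)
    (h : IsPositive (η ((chartAt (Fin n → ℂ) p).symm y))) :
    contr (η ((chartAt (Fin n → ℂ) p).symm y)) (β ((chartAt (Fin n → ℂ) p).symm y))
      = contr (inChart η p y) (inChart β p y) := by
  obtain ⟨A, hA⟩ := exists_equiv_chartFrame p hy
  rw [inChart_eq_pull, inChart_eq_pull, ← hA, h.contr_pull]
  intro u
  have := chartFrame_I p hy u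
  rwa [← hA] at this

variable {E : Type*} [NormedAddCommGroup E] [NormedSpace ℝ E] {W : Set E}
  {φ : E → Smooth n X} {f g : E → X → ℝ}

omit [IsManifold 𝓘(ℂ, Fin n → ℂ) ω X] in
theorem SmoothFam.hessian_chart (hf : SmoothFam n W f) (hW : IsOpen W) (p : X) :
    ContDiffOn ℝ ∞ (fun q : E × (Fin n → ℂ) =>
      fderiv ℝ (fderiv ℝ (f q.1 ∘ (chartAt (Fin n → ℂ) p).symm)) q.2)
      (W ×ˢ (chartAt (Fin n → ℂ) p).target) :=
  contDiffOn_fderiv_snd (hW.prod (chartAt (Fin n → ℂ) p).open_target)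
    (contDiffOn_fderiv_snd (hW.prod (chartAt (Fin n → ℂ) p).open_target) (hf p))

theorem SmoothFam.inChart_iddbar (hf : SmoothFam n W f) (hW : IsOpen W) (p : X) :
    ContDiffOn ℝ ∞ (fun q : E × (Fin n → ℂ) => inChart (iddbar n (f q.1)) p q.2)
      (W ×ˢ (chartAt (Fin n → ℂ) p).target) :=
  (contDiff_ddc.comp_contDiffOn (hf.hessian_chart hW p)).congr fun _ hq =>
    WZW.inChart_iddbar (hf.slice hq.1) p hq.2

theorem SmoothFam.inChart_perturb (hf : SmoothFam n W f) (hW : IsOpen W) (p : X) :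
    ContDiffOn ℝ ∞ (fun q : E × (Fin n → ℂ) => inChart (K.perturb (f q.1)) p q.2)
      (W ×ˢ (chartAt (Fin n → ℂ) p).target) :=
  ((K.smooth p).comp contDiff_snd.contDiffOn fun _ hq => hq.2).add (hf.inChart_iddbar hW p)

/-- ω_φ is affine in φ, and the parameter derivative commutes with the two spatial derivatives of
the Hessian. -/
theorem SmoothFam.fderiv_inChart_perturb (hf : SmoothFam n W f) (hW : IsOpen W) (p : X) (v : E)
    {w : E} (hw : w ∈ W) {y : Fin n → ℂ} (hy : y ∈ (chartAt (Fin n → ℂ) p).target) :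
    fderiv ℝ (fun w => inChart (K.perturb (f w)) p y) w v
      = inChart (iddbar n (WZW.famDeriv f v w)) p y := by
  have hU := hW.prod (chartAt (Fin n → ℂ) p).open_target
  have hev : (fun w => inChart (K.perturb (f w)) p y) =ᶠ[nhds w] fun w => inChart K.form p y
      + ddc n (fderiv ℝ (fderiv ℝ (f w ∘ (chartAt (Fin n → ℂ) p).symm)) y) := by
    filter_upwards [hW.mem_nhds hw] with w' hw'
    exact K.inChart_perturb (hf.slice hw') p hy
  have hd : DifferentiableAt ℝ
      (fun w => fderiv ℝ (fderiv ℝ (f w ∘ (chartAt (Fin n → ℂ) p).symm)) y) w :=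
    (hasFDerivAt_slice_fst ((hf.hessian_chart hW p).differentiableAt_of_isOpen hU
      (q := (w, y)) ⟨hw, hy⟩).hasFDerivAt).differentiableAt
  rw [hev.fderiv_eq, WZW.inChart_iddbar ((hf.famDeriv hW v).slice hw) p hy]
  refine ((fderiv_const_add_apply (F := BForm n) _ v).trans (fderiv_ddc_comp hd v)).trans ?_
  congr 1
  have h1 := fderiv_fst_snd_comm hU (contDiffOn_fderiv_snd hU (hf p)) v (w := w) (y := y) ⟨hw, hy⟩
  refine h1.trans ?_
  have hev2 : (fun y' => fderiv ℝ (fun w' => fderiv ℝ (fun y =>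
      f w' ((chartAt (Fin n → ℂ) p).symm y)) y') w v)
      =ᶠ[nhds y] fderiv ℝ (WZW.famDeriv f v w ∘ (chartAt (Fin n → ℂ) p).symm) := by
    filter_upwards [(chartAt (Fin n → ℂ) p).open_target.mem_nhds hy] with y' hy'
    exact fderiv_fst_snd_comm hU (hf p) v (w := w) (y := y') ⟨hw, hy'⟩
  exact hev2.fderiv_eq

theorem SmoothFam.bracket (hφ : SmoothFam n W fun w => φ w) (hW : IsOpen W)
    (hpot : ∀ w ∈ W, φ w ∈ K.potentials) (hf : SmoothFam n W f) (hg : SmoothFam n W g) :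
    SmoothFam n W fun w => K.bracket (φ w) (f w) (g w) := fun p =>
  (contDiffOn_bracketR (hφ.inChart_perturb K hW p)
    (fun q hq => K.inChart_perturb_isPositive (hpot q.1 hq.1) p hq.2)
    (contDiffOn_fderiv_snd (hW.prod (chartAt (Fin n → ℂ) p).open_target) (hf p))
    (contDiffOn_fderiv_snd (hW.prod (chartAt (Fin n → ℂ) p).open_target) (hg p))).congr
    fun q hq => bracketR_chart p hq.2 (K.perturb_isPositive (hpot q.1 hq.1) _)
      (hf.slice hq.1) (hg.slice hq.1)

theorem SmoothFam.gradDot (hφ : SmoothFam n W fun w => φ w) (hW : IsOpen W)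
    (hpot : ∀ w ∈ W, φ w ∈ K.potentials) (hf : SmoothFam n W f) (hg : SmoothFam n W g) :
    SmoothFam n W fun w => K.gradDot (φ w) (f w) (g w) := fun p =>
  (contDiffOn_dotR (hφ.inChart_perturb K hW p)
    (fun q hq => K.inChart_perturb_isPositive (hpot q.1 hq.1) p hq.2)
    (contDiffOn_fderiv_snd (hW.prod (chartAt (Fin n → ℂ) p).open_target) (hf p))
    (contDiffOn_fderiv_snd (hW.prod (chartAt (Fin n → ℂ) p).open_target) (hg p))).congr
    fun q hq => dotR_chart p hq.2 (K.perturb_isPositive (hpot q.1 hq.1) _)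
      (hf.slice hq.1) (hg.slice hq.1)

theorem SmoothFam.lap (hφ : SmoothFam n W fun w => φ w) (hW : IsOpen W)
    (hpot : ∀ w ∈ W, φ w ∈ K.potentials) (hf : SmoothFam n W f) :
    SmoothFam n W fun w => K.lap (φ w) (f w) := fun p =>
  (contDiffOn_contr (hφ.inChart_perturb K hW p)
    (fun q hq => K.inChart_perturb_isPositive (hpot q.1 hq.1) p hq.2)
    (hf.inChart_iddbar hW p)).congr
    fun q hq => contr_chart p hq.2 (K.perturb_isPositive (hpot q.1 hq.1) _)

theorem SmoothFam.topPower (hf : SmoothFam n W f) (hW : IsOpen W) (p : X) :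
    ContDiffOn ℝ ∞ (fun q : E × (Fin n → ℂ) => topPower (inChart (K.perturb (f q.1)) p q.2))
      (W ×ˢ (chartAt (Fin n → ℂ) p).target) :=
  contDiff_topPower.comp_contDiffOn (hf.inChart_perturb K hW p)

/-- The derivative of ω_φⁿ in φ is the Laplacian of the variation times ω_φⁿ, the only way the
potential enters the variation of the Mabuchi metric. -/
theorem SmoothFam.fderiv_topPower (hφ : SmoothFam n W fun w => φ w) (hW : IsOpen W)
    (hpot : ∀ w ∈ W, φ w ∈ K.potentials) (p : X) (v : E)
    {w : E} (hw : w ∈ W) {y : Fin n → ℂ} (hy : y ∈ (chartAt (Fin n → ℂ) p).target) :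
    fderiv ℝ (fun w => WZW.topPower (inChart (K.perturb (φ w)) p y)) w v
      = WZW.topPower (inChart (K.perturb (φ w)) p y)
        * K.lap (φ w) (WZW.famDeriv (fun w => φ w) v w) ((chartAt (Fin n → ℂ) p).symm y) := by
  have hU := hW.prod (chartAt (Fin n → ℂ) p).open_target
  have hd : DifferentiableAt ℝ (fun w => inChart (K.perturb (φ w)) p y) w :=
    (hasFDerivAt_slice_fst ((hφ.inChart_perturb K hW p).differentiableAt_of_isOpen hU
      (q := (w, y)) ⟨hw, hy⟩).hasFDerivAt).differentiableAt
  rw [fderiv_topPower_comp hd (K.inChart_perturb_isPositive (hpot w hw) p hy),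
    hφ.fderiv_inChart_perturb K hW p v hw hy, KahlerForm.lap,
    contr_chart p hy (K.perturb_isPositive (hpot w hw) _)]
  exact Filter.Eventually.of_forall fun w' => K.inChart_perturb_isOneOne (φ w').contMDiff p hy

/-- The Kähler form `ω_φ` is closed. -/
theorem KahlerForm.closed_perturb {φ : X → ℝ}
    (hφ : ContMDiff 𝓘(ℝ, Fin n → ℂ) 𝓘(ℝ, ℝ) ∞ φ) (p : X) {y : Fin n → ℂ}
    (hy : y ∈ (chartAt (Fin n → ℂ) p).target) (u v w : Fin n → ℂ) :
    fderiv ℝ (inChart (K.perturb φ) p) y u v w + fderiv ℝ (inChart (K.perturb φ) p) y v w u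
      + fderiv ℝ (inChart (K.perturb φ) p) y w u v = 0 := by
  have hT := (chartAt (Fin n → ℂ) p).open_target
  have hc := contDiffOn_chart hφ p
  have h1 := hc.fderiv_infty hT
  have h2 := h1.fderiv_infty hT
  have hev : inChart (K.perturb φ) p =ᶠ[nhds y] fun y => inChart K.form p y
      + ddc n (fderiv ℝ (fderiv ℝ (φ ∘ (chartAt (Fin n → ℂ) p).symm)) y) := by
    filter_upwards [hT.mem_nhds hy] with y' hy' using K.inChart_perturb hφ p hy'
  have hdK : DifferentiableAt ℝ (inChart K.form p) y :=
    (K.smooth p).differentiableAt_of_isOpen hT hy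
  have hd2 := h2.differentiableAt_of_isOpen hT hy
  have hdd : DifferentiableAt ℝ
      (fun y => ddc n (fderiv ℝ (fderiv ℝ (φ ∘ (chartAt (Fin n → ℂ) p).symm)) y)) y :=
    (contDiff_ddc.differentiable (by simp) _).comp y hd2
  have hsym := (h1.contDiffAt (hT.mem_nhds hy)).isSymmSndFDerivAt (by simp; exact infty_two)
  have hadd : ∀ u v w, fderiv ℝ (inChart (K.perturb φ) p) y u v w
      = fderiv ℝ (inChart K.form p) y u v w
        + ddc n (fderiv ℝ (fderiv ℝ (fderiv ℝ (φ ∘ (chartAt (Fin n → ℂ) p).symm))) y u) v w := by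
    intro u v w
    have := fderiv_add_apply (F := BForm n) hdK hdd u
    rw [fderiv_ddc_comp hd2] at this
    rw [hev.fderiv_eq]
    exact congrArg (fun B : BForm n => B v w) this
  simp only [hadd, ddc_apply]
  have := K.closed p y hy u v w
  -- Symmetry of the third derivative of φ in its first two slots makes the six terms coming from
  -- `ddc` cancel in pairs.
  rw [hsym.eq v u, hsym.eq w u, hsym.eq w v]
  linarith

end KahlerFamilies

/-! ### Integration over `X` -/

section Integrals

open MeasureTheory

variable {n : ℕ} {X : Type*} [TopologicalSpace X] [ChartedSpace (Fin n → ℂ) X]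
  [IsManifold 𝓘(ℂ, Fin n → ℂ) ω X]

/-- Since h vanishes off either chart domain, both integrals live on the overlap, where the change
of variables formula meets the factor |det| of `IsPositive.topPower_pull`. -/
theorem setIntegral_chart_eq {η : X → BForm n} (hη : ∀ x, IsPositive (η x)) (p q : X) {h : X → ℝ}
    (hp : ∀ x ∉ (chartAt (Fin n → ℂ) p).source, h x = 0)
    (hq : ∀ x ∉ (chartAt (Fin n → ℂ) q).source, h x = 0) :
    ∫ y in (chartAt (Fin n → ℂ) p).target,
        h ((chartAt (Fin n → ℂ) p).symm y) * topPower (inChart η p y)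
      = ∫ y in (chartAt (Fin n → ℂ) q).target,
        h ((chartAt (Fin n → ℂ) q).symm y) * topPower (inChart η q y) := by
  set s := ((chartAt (Fin n → ℂ) q).symm.trans (chartAt (Fin n → ℂ) p)).source with hs
  set s' := ((chartAt (Fin n → ℂ) p).symm.trans (chartAt (Fin n → ℂ) q)).source with hs'
  set τ := chartAt (Fin n → ℂ) p ∘ (chartAt (Fin n → ℂ) q).symm with hτ
  have hso : IsOpen s := OpenPartialHomeomorph.open_source _
  have hsub : s ⊆ (chartAt (Fin n → ℂ) q).target := by
    rw [hs, OpenPartialHomeomorph.trans_source]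
    exact Set.inter_subset_left
  have hsub' : s' ⊆ (chartAt (Fin n → ℂ) p).target := by
    rw [hs', OpenPartialHomeomorph.trans_source]
    exact Set.inter_subset_left
  have himage : τ '' s = s' := by
    have h1 := ((chartAt (Fin n → ℂ) q).symm.trans (chartAt (Fin n → ℂ) p)).image_source_eq_target
    have h2 : ((chartAt (Fin n → ℂ) q).symm.trans (chartAt (Fin n → ℂ) p)).target = s' := by
      rw [hs', ← OpenPartialHomeomorph.symm_source, OpenPartialHomeomorph.trans_symm_eq_symm_trans_symm,
        OpenPartialHomeomorph.symm_symm]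
    rw [← h2, ← h1]
    rfl
  have hinj : Set.InjOn τ s :=
    ((chartAt (Fin n → ℂ) q).symm.trans (chartAt (Fin n → ℂ) p)).injOn
  have hder : ∀ y ∈ s, HasFDerivWithinAt τ (fderiv ℝ τ y) s y := fun y hy =>
    ((contDiffOn_transition_real q p).differentiableAt_of_isOpen hso hy).hasFDerivAt.hasFDerivWithinAt
  have e1 : ∫ y in (chartAt (Fin n → ℂ) p).target,
        h ((chartAt (Fin n → ℂ) p).symm y) * topPower (inChart η p y)
      = ∫ y in s', h ((chartAt (Fin n → ℂ) p).symm y) * topPower (inChart η p y) :=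
    (setIntegral_eq_of_subset_of_forall_sdiff_eq_zero
      (chartAt (Fin n → ℂ) p).open_target.measurableSet hsub' fun y hy => by
        rw [hq _ fun hx => hy.2 (mem_transition_source p q hy.1 hx), zero_mul])
  have e2 : ∫ y in (chartAt (Fin n → ℂ) q).target,
        h ((chartAt (Fin n → ℂ) q).symm y) * topPower (inChart η q y)
      = ∫ y in s, h ((chartAt (Fin n → ℂ) q).symm y) * topPower (inChart η q y) :=
    (setIntegral_eq_of_subset_of_forall_sdiff_eq_zero
      (chartAt (Fin n → ℂ) q).open_target.measurableSet hsub fun y hy => by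
        rw [hp _ fun hx => hy.2 (mem_transition_source q p hy.1 hx), zero_mul])
  rw [e1, e2, ← himage, integral_image_eq_integral_abs_det_fderiv_smul volume hso.measurableSet
    hder hinj]
  refine setIntegral_congr_fun hso.measurableSet fun y hy => ?_
  have hy' := hy
  rw [hs, OpenPartialHomeomorph.trans_source] at hy'
  have hx : (chartAt (Fin n → ℂ) p).symm (τ y) = (chartAt (Fin n → ℂ) q).symm y :=
    (chartAt (Fin n → ℂ) p).left_inv hy'.2
  have hτy : τ y ∈ (chartAt (Fin n → ℂ) p).target := (chartAt (Fin n → ℂ) p).map_source hy'.2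
  -- The two chart frames differ by this derivative, and the frame at y is invertible.
  have hinjd : Function.Injective (fderiv ℝ τ y) := by
    obtain ⟨A, hA⟩ := exists_equiv_chartFrame q hy'.1
    have hc := chartFrame_transition q p hy
    rw [← hA] at hc
    intro u v huv
    apply A.injective
    have := congrArg (fun L : (Fin n → ℂ) →L[ℝ] (Fin n → ℂ) => L u - L v) hc
    simp only [ContinuousLinearMap.comp_apply] at this
    rw [hτ] at huv
    rw [huv, sub_self] at this
    exact sub_eq_zero.1 this
  have htp := (inChart_isPositive p hτy (hη _)).topPower_pull (fderiv_transition_I q p hy) hinjd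
  rw [inChart_transition η q p hy]
  change |(fderiv ℝ τ y).det| • (h ((chartAt (Fin n → ℂ) p).symm (τ y))
    * topPower (inChart η p (τ y))) = h ((chartAt (Fin n → ℂ) q).symm y) * topPower _
  rw [hx, smul_eq_mul]
  refine Eq.trans ?_ (congrArg _ htp.symm)
  change _ = _ * (|(fderiv ℝ τ y).det| * topPower (inChart η p (τ y)))
  ring

variable [CompactSpace X] [T2Space X]

theorem chartPartition_subordinate (p : X) :
    tsupport (chartPartition n X p) ⊆ (chartAt (Fin n → ℂ) p).source :=
  Classical.choose_spec
    (SmoothPartitionOfUnity.exists_isSubordinate_chartAt_source 𝓘(ℝ, Fin n → ℂ) X) p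

theorem chartPartition_eq_zero (p : X) {x : X} (hx : x ∉ (chartAt (Fin n → ℂ) p).source) :
    chartPartition n X p x = 0 :=
  image_eq_zero_of_notMem_tsupport fun h => hx (chartPartition_subordinate p h)

variable (n X) in
/-- The finitely many indices of nonzero functions of the partition of unity. -/
def partitionIndex : Finset X :=
  ((chartPartition n X).locallyFinite.finite_nonempty_of_compact).toFinset

theorem chartPartition_of_notMem {p : X} (hp : p ∉ partitionIndex n X) (x : X) :
    chartPartition n X p x = 0 := by
  by_contra h
  exact hp (by
    rw [partitionIndex, Set.Finite.mem_toFinset]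
    exact ⟨x, h⟩)

theorem sum_chartPartition (x : X) : ∑ p ∈ partitionIndex n X, chartPartition n X p x = 1 := by
  rw [← (chartPartition n X).sum_eq_one (Set.mem_univ x)]
  refine (finsum_eq_sum_of_support_subset _ fun p hp => ?_).symm
  by_contra h
  exact hp (chartPartition_of_notMem h x)

/-- The support of a function of the partition of unity, in the chart. -/
def chartSupport (n : ℕ) {X : Type*} [TopologicalSpace X] [ChartedSpace (Fin n → ℂ) X]
    [IsManifold 𝓘(ℂ, Fin n → ℂ) ω X] [CompactSpace X] [T2Space X] (p : X) : Set (Fin n → ℂ) :=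
  chartAt (Fin n → ℂ) p '' tsupport (chartPartition n X p)

theorem image_chart_isCompact {s : Set X} (hs : IsClosed s) (p : X)
    (h : s ⊆ (chartAt (Fin n → ℂ) p).source) : IsCompact (chartAt (Fin n → ℂ) p '' s) :=
  hs.isCompact.image_of_continuousOn ((chartAt (Fin n → ℂ) p).continuousOn.mono h)

theorem chartSupport_isCompact (p : X) : IsCompact (chartSupport n p) :=
  image_chart_isCompact (isClosed_tsupport _) p (chartPartition_subordinate p)

theorem chartSupport_subset (p : X) : chartSupport n p ⊆ (chartAt (Fin n → ℂ) p).target := by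
  rintro _ ⟨x, hx, rfl⟩
  exact (chartAt (Fin n → ℂ) p).map_source (chartPartition_subordinate p hx)

theorem eq_zero_of_notMem_image {h : X → ℝ} (p : X) {y : Fin n → ℂ}
    (hy : y ∈ (chartAt (Fin n → ℂ) p).target) (hy' : y ∉ chartAt (Fin n → ℂ) p '' tsupport h) :
    h ((chartAt (Fin n → ℂ) p).symm y) = 0 :=
  image_eq_zero_of_notMem_tsupport fun hx => hy' ⟨_, hx, (chartAt (Fin n → ℂ) p).right_inv hy⟩

/-- A finite sum over compact domains, the form in which continuity in parameters and
differentiation under the integral are available. -/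
theorem integralTop_eq_sum (η : X → BForm n) (f : X → ℝ) :
    integralTop η f = ∑ p ∈ partitionIndex n X, ∫ y in chartSupport n p,
      chartPartition n X p ((chartAt (Fin n → ℂ) p).symm y)
        * f ((chartAt (Fin n → ℂ) p).symm y) * topPower (inChart η p y) := by
  rw [integralTop, finsum_eq_sum_of_support_subset (s := partitionIndex n X)]
  · refine Finset.sum_congr rfl fun p _ => ?_
    refine setIntegral_eq_of_subset_of_forall_sdiff_eq_zero
      (chartAt (Fin n → ℂ) p).open_target.measurableSet (chartSupport_subset p) fun y hy => ?_
    rw [eq_zero_of_notMem_image p hy.1 hy.2, zero_mul, zero_mul]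
  · intro p hp
    by_contra h
    refine hp ?_
    simp [chartPartition_of_notMem h]

theorem integralTop_congr {η : X → BForm n} {f g : X → ℝ} (h : ∀ x, f x = g x) :
    integralTop η f = integralTop η g := by
  rw [funext h]

variable (K : KahlerForm n X) {φ : Smooth n X}

theorem continuousOn_topPower_chart (φ : Smooth n X) (p : X) :
    ContinuousOn (fun y => topPower (inChart (K.perturb φ) p y))
      (chartAt (Fin n → ℂ) p).target := by
  have h := (SmoothFam.const (W := (Set.univ : Set ℝ)) φ.contMDiff).topPower K isOpen_univ p
  exact (h.comp (contDiff_prodMk_right (0 : ℝ)).contDiffOn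
    fun y hy => ⟨Set.mem_univ _, hy⟩).continuousOn

theorem continuousOn_comp_chart {f : X → ℝ} (hf : Continuous f) (p : X) :
    ContinuousOn (fun y => f ((chartAt (Fin n → ℂ) p).symm y)) (chartAt (Fin n → ℂ) p).target :=
  hf.comp_continuousOn (chartAt (Fin n → ℂ) p).continuousOn_symm

theorem continuousOn_integrand (φ : Smooth n X) {f : X → ℝ} (hf : Continuous f) (p : X) :
    ContinuousOn (fun y => chartPartition n X p ((chartAt (Fin n → ℂ) p).symm y)
        * f ((chartAt (Fin n → ℂ) p).symm y) * topPower (inChart (K.perturb φ) p y))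
      (chartAt (Fin n → ℂ) p).target :=
  ((continuousOn_comp_chart (chartPartition n X p).contMDiff.continuous p).mul
    (continuousOn_comp_chart hf p)).mul (continuousOn_topPower_chart K φ p)

theorem integralTop_add (φ : Smooth n X) {f g : X → ℝ} (hf : Continuous f) (hg : Continuous g) :
    integralTop (K.perturb φ) (fun x => f x + g x)
      = integralTop (K.perturb φ) f + integralTop (K.perturb φ) g := by
  simp only [integralTop_eq_sum]
  rw [← Finset.sum_add_distrib]
  refine Finset.sum_congr rfl fun p _ => ?_
  rw [← integral_add]
  · simp only [mul_add, add_mul]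
  · exact ((continuousOn_integrand K φ hf p).mono (chartSupport_subset p)).integrableOn_compact
      (chartSupport_isCompact p)
  · exact ((continuousOn_integrand K φ hg p).mono (chartSupport_subset p)).integrableOn_compact
      (chartSupport_isCompact p)

theorem integralTop_const_mul (φ : X → ℝ) (c : ℝ) (f : X → ℝ) :
    integralTop (K.perturb φ) (fun x => c * f x) = c * integralTop (K.perturb φ) f := by
  simp only [integralTop_eq_sum]
  rw [Finset.mul_sum]
  refine Finset.sum_congr rfl fun p _ => ?_
  rw [← integral_const_mul]
  congr 1
  ext y
  ring

theorem integralTop_zero (φ : X → ℝ) : integralTop (K.perturb φ) (fun _ => 0) = 0 := by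
  have := integralTop_const_mul K φ 0 (fun _ => 0)
  simpa using this

theorem integralTop_finsetSum (φ : Smooth n X) {ι : Type*} (s : Finset ι) {f : ι → X → ℝ}
    (hf : ∀ i ∈ s, Continuous (f i)) :
    integralTop (K.perturb φ) (fun x => ∑ i ∈ s, f i x)
      = ∑ i ∈ s, integralTop (K.perturb φ) (f i) := by
  induction s using Finset.cons_induction with
  | empty => simpa using integralTop_zero K φ
  | cons a s ha ih =>
    simp only [Finset.sum_cons]
    rw [integralTop_add K φ (hf a (Finset.mem_cons_self a s))
      (continuous_finsetSum _ fun i hi => hf i (Finset.mem_cons_of_mem hi)),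
      ih fun i hi => hf i (Finset.mem_cons_of_mem hi)]

/-- The integral of a function supported in a chart may be computed in this chart. -/
theorem integralTop_eq_chart (hφ : φ ∈ K.potentials) {F : X → ℝ} (hF : Continuous F) (q : X)
    (hs : tsupport F ⊆ (chartAt (Fin n → ℂ) q).source) :
    integralTop (K.perturb φ) F = ∫ y in (chartAt (Fin n → ℂ) q).target,
      F ((chartAt (Fin n → ℂ) q).symm y) * topPower (inChart (K.perturb φ) q y) := by
  have hF0 : ∀ x ∉ (chartAt (Fin n → ℂ) q).source, F x = 0 := fun x hx =>
    image_eq_zero_of_notMem_tsupport fun h => hx (hs h)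
  have hint : ∀ p, IntegrableOn (fun y => (chartPartition n X p ((chartAt (Fin n → ℂ) q).symm y)
      * F ((chartAt (Fin n → ℂ) q).symm y)) * topPower (inChart (K.perturb φ) q y))
      (chartAt (Fin n → ℂ) q).target := fun p => by
    have hc : ContinuousOn (fun y => (chartPartition n X p ((chartAt (Fin n → ℂ) q).symm y)
      * F ((chartAt (Fin n → ℂ) q).symm y)) * topPower (inChart (K.perturb φ) q y))
      (chartAt (Fin n → ℂ) q).target :=
      ((continuousOn_comp_chart (chartPartition n X p).contMDiff.continuous q).mul
        (continuousOn_comp_chart hF q)).mul (continuousOn_topPower_chart K φ q)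
    have hsub : chartAt (Fin n → ℂ) q '' tsupport F ⊆ (chartAt (Fin n → ℂ) q).target := by
      rintro _ ⟨x, hx, rfl⟩
      exact (chartAt (Fin n → ℂ) q).map_source (hs hx)
    have h1 := (hc.mono hsub).integrableOn_compact (μ := volume)
      (image_chart_isCompact (isClosed_tsupport F) q hs)
    refine IntegrableOn.of_forall_sdiff_eq_zero h1
      (chartAt (Fin n → ℂ) q).open_target.measurableSet fun y hy => ?_
    rw [eq_zero_of_notMem_image q hy.1 hy.2, mul_zero, zero_mul]
  have hsum : integralTop (K.perturb φ) F = ∑ p ∈ partitionIndex n X,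
      ∫ y in (chartAt (Fin n → ℂ) q).target,
        (chartPartition n X p ((chartAt (Fin n → ℂ) q).symm y)
          * F ((chartAt (Fin n → ℂ) q).symm y)) * topPower (inChart (K.perturb φ) q y) := by
    rw [integralTop, finsum_eq_sum_of_support_subset (s := partitionIndex n X)]
    · refine Finset.sum_congr rfl fun p _ => ?_
      -- Each term is supported in both charts, so it can be moved from chart p to chart q, where
      -- the partition functions then add up to 1.
      exact setIntegral_chart_eq (K.perturb_isPositive hφ) p q
        (h := fun x => chartPartition n X p x * F x)
        (fun x hx => by simp [chartPartition_eq_zero p hx]) (fun x hx => by simp [hF0 x hx])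
    · intro p hp
      by_contra h
      refine hp ?_
      simp [chartPartition_of_notMem h]
  rw [hsum, ← integral_finsetSum _ fun p _ => hint p]
  congr 1
  ext y
  rw [← Finset.sum_mul, ← Finset.sum_mul, sum_chartPartition, one_mul]

theorem integralTop_nonneg (hφ : φ ∈ K.potentials) {F : X → ℝ} (h0 : ∀ x, 0 ≤ F x) :
    0 ≤ integralTop (K.perturb φ) F :=
  finsum_nonneg fun p => setIntegral_nonneg (chartAt (Fin n → ℂ) p).open_target.measurableSet
    fun _ hy => mul_nonneg (mul_nonneg ((chartPartition n X).nonneg _ _) (h0 _))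
      (K.inChart_perturb_isPositive hφ p hy).topPower_pos.le

/-- A continuous nonnegative function with vanishing integral is zero. -/
theorem eq_zero_of_integralTop_eq_zero (hφ : φ ∈ K.potentials) {F : X → ℝ} (hF : Continuous F)
    (h0 : ∀ x, 0 ≤ F x) (hI : integralTop (K.perturb φ) F = 0) (x : X) : F x = 0 := by
  rw [integralTop, finsum_eq_sum_of_support_subset (s := partitionIndex n X)] at hI
  swap
  · intro p hp
    by_contra h
    refine hp ?_
    simp [chartPartition_of_notMem h]
  have hnn : ∀ p : X, ∀ y ∈ (chartAt (Fin n → ℂ) p).target,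
      0 ≤ chartPartition n X p ((chartAt (Fin n → ℂ) p).symm y)
        * F ((chartAt (Fin n → ℂ) p).symm y) * topPower (inChart (K.perturb φ) p y) :=
    fun p y hy => mul_nonneg (mul_nonneg ((chartPartition n X).nonneg _ _) (h0 _))
      (K.inChart_perturb_isPositive hφ p hy).topPower_pos.le
  have hz := (Finset.sum_eq_zero_iff_of_nonneg fun p _ =>
    setIntegral_nonneg (chartAt (Fin n → ℂ) p).open_target.measurableSet (hnn p)).1 hI
  have hpt : ∀ p ∈ partitionIndex n X, chartPartition n X p x * F x = 0 := by
    intro p hp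
    by_cases hx : x ∈ (chartAt (Fin n → ℂ) p).source
    swap
    · rw [chartPartition_eq_zero p hx, zero_mul]
    have hT := (chartAt (Fin n → ℂ) p).open_target
    have hint : IntegrableOn (fun y => chartPartition n X p ((chartAt (Fin n → ℂ) p).symm y)
        * F ((chartAt (Fin n → ℂ) p).symm y) * topPower (inChart (K.perturb φ) p y))
        (chartAt (Fin n → ℂ) p).target :=
      IntegrableOn.of_forall_sdiff_eq_zero
        (((continuousOn_integrand K φ hF p).mono (chartSupport_subset p)).integrableOn_compact
          (chartSupport_isCompact p)) hT.measurableSet fun y hy => by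
            rw [eq_zero_of_notMem_image p hy.1 hy.2, zero_mul, zero_mul]
    have hae := (setIntegral_eq_zero_iff_of_nonneg_ae
      ((ae_restrict_mem hT.measurableSet).mono (hnn p)) hint).1 (hz p hp)
    -- Continuity upgrades almost everywhere vanishing to vanishing everywhere in the chart. The
    -- density is positive there, so the product of F with the partition function is zero.
    have heq := Measure.eqOn_open_of_ae_eq hae hT (continuousOn_integrand K φ hF p)
      continuousOn_const
    have := heq ((chartAt (Fin n → ℂ) p).map_source hx)
    simp only [(chartAt (Fin n → ℂ) p).left_inv hx, Pi.zero_apply, mul_eq_zero] at this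
    rcases this with h | h
    · exact mul_eq_zero.2 h
    · exact absurd h (K.inChart_perturb_isPositive hφ p
        ((chartAt (Fin n → ℂ) p).map_source hx)).topPower_pos.ne'
  have := Finset.sum_eq_zero hpt
  rwa [← Finset.sum_mul, sum_chartPartition, one_mul] at this

end Integrals

/-! ### Integration by parts on `X` -/

section Parts

open MeasureTheory

variable {n : ℕ} {X : Type*} [TopologicalSpace X] [ChartedSpace (Fin n → ℂ) X]
  [IsManifold 𝓘(ℂ, Fin n → ℂ) ω X]

theorem dAt_eq {f : X → ℝ} (hf : ContMDiff 𝓘(ℝ, Fin n → ℂ) 𝓘(ℝ, ℝ) ∞ f) (x : X) :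
    dAt n f x = fderiv ℝ (f ∘ (chartAt (Fin n → ℂ) x).symm) (chartAt (Fin n → ℂ) x x) := by
  rw [dAt, (hf.mdifferentiableAt (by simp)).mfderiv, ← fderivWithin_univ]
  simp only [writtenInExtChartAt, extChartAt, OpenPartialHomeomorph.extend,
    modelWithCornersSelf_partialEquiv, PartialEquiv.trans_refl, modelWithCornersSelf_coe,
    Set.range_id]
  rfl

theorem differentiableAt_chart {f : X → ℝ} (hf : ContMDiff 𝓘(ℝ, Fin n → ℂ) 𝓘(ℝ, ℝ) ∞ f) (x : X) :
    DifferentiableAt ℝ (f ∘ (chartAt (Fin n → ℂ) x).symm) (chartAt (Fin n → ℂ) x x) :=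
  (contDiffOn_chart hf x).differentiableAt_of_isOpen (chartAt (Fin n → ℂ) x).open_target
    (mem_chart_target _ x)

theorem dAt_mul {f g : X → ℝ} (hf : ContMDiff 𝓘(ℝ, Fin n → ℂ) 𝓘(ℝ, ℝ) ∞ f)
    (hg : ContMDiff 𝓘(ℝ, Fin n → ℂ) 𝓘(ℝ, ℝ) ∞ g) (x : X) :
    dAt n (fun x => f x * g x) x = f x • dAt n g x + g x • dAt n f x := by
  rw [dAt_eq hf, dAt_eq hg, dAt_eq (f := fun x => f x * g x) (hf.mul hg)]
  have := fderiv_mul (differentiableAt_chart hf x) (differentiableAt_chart hg x)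
  refine this.trans ?_
  simp

theorem dAt_finsetSum {ι : Type*} {s : Finset ι} {f : ι → X → ℝ}
    (hf : ∀ i ∈ s, ContMDiff 𝓘(ℝ, Fin n → ℂ) 𝓘(ℝ, ℝ) ∞ (f i)) (x : X) :
    dAt n (fun x => ∑ i ∈ s, f i x) x = ∑ i ∈ s, dAt n (f i) x := by
  rw [dAt_eq (ContMDiff.sum hf), Finset.sum_congr rfl fun i hi => dAt_eq (hf i hi) x]
  exact fderiv_fun_sum fun i hi => differentiableAt_chart (hf i hi) x

theorem dAt_eq_zero {f : X → ℝ} {x : X} (hx : x ∉ tsupport f) : dAt n f x = 0 := by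
  rw [dAt, ((notMem_tsupport_iff_eventuallyEq).1 hx).mfderiv_eq]
  exact mfderiv_const

variable (K : KahlerForm n X) {φ : Smooth n X}

theorem KahlerForm.contMDiff_bracket (hφ : φ ∈ K.potentials) {f g : X → ℝ}
    (hf : ContMDiff 𝓘(ℝ, Fin n → ℂ) 𝓘(ℝ, ℝ) ∞ f) (hg : ContMDiff 𝓘(ℝ, Fin n → ℂ) 𝓘(ℝ, ℝ) ∞ g) :
    ContMDiff 𝓘(ℝ, Fin n → ℂ) 𝓘(ℝ, ℝ) ∞ (K.bracket φ f g) :=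
  smoothFam_const_iff.1 ((SmoothFam.const φ.contMDiff).bracket K isOpen_univ (fun _ _ => hφ)
    (SmoothFam.const hf) (SmoothFam.const hg))

theorem KahlerForm.contMDiff_gradDot (hφ : φ ∈ K.potentials) {f g : X → ℝ}
    (hf : ContMDiff 𝓘(ℝ, Fin n → ℂ) 𝓘(ℝ, ℝ) ∞ f) (hg : ContMDiff 𝓘(ℝ, Fin n → ℂ) 𝓘(ℝ, ℝ) ∞ g) :
    ContMDiff 𝓘(ℝ, Fin n → ℂ) 𝓘(ℝ, ℝ) ∞ (K.gradDot φ f g) :=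
  smoothFam_const_iff.1 ((SmoothFam.const φ.contMDiff).gradDot K isOpen_univ (fun _ _ => hφ)
    (SmoothFam.const hf) (SmoothFam.const hg))

theorem KahlerForm.contMDiff_lap (hφ : φ ∈ K.potentials) {f : X → ℝ}
    (hf : ContMDiff 𝓘(ℝ, Fin n → ℂ) 𝓘(ℝ, ℝ) ∞ f) :
    ContMDiff 𝓘(ℝ, Fin n → ℂ) 𝓘(ℝ, ℝ) ∞ (K.lap φ f) :=
  smoothFam_const_iff.1 ((SmoothFam.const φ.contMDiff).lap K isOpen_univ (fun _ _ => hφ)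
    (SmoothFam.const hf))

theorem KahlerForm.bracket_swap (hφ : φ ∈ K.potentials) (f g : X → ℝ) (x : X) :
    K.bracket φ f g x = -K.bracket φ g f x :=
  (K.perturb_isPositive hφ x).bracketR_swap _ _

theorem KahlerForm.gradDot_swap (hφ : φ ∈ K.potentials) (f g : X → ℝ) (x : X) :
    K.gradDot φ f g x = K.gradDot φ g f x :=
  (K.perturb_isPositive hφ x).dotR_swap _ _

theorem KahlerForm.bracket_mul (hφ : φ ∈ K.potentials) {f g : X → ℝ} (h : X → ℝ)
    (hf : ContMDiff 𝓘(ℝ, Fin n → ℂ) 𝓘(ℝ, ℝ) ∞ f) (hg : ContMDiff 𝓘(ℝ, Fin n → ℂ) 𝓘(ℝ, ℝ) ∞ g)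
    (x : X) :
    K.bracket φ (fun x => f x * g x) h x = f x * K.bracket φ g h x + g x * K.bracket φ f h x := by
  simp only [KahlerForm.bracket, (K.perturb_isPositive hφ x).bracketR_eq, dAt_mul hf hg]
  simp

theorem KahlerForm.gradDot_mul {f g : X → ℝ} (h : X → ℝ)
    (hf : ContMDiff 𝓘(ℝ, Fin n → ℂ) 𝓘(ℝ, ℝ) ∞ f) (hg : ContMDiff 𝓘(ℝ, Fin n → ℂ) 𝓘(ℝ, ℝ) ∞ g)
    (x : X) :
    K.gradDot φ (fun x => f x * g x) h x = f x * K.gradDot φ g h x + g x * K.gradDot φ f h x := by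
  simp only [KahlerForm.gradDot, dotR, dAt_mul hf hg]
  simp

theorem contDiffOn_inChart_perturb (φ : Smooth n X) (p : X) :
    ContDiffOn ℝ ∞ (inChart (K.perturb φ) p) (chartAt (Fin n → ℂ) p).target :=
  ((K.smooth p).add (contDiff_ddc.comp_contDiffOn
    (((contDiffOn_chart φ.contMDiff p).fderiv_infty (chartAt (Fin n → ℂ) p).open_target).fderiv_infty
      (chartAt (Fin n → ℂ) p).open_target))).congr fun _ hy => K.inChart_perturb φ.contMDiff p hy

variable [T2Space X] [CompactSpace X]

/-- The divergence theorem for the field ω_φⁿ f η⁻¹(b), compactly supported in the chart; its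
divergence was computed in `trace_hamiltonian_field`. Both integration by parts formulas on X are
instances. -/
theorem integral_hamiltonian_chart (hφ : φ ∈ K.potentials) {f : X → ℝ}
    (hf : ContMDiff 𝓘(ℝ, Fin n → ℂ) 𝓘(ℝ, ℝ) ∞ f) (p : X)
    (hs : tsupport f ⊆ (chartAt (Fin n → ℂ) p).source)
    {b : (Fin n → ℂ) → (Fin n → ℂ) →L[ℝ] ℝ}
    (hb : ContDiffOn ℝ ∞ b (chartAt (Fin n → ℂ) p).target) :
    ∫ y in (chartAt (Fin n → ℂ) p).target,
      (fderiv ℝ (f ∘ (chartAt (Fin n → ℂ) p).symm) y ((inChart (K.perturb φ) p y).inverse (b y))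
        + f ((chartAt (Fin n → ℂ) p).symm y)
          * LinearMap.trace ℝ (Fin n → ℂ)
            ((inChart (K.perturb φ) p y).inverse.comp (fderiv ℝ b y)).toLinearMap)
        * topPower (inChart (K.perturb φ) p y) = 0 := by
  have hT := (chartAt (Fin n → ℂ) p).open_target
  have hη := contDiffOn_inChart_perturb K φ p
  have hpos := fun y hy => K.inChart_perturb_isPositive hφ p (y := y) hy
  have hW := contDiffOn_inverse hη hpos
  have hP : ContDiffOn ℝ ∞ (fun y => topPower (inChart (K.perturb φ) p y))
      (chartAt (Fin n → ℂ) p).target := contDiff_topPower.comp_contDiffOn hη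
  have hfc := contDiffOn_chart hf p
  have hY := (hP.mul hfc).smul (hW.clm_apply hb)
  have hsub : chartAt (Fin n → ℂ) p '' tsupport f ⊆ (chartAt (Fin n → ℂ) p).target := by
    rintro _ ⟨x, hx, rfl⟩
    exact (chartAt (Fin n → ℂ) p).map_source (hs hx)
  have hdiv := integral_divergence_eq_zero (μ := volume) hT
    (image_chart_isCompact (isClosed_tsupport f) p hs) hsub hY fun y hy hy' => by
      simp [eq_zero_of_notMem_image p hy hy']
  rw [← hdiv]
  refine setIntegral_congr_fun hT.measurableSet fun y hy => ?_
  have hdη := hη.differentiableAt_of_isOpen hT hy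
  have hev : ∀ᶠ x in nhds y, IsOneOne (inChart (K.perturb φ) p x) := by
    filter_upwards [hT.mem_nhds hy] with x hx using K.inChart_perturb_isOneOne φ.contMDiff p hx
  have := trace_hamiltonian_field hT hy hdη (hW.differentiableAt_of_isOpen hT hy)
    (hP.differentiableAt_of_isOpen hT hy) (hfc.differentiableAt_of_isOpen hT hy)
    (hb.differentiableAt_of_isOpen hT hy) (fun x hx => (hpos x hx).apply_inverse)
    (hpos y hy).inverse_apply
    (fun a c => by
      rw [← (hpos y hy).bracketR_eq, ← (hpos y hy).bracketR_eq, (hpos y hy).bracketR_swap])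
    (fun u => (isOneOne_fderiv hdη hev u).swap)
    (K.closed_perturb φ.contMDiff p hy)
    (fun u => fderiv_topPower_comp hdη (hpos y hy) hev u)
  refine Eq.trans ?_ this.symm
  rw [mul_comm]
  rfl

theorem tsupport_partition_mul (f : X → ℝ) (p : X) :
    tsupport (fun x => chartPartition n X p x * f x) ⊆ (chartAt (Fin n → ℂ) p).source :=
  (tsupport_mul_subset_left).trans (chartPartition_subordinate p)

theorem contMDiff_partition_mul {f : X → ℝ} (hf : ContMDiff 𝓘(ℝ, Fin n → ℂ) 𝓘(ℝ, ℝ) ∞ f) (p : X) :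
    ContMDiff 𝓘(ℝ, Fin n → ℂ) 𝓘(ℝ, ℝ) ∞ fun x => chartPartition n X p x * f x :=
  (chartPartition n X p).contMDiff.mul hf

theorem dAt_eq_sum_partition {f : X → ℝ} (hf : ContMDiff 𝓘(ℝ, Fin n → ℂ) 𝓘(ℝ, ℝ) ∞ f) (x : X) :
    dAt n f x = ∑ p ∈ partitionIndex n X, dAt n (fun x => chartPartition n X p x * f x) x := by
  rw [← dAt_finsetSum fun p _ => contMDiff_partition_mul hf p]
  congr 1
  ext y
  rw [← Finset.sum_mul, sum_chartPartition, one_mul]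

theorem tsupport_subset_of_forall {f F : X → ℝ} (h : ∀ x ∉ tsupport f, F x = 0) :
    tsupport F ⊆ tsupport f :=
  closure_minimal (fun x hx => by
    by_contra h'
    exact hx (h x h')) (isClosed_tsupport f)

/-- Here b = dg. Its derivative is the symmetric Hessian, whose trace against the antisymmetric η⁻¹
is zero, so only df(η⁻¹ dg) = {f, g} remains. -/
theorem integral_bracket_of_tsupport (hφ : φ ∈ K.potentials) {f g : X → ℝ}
    (hf : ContMDiff 𝓘(ℝ, Fin n → ℂ) 𝓘(ℝ, ℝ) ∞ f) (hg : ContMDiff 𝓘(ℝ, Fin n → ℂ) 𝓘(ℝ, ℝ) ∞ g)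
    (p : X) (hs : tsupport f ⊆ (chartAt (Fin n → ℂ) p).source) :
    integralTop (K.perturb φ) (K.bracket φ f g) = 0 := by
  have hT := (chartAt (Fin n → ℂ) p).open_target
  rw [integralTop_eq_chart K hφ (K.contMDiff_bracket hφ hf hg).continuous p
    ((tsupport_subset_of_forall fun x hx => ?_).trans hs)]
  · rw [← integral_hamiltonian_chart K hφ hf p hs ((contDiffOn_chart hg p).fderiv_infty hT)]
    refine setIntegral_congr_fun hT.measurableSet fun y hy => ?_
    have hpos := K.inChart_perturb_isPositive hφ p hy
    have htr := trace_comp_flip (W := (inChart (K.perturb φ) p y).inverse)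
      (fun a c => by
        rw [← hpos.bracketR_eq, ← hpos.bracketR_eq, hpos.bracketR_swap])
      (fderiv ℝ (fderiv ℝ (g ∘ (chartAt (Fin n → ℂ) p).symm)) y)
    have hsym : (fderiv ℝ (fderiv ℝ (g ∘ (chartAt (Fin n → ℂ) p).symm)) y).flip
        = fderiv ℝ (fderiv ℝ (g ∘ (chartAt (Fin n → ℂ) p).symm)) y := by
      ext u v
      exact (((contDiffOn_chart hg p).contDiffAt (hT.mem_nhds hy)).isSymmSndFDerivAt
        (by simp; exact infty_two)).eq v u
    rw [hsym] at htr
    have htr0 : LinearMap.trace ℝ (Fin n → ℂ) ((inChart (K.perturb φ) p y).inverse.comp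
        (fderiv ℝ (fderiv ℝ (g ∘ (chartAt (Fin n → ℂ) p).symm)) y)).toLinearMap = 0 := by linarith
    simp only [htr0, mul_zero, add_zero]
    congr 1
    rw [KahlerForm.bracket, bracketR_chart p hy (K.perturb_isPositive hφ _) hf hg,
      hpos.bracketR_eq]
  · rw [KahlerForm.bracket, (K.perturb_isPositive hφ x).bracketR_eq, dAt_eq_zero hx]
    rfl

theorem integral_bracket (hφ : φ ∈ K.potentials) {f g : X → ℝ}
    (hf : ContMDiff 𝓘(ℝ, Fin n → ℂ) 𝓘(ℝ, ℝ) ∞ f) (hg : ContMDiff 𝓘(ℝ, Fin n → ℂ) 𝓘(ℝ, ℝ) ∞ g) :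
    integralTop (K.perturb φ) (K.bracket φ f g) = 0 := by
  have h : ∀ x, K.bracket φ f g x
      = ∑ p ∈ partitionIndex n X, K.bracket φ (fun x => chartPartition n X p x * f x) g x := by
    intro x
    simp only [KahlerForm.bracket, (K.perturb_isPositive hφ x).bracketR_eq]
    rw [dAt_eq_sum_partition hf]
    simp
  rw [integralTop_congr h, integralTop_finsetSum K φ _ fun p _ =>
    (K.contMDiff_bracket hφ (contMDiff_partition_mul hf p) hg).continuous]
  exact Finset.sum_eq_zero fun p _ => integral_bracket_of_tsupport K hφ
    (contMDiff_partition_mul hf p) hg p (tsupport_partition_mul f p)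

/-- With S = -B(·, i·) one has `ddc n B` = ½(S - Sᵀ), and Sᵀ contributes the opposite of the trace
of S. -/
theorem trace_eq_contr {η : BForm n} (h : IsPositive η) (B : BForm n) :
    LinearMap.trace ℝ (Fin n → ℂ) (η.inverse.comp
      (-(B.bilinearComp (ContinuousLinearMap.id ℝ _) (cplxJ n)))).toLinearMap
      = 2 * contr η (ddc n B) := by
  set S : BForm n := -(B.bilinearComp (ContinuousLinearMap.id ℝ _) (cplxJ n)) with hS
  have htr := trace_comp_flip (W := η.inverse) (fun a c => by
        rw [← h.bracketR_eq, ← h.bracketR_eq, h.bracketR_swap]) S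
  have hd : ddc n B = (1 / 2 : ℝ) • (S - S.flip) := by
    ext u v
    simp [ddc_apply, hS]
    ring
  rw [hd, contr_smul, contr, ContinuousLinearMap.comp_sub, ContinuousLinearMap.toLinearMap_sub,
    map_sub, htr]
  ring

/-- Here b = -dg∘i, so that η⁻¹(b) is the gradient of g and the trace of its derivative term is
twice the normalised Laplacian. -/
theorem integral_gradDot_of_tsupport (hφ : φ ∈ K.potentials) {f g : X → ℝ}
    (hf : ContMDiff 𝓘(ℝ, Fin n → ℂ) 𝓘(ℝ, ℝ) ∞ f) (hg : ContMDiff 𝓘(ℝ, Fin n → ℂ) 𝓘(ℝ, ℝ) ∞ g)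
    (p : X) (hs : tsupport f ⊆ (chartAt (Fin n → ℂ) p).source) :
    integralTop (K.perturb φ) (fun x => K.gradDot φ f g x + f x * (2 * K.lap φ g x)) = 0 := by
  have hT := (chartAt (Fin n → ℂ) p).open_target
  have hc : Continuous fun x => K.gradDot φ f g x + f x * (2 * K.lap φ g x) :=
    (K.contMDiff_gradDot hφ hf hg).continuous.add
      (hf.continuous.mul (continuous_const.mul (K.contMDiff_lap hφ hg).continuous))
  have hdg := (contDiffOn_chart hg p).fderiv_infty hT
  rw [integralTop_eq_chart K hφ hc p ((tsupport_subset_of_forall fun x hx => ?_).trans hs)]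
  · rw [← integral_hamiltonian_chart K hφ hf p hs
      (b := fun y => -((fderiv ℝ (g ∘ (chartAt (Fin n → ℂ) p).symm) y).comp (cplxJ n)))
      (hdg.clm_comp contDiffOn_const).neg]
    refine setIntegral_congr_fun hT.measurableSet fun y hy => ?_
    have hpos := K.inChart_perturb_isPositive hφ p hy
    have hb : fderiv ℝ
        (fun y => -((fderiv ℝ (g ∘ (chartAt (Fin n → ℂ) p).symm) y).comp (cplxJ n))) y
        = -((fderiv ℝ (fderiv ℝ (g ∘ (chartAt (Fin n → ℂ) p).symm)) y).bilinearComp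
          (ContinuousLinearMap.id ℝ _) (cplxJ n)) := by
      have h1 := ((hdg.differentiableAt_of_isOpen hT hy).hasFDerivAt.clm_comp
        (hasFDerivAt_const (cplxJ n) y)).neg
      refine h1.fderiv.trans ?_
      ext u v
      simp
    simp only [hb, trace_eq_contr hpos]
    congr 1
    rw [KahlerForm.gradDot, KahlerForm.lap, dotR_chart p hy (K.perturb_isPositive hφ _) hf hg,
      contr_chart p hy (K.perturb_isPositive hφ _), inChart_iddbar hg p hy]
    rfl
  · rw [KahlerForm.gradDot, dotR, dAt_eq_zero hx, image_eq_zero_of_notMem_tsupport hx]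
    simp

theorem integral_gradDot (hφ : φ ∈ K.potentials) {f g : X → ℝ}
    (hf : ContMDiff 𝓘(ℝ, Fin n → ℂ) 𝓘(ℝ, ℝ) ∞ f) (hg : ContMDiff 𝓘(ℝ, Fin n → ℂ) 𝓘(ℝ, ℝ) ∞ g) :
    integralTop (K.perturb φ) (fun x => K.gradDot φ f g x + f x * (2 * K.lap φ g x)) = 0 := by
  have h : ∀ x, K.gradDot φ f g x + f x * (2 * K.lap φ g x)
      = ∑ p ∈ partitionIndex n X, (K.gradDot φ (fun x => chartPartition n X p x * f x) g x
        + chartPartition n X p x * f x * (2 * K.lap φ g x)) := by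
    intro x
    rw [Finset.sum_add_distrib, ← Finset.sum_mul, ← Finset.sum_mul, sum_chartPartition, one_mul]
    congr 1
    simp only [KahlerForm.gradDot, dotR]
    rw [dAt_eq_sum_partition hf]
    simp
  rw [integralTop_congr h, integralTop_finsetSum K φ _
    (f := fun p x => K.gradDot φ (fun x => chartPartition n X p x * f x) g x
        + chartPartition n X p x * f x * (2 * K.lap φ g x)) fun p _ =>
    (K.contMDiff_gradDot hφ (contMDiff_partition_mul hf p) hg).continuous.add
      ((contMDiff_partition_mul hf p).continuous.mul
        (continuous_const.mul (K.contMDiff_lap hφ hg).continuous))]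
  exact Finset.sum_eq_zero fun p _ => integral_gradDot_of_tsupport K hφ
    (contMDiff_partition_mul hf p) hg p (tsupport_partition_mul f p)

/-- The three-form `θ` is totally antisymmetric. -/
theorem KahlerForm.theta_eq (hφ : φ ∈ K.potentials) (ψ a b : Smooth n X) :
    K.theta φ ψ a b = integralTop (K.perturb φ) (fun x => ψ x * K.bracket φ a b x) := by
  -- By Leibniz, 0 = ∫{ψb, a} = ∫ b{ψ, a} - ∫ ψ{a, b}.
  have h := integral_bracket K hφ (ψ.contMDiff.mul b.contMDiff) a.contMDiff
  have e : ∀ x, K.bracket φ (fun x => ψ x * b x) a x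
      = K.bracket φ ψ a x * b x + (-1) * (ψ x * K.bracket φ a b x) := fun x => by
    rw [K.bracket_mul hφ a ψ.contMDiff b.contMDiff, K.bracket_swap hφ a b]
    ring
  have h' : integralTop (K.perturb φ) (K.bracket φ (fun x => ψ x * b x) a) = 0 := h
  rw [integralTop_congr e, integralTop_add K φ, integralTop_const_mul] at h'
  · rw [KahlerForm.theta, KahlerForm.mabuchi]
    linarith
  · exact (K.contMDiff_bracket hφ ψ.contMDiff a.contMDiff).continuous.mul b.contMDiff.continuous
  · exact continuous_const.mul (ψ.contMDiff.continuous.mul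
      (K.contMDiff_bracket hφ a.contMDiff b.contMDiff).continuous)

/-- Green's formula for the pairs (a², ψ) and (aψ, a). Eliminating ∫ a⟨∇a, ∇ψ⟩ between the two moves
the Laplacian from ψ to a. -/
theorem integral_lap_sub (hφ : φ ∈ K.potentials) {a ψ : X → ℝ}
    (ha : ContMDiff 𝓘(ℝ, Fin n → ℂ) 𝓘(ℝ, ℝ) ∞ a) (hψ : ContMDiff 𝓘(ℝ, Fin n → ℂ) 𝓘(ℝ, ℝ) ∞ ψ) :
    integralTop (K.perturb φ) (fun x => a x * a x * K.lap φ ψ x)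
      = integralTop (K.perturb φ) (fun x => 2 * (a x * ψ x * K.lap φ a x))
        + integralTop (K.perturb φ) (fun x => ψ x * K.gradDot φ a a x) := by
  have h1 := integral_gradDot K hφ (ha.mul ha) hψ
  have h2 := integral_gradDot K hφ (ha.mul hψ) ha
  have hca := ha.continuous
  have hcψ := hψ.continuous
  have c1 : Continuous fun x => a x * K.gradDot φ a ψ x :=
    hca.mul (K.contMDiff_gradDot hφ ha hψ).continuous
  have c2 : Continuous fun x => a x * a x * K.lap φ ψ x :=
    (hca.mul hca).mul (K.contMDiff_lap hφ hψ).continuous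
  have c3 : Continuous fun x => a x * ψ x * K.lap φ a x :=
    (hca.mul hcψ).mul (K.contMDiff_lap hφ ha).continuous
  have c4 : Continuous fun x => ψ x * K.gradDot φ a a x :=
    hcψ.mul (K.contMDiff_gradDot hφ ha ha).continuous
  have e1 : integralTop (K.perturb φ) (fun x => 2 * (a x * K.gradDot φ a ψ x)
      + 2 * (a x * a x * K.lap φ ψ x)) = 0 := by
    rw [← h1]
    refine integralTop_congr fun x => ?_
    have := K.gradDot_mul (φ := φ) ψ ha ha x
    change _ = K.gradDot φ (fun x => a x * a x) ψ x + a x * a x * (2 * K.lap φ ψ x)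
    rw [this]
    ring
  have e2 : integralTop (K.perturb φ) (fun x => (a x * K.gradDot φ a ψ x
      + ψ x * K.gradDot φ a a x) + 2 * (a x * ψ x * K.lap φ a x)) = 0 := by
    rw [← h2]
    refine integralTop_congr fun x => ?_
    have := K.gradDot_mul (φ := φ) a ha hψ x
    change _ = K.gradDot φ (fun x => a x * ψ x) a x + a x * ψ x * (2 * K.lap φ a x)
    rw [this, K.gradDot_swap hφ ψ a]
    ring
  rw [integralTop_add K φ (f := fun x => 2 * (a x * K.gradDot φ a ψ x))
    (g := fun x => 2 * (a x * a x * K.lap φ ψ x)) (continuous_const.mul c1)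
    (continuous_const.mul c2), integralTop_const_mul, integralTop_const_mul] at e1
  rw [integralTop_add K φ (f := fun x => a x * K.gradDot φ a ψ x + ψ x * K.gradDot φ a a x)
    (g := fun x => 2 * (a x * ψ x * K.lap φ a x)) (c1.add c4) (continuous_const.mul c3),
    integralTop_add K φ c1 c4,
    integralTop_const_mul] at e2
  rw [integralTop_const_mul]
  linarith

end Parts

/-! ### Integrals over `X` depending on parameters -/

section ParametricIntegrals

open MeasureTheory

variable {n : ℕ} {X : Type*} [TopologicalSpace X] [ChartedSpace (Fin n → ℂ) X]
  [IsManifold 𝓘(ℂ, Fin n → ℂ) ω X] [CompactSpace X]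
  (K : KahlerForm n X)
  {E : Type*} [NormedAddCommGroup E] [NormedSpace ℝ E] {W : Set E}
  {φ : E → Smooth n X} {f : E → X → ℝ}

theorem apply_smul_I_smul (η : BForm n) (c : ℝ) (u : Fin n → ℂ) :
    η (c • u) (Complex.I • (c • u)) = c * c * η u (Complex.I • u) := by
  rw [smul_comm Complex.I c u, (η (c • u)).map_smul, η.map_smul, smul_apply, smul_eq_mul,
    smul_eq_mul, mul_assoc]

/-- In a chart, positivity is an open condition on the compact unit sphere; homogeneity of degree 2
extends it to all nonzero vectors. -/
theorem SmoothFam.eventually_pos (hφ : SmoothFam n W fun w => φ w) (hW : IsOpen W)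
    {w : E} (hw : w ∈ W) (hp : φ w ∈ K.potentials) (x : X) :
    ∀ᶠ q : E × X in nhds (w, x), ∀ u, u ≠ 0 → 0 < K.perturb (φ q.1) q.2 u (cplxJ n u) := by
  have hU := hW.prod (chartAt (Fin n → ℂ) x).open_target
  have hy := mem_chart_target (Fin n → ℂ) x
  have hU' := hU.mem_nhds (x := (w, chartAt (Fin n → ℂ) x x)) ⟨hw, hy⟩
  have hcont := ((hφ.inChart_perturb K hW x).continuousOn).continuousAt hU'
  have h1 : ∀ᶠ q : E × (Fin n → ℂ) in nhds (w, chartAt (Fin n → ℂ) x x),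
      ∀ u ∈ Metric.sphere (0 : Fin n → ℂ) 1,
        0 < inChart (K.perturb (φ q.1)) x q.2 u (Complex.I • u) := by
    refine (isCompact_sphere _ _).eventually_forall_of_forall_eventually fun u hu => ?_
    have hc : ContinuousAt (fun r : (E × (Fin n → ℂ)) × (Fin n → ℂ) =>
        inChart (K.perturb (φ r.1.1)) x r.1.2 r.2 (Complex.I • r.2))
        ((w, chartAt (Fin n → ℂ) x x), u) := by
      have h0 : ContinuousAt (fun r : (E × (Fin n → ℂ)) × (Fin n → ℂ) =>
          inChart (K.perturb (φ r.1.1)) x r.1.2) ((w, chartAt (Fin n → ℂ) x x), u) :=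
        ContinuousAt.comp (f := fun r : (E × (Fin n → ℂ)) × (Fin n → ℂ) => r.1)
          (g := fun q : E × (Fin n → ℂ) => inChart (K.perturb (φ q.1)) x q.2) hcont
          continuousAt_fst
      exact (h0.clm_apply continuousAt_snd).clm_apply (by fun_prop)
    refine hc.eventually_const_lt ?_
    refine (K.inChart_perturb_isPositive hp x hy).positive u ?_
    rintro rfl
    simp at hu
  have hchart : ContinuousAt (fun q : E × X => (q.1, chartAt (Fin n → ℂ) x q.2)) (w, x) := by
    refine continuousAt_fst.prodMk ?_
    exact ContinuousAt.comp (f := fun q : E × X => q.2) (g := chartAt (Fin n → ℂ) x)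
      ((chartAt (Fin n → ℂ) x).continuousAt (mem_chart_source _ x)) continuousAt_snd
  have hsrc : ∀ᶠ q : E × X in nhds (w, x), q.2 ∈ (chartAt (Fin n → ℂ) x).source :=
    continuous_snd.continuousAt.eventually
      ((chartAt (Fin n → ℂ) x).open_source.mem_nhds (mem_chart_source _ x))
  filter_upwards [hchart.eventually h1, hsrc] with q hq hqs u hu
  have hqt := (chartAt (Fin n → ℂ) x).map_source hqs
  obtain ⟨A, hA⟩ := exists_equiv_chartFrame x hqt
  have hI := chartFrame_I x hqt (A.symm u)
  have hne : A.symm u ≠ 0 := by simpa using hu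
  have hn : 0 < ‖A.symm u‖ := norm_pos_iff.2 hne
  -- The vector is transported to the chart and normalised; the positive factor is then removed.
  have := hq (‖A.symm u‖⁻¹ • A.symm u) (by simp [norm_smul, hn.ne'])
  rw [apply_smul_I_smul] at this
  have h2 := pos_of_mul_pos_right this (by positivity)
  rw [inChart_eq_pull, pull_apply, hI, ← hA, (chartAt (Fin n → ℂ) x).left_inv hqs] at h2
  simpa using h2

/-- Openness of H_ω along smooth families: compactness of X makes the pointwise statement uniform.
-/
theorem SmoothFam.eventually_potentials (hφ : SmoothFam n W fun w => φ w) (hW : IsOpen W)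
    {w : E} (hw : w ∈ W) (hp : φ w ∈ K.potentials) :
    ∀ᶠ w' in nhds w, φ w' ∈ K.potentials := by
  have := isCompact_univ.eventually_forall_of_forall_eventually (x₀ := w)
    (P := fun w' (x : X) => ∀ u, u ≠ 0 → 0 < K.perturb (φ w') x u (cplxJ n u))
    fun x _ => hφ.eventually_pos K hW hw hp x
  filter_upwards [this] with w' hw' x using hw' x trivial

variable [T2Space X]

theorem SmoothFam.continuousOn_integrand (hφ : SmoothFam n W fun w => φ w) (hW : IsOpen W)
    (hf : SmoothFam n W f) (p : X) :
    ContinuousOn (fun q : E × (Fin n → ℂ) =>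
      chartPartition n X p ((chartAt (Fin n → ℂ) p).symm q.2)
        * f q.1 ((chartAt (Fin n → ℂ) p).symm q.2) * WZW.topPower (inChart (K.perturb (φ q.1)) p q.2))
      (W ×ˢ chartSupport n p) :=
  (((SmoothFam.const (chartPartition n X p).contMDiff).mul hf p).mul
    (hφ.topPower K hW p)).continuousOn.mono (Set.prod_mono_right (chartSupport_subset p))

theorem SmoothFam.continuousOn_integralTop (hφ : SmoothFam n W fun w => φ w) (hW : IsOpen W)
    (hf : SmoothFam n W f) : ContinuousOn (fun w => integralTop (K.perturb (φ w)) (f w)) W := by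
  simp only [integralTop_eq_sum]
  exact continuousOn_finsetSum _ fun p _ =>
    continuousOn_setIntegral_of_compact (μ := volume) (chartSupport_isCompact p)
      (g := fun w y => chartPartition n X p ((chartAt (Fin n → ℂ) p).symm y)
        * f w ((chartAt (Fin n → ℂ) p).symm y) * WZW.topPower (inChart (K.perturb (φ w)) p y))
      (hφ.continuousOn_integrand K hW hf p)

theorem SmoothFam.hasLineDerivAt_integralTop (hφ : SmoothFam n W fun w => φ w) (hW : IsOpen W)
    (hpot : ∀ w ∈ W, φ w ∈ K.potentials) (hf : SmoothFam n W f) (v : E) {w : E} (hw : w ∈ W) :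
    HasLineDerivAt ℝ (fun w => integralTop (K.perturb (φ w)) (f w))
      (integralTop (K.perturb (φ w)) (fun x => WZW.famDeriv f v w x
        + f w x * K.lap (φ w) (WZW.famDeriv (fun w => φ w) v w) x)) w v := by
  have hline : Continuous fun s : ℝ => w + s • v := by fun_prop
  have hS : (fun s : ℝ => w + s • v) ⁻¹' W ∈ nhds 0 :=
    (hW.preimage hline).mem_nhds (by simpa using hw)
  have hf' : SmoothFam n W fun w x => WZW.famDeriv f v w x
        + f w x * K.lap (φ w) (WZW.famDeriv (fun w => φ w) v w) x :=
    (hf.famDeriv hW v).add (hf.mul (hφ.lap K hW hpot (hφ.famDeriv hW v)))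
  rw [HasLineDerivAt]
  simp only [integralTop_eq_sum]
  refine HasDerivAt.fun_sum fun p _ => ?_
  -- The second term of `g'` comes from differentiating the volume density.
  have key := hasDerivAt_setIntegral_of_compact (μ := volume) hS (chartSupport_isCompact p)
    (g := fun s y => chartPartition n X p ((chartAt (Fin n → ℂ) p).symm y)
        * f (w + s • v) ((chartAt (Fin n → ℂ) p).symm y)
        * WZW.topPower (inChart (K.perturb (φ (w + s • v))) p y))
    (g' := fun s y => chartPartition n X p ((chartAt (Fin n → ℂ) p).symm y)
        * (WZW.famDeriv f v (w + s • v) ((chartAt (Fin n → ℂ) p).symm y)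
          + f (w + s • v) ((chartAt (Fin n → ℂ) p).symm y) * K.lap (φ (w + s • v))
            (WZW.famDeriv (fun w => φ w) v (w + s • v)) ((chartAt (Fin n → ℂ) p).symm y))
        * WZW.topPower (inChart (K.perturb (φ (w + s • v))) p y))
    (fun s hs => (hφ.continuousOn_integrand K hW hf p).comp
      (Continuous.prodMk_right (w + s • v)).continuousOn fun y hy => ⟨hs, hy⟩)
    ((hφ.continuousOn_integrand K hW hf' p).comp
      (f := fun q : ℝ × (Fin n → ℂ) => (w + q.1 • v, q.2)) (by fun_prop)
      fun q hq => ⟨hq.1, hq.2⟩) ?_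
  · simpa using key
  · intro s hs y hy
    have hyt := chartSupport_subset p hy
    have hl : HasDerivAt (fun s : ℝ => w + s • v) v s := by
      simpa using ((hasDerivAt_id s).smul_const v).const_add w
    have h1 := (hf.hasFDerivAt hW hs ((chartAt (Fin n → ℂ) p).symm y)).comp_hasDerivAt s hl
    have hd : DifferentiableAt ℝ
        (fun w => WZW.topPower (inChart (K.perturb (φ w)) p y)) (w + s • v) :=
      (hasFDerivAt_slice_fst ((hφ.topPower K hW p).differentiableAt_of_isOpen
        (hW.prod (chartAt (Fin n → ℂ) p).open_target)
        (q := (w + s • v, y)) ⟨hs, hyt⟩).hasFDerivAt).differentiableAt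
    have h2 := hd.hasFDerivAt.comp_hasDerivAt s hl
    rw [hφ.fderiv_topPower K hW hpot p v hs hyt] at h2
    refine ((h1.const_mul _).mul h2).congr_deriv ?_
    simp only [WZW.famDeriv, Function.comp_apply]
    ring

end ParametricIntegrals

/-! ### Two-forms along smooth families of potentials -/

section SmoothSpace

open Filter Topology

variable {n : ℕ} {X : Type*} [TopologicalSpace X] [ChartedSpace (Fin n → ℂ) X]
  [IsManifold 𝓘(ℂ, Fin n → ℂ) ω X]

theorem toSmooth_apply {f : X → ℝ} (hf : ContMDiff 𝓘(ℝ, Fin n → ℂ) 𝓘(ℝ, ℝ) ∞ f) (x : X) :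
    toSmooth n f x = f x := by
  have h : toSmooth n f = (⟨f, hf⟩ : Smooth n X) := dif_pos hf
  rw [h]
  rfl

theorem toSmooth_coe (f : Smooth n X) : toSmooth n f = f := by
  ext x
  exact toSmooth_apply f.contMDiff x

theorem contDiffAt_chart (f : Smooth n X) (p : X) {y : Fin n → ℂ}
    (hy : y ∈ (chartAt (Fin n → ℂ) p).target) (k : ℕ) :
    ContDiffAt ℝ k (f ∘ (chartAt (Fin n → ℂ) p).symm) y :=
  ((contDiffOn_chart f.contMDiff p).contDiffAt
    ((chartAt (Fin n → ℂ) p).open_target.mem_nhds hy)).of_le (by exact_mod_cast le_top)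

theorem iteratedFDeriv_chart_add (f g : Smooth n X) (p : X) {y : Fin n → ℂ}
    (hy : y ∈ (chartAt (Fin n → ℂ) p).target) (k : ℕ) :
    iteratedFDeriv ℝ k ((f + g : Smooth n X) ∘ (chartAt (Fin n → ℂ) p).symm) y
      = iteratedFDeriv ℝ k (f ∘ (chartAt (Fin n → ℂ) p).symm) y
        + iteratedFDeriv ℝ k (g ∘ (chartAt (Fin n → ℂ) p).symm) y :=
  iteratedFDeriv_add_apply (contDiffAt_chart f p hy k) (contDiffAt_chart g p hy k)

theorem iteratedFDeriv_chart_sub (f g : Smooth n X) (p : X) {y : Fin n → ℂ}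
    (hy : y ∈ (chartAt (Fin n → ℂ) p).target) (k : ℕ) :
    iteratedFDeriv ℝ k ((f - g : Smooth n X) ∘ (chartAt (Fin n → ℂ) p).symm) y
      = iteratedFDeriv ℝ k (f ∘ (chartAt (Fin n → ℂ) p).symm) y
        - iteratedFDeriv ℝ k (g ∘ (chartAt (Fin n → ℂ) p).symm) y :=
  iteratedFDeriv_sub_apply (contDiffAt_chart f p hy k) (contDiffAt_chart g p hy k)

theorem iteratedFDeriv_chart_smul (c : ℝ) (f : Smooth n X) (p : X) {y : Fin n → ℂ}
    (hy : y ∈ (chartAt (Fin n → ℂ) p).target) (k : ℕ) :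
    iteratedFDeriv ℝ k ((c • f : Smooth n X) ∘ (chartAt (Fin n → ℂ) p).symm) y
      = c • iteratedFDeriv ℝ k (f ∘ (chartAt (Fin n → ℂ) p).symm) y :=
  iteratedFDeriv_const_smul_apply (contDiffAt_chart f p hy k)

/-- Convergence of every derivative jointly in the index and a moving point is the same as locally
uniform convergence, the limit being continuous. -/
theorem tendsto_smooth {ι : Type*} {l : Filter ι} {F : ι → Smooth n X} {g : Smooth n X}
    (h : ∀ (p : X) (k : ℕ), ∀ y ∈ (chartAt (Fin n → ℂ) p).target,
      Tendsto (fun q : ι × (Fin n → ℂ) =>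
        iteratedFDeriv ℝ k (F q.1 ∘ (chartAt (Fin n → ℂ) p).symm) q.2) (l ×ˢ 𝓝 y)
        (𝓝 (iteratedFDeriv ℝ k (g ∘ (chartAt (Fin n → ℂ) p).symm) y))) :
    Tendsto F l (𝓝 g) := by
  rw [nhds_iInf, tendsto_iInf]
  intro p
  rw [nhds_iInf, tendsto_iInf]
  intro k
  rw [nhds_induced, tendsto_comap_iff]
  have := (chartAt (Fin n → ℂ) p).open_target.locallyCompactSpace
  rw [ContinuousMap.tendsto_iff_tendstoLocallyUniformly,
    tendstoLocallyUniformly_iff_forall_tendsto]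
  intro y
  have h1 : Tendsto (fun q : ι × (chartAt (Fin n → ℂ) p).target => chartDeriv p k (F q.1) q.2)
      (l ×ˢ 𝓝 y) (𝓝 (chartDeriv p k g y)) :=
    (h p k y y.2).comp (tendsto_fst.prodMk
      ((continuous_subtype_val.tendsto y).comp tendsto_snd))
  have h2 : Tendsto (fun q : ι × (chartAt (Fin n → ℂ) p).target => chartDeriv p k g q.2)
      (l ×ˢ 𝓝 y) (𝓝 (chartDeriv p k g y)) :=
    ((chartDeriv p k g).continuous.tendsto y).comp tendsto_snd
  exact ((h2.prodMk_nhds h1).mono_right (nhds_le_uniformity _))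

variable {E : Type*} [NormedAddCommGroup E] [NormedSpace ℝ E] {W : Set E}
  {φ ξ ζ : E → Smooth n X}

theorem SmoothFam.toSmooth {f : E → X → ℝ} (hf : SmoothFam n W f) :
    SmoothFam n W fun w => WZW.toSmooth n (f w) :=
  hf.congr fun _ hw x => toSmooth_apply (hf.slice hw) x

theorem SmoothFam.continuousAt_smooth (hφ : SmoothFam n W fun w => φ w) (hW : IsOpen W) {w : E}
    (hw : w ∈ W) : ContinuousAt φ w := by
  refine tendsto_smooth fun p k y hy => ?_
  have hU := hW.prod (chartAt (Fin n → ℂ) p).open_target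
  rw [← nhds_prod_eq]
  exact ((contDiffOn_iteratedFDeriv_snd hU (hφ p) k).continuousOn.continuousAt
    (hU.mem_nhds (x := (w, y)) ⟨hw, hy⟩))

/-- The derivative of a family of smooth functions in the direction `v`. -/
def smoothDeriv (φ : E → Smooth n X) (v w : E) : Smooth n X :=
  WZW.toSmooth n (famDeriv (fun w => φ w) v w)

theorem SmoothFam.smoothDeriv (hφ : SmoothFam n W fun w => φ w) (hW : IsOpen W) (v : E) :
    SmoothFam n W fun w => WZW.smoothDeriv φ v w := (hφ.famDeriv hW v).toSmooth

theorem SmoothFam.smoothDeriv_apply (hφ : SmoothFam n W fun w => φ w) (hW : IsOpen W) (v : E)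
    {w : E} (hw : w ∈ W) (x : X) :
    WZW.smoothDeriv φ v w x = fderiv ℝ (fun w' => φ w' x) w v :=
  toSmooth_apply ((hφ.famDeriv hW v).slice hw) x

/-- A smooth family is directionally differentiable as a curve in the Fréchet space, with its
pointwise derivative as derivative. -/
theorem SmoothFam.tendsto_quotient (hφ : SmoothFam n W fun w => φ w) (hW : IsOpen W) (v : E)
    {w : E} (hw : w ∈ W) :
    Tendsto (fun s : ℝ => s⁻¹ • (φ (w + s • v) - φ w)) (𝓝[≠] 0) (𝓝 (WZW.smoothDeriv φ v w)) := by
  refine tendsto_smooth fun p k y hy => ?_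
  have hU := hW.prod (chartAt (Fin n → ℂ) p).open_target
  have h1 := tendsto_differenceQuotient hU (contDiffOn_iteratedFDeriv_snd hU (hφ p) k) v
    (w := w) (y := y) ⟨hw, hy⟩
  have h2 := fderiv_iteratedFDeriv_comm hU (hφ p) v k (w := w) (y := y) ⟨hw, hy⟩
  have h3 : iteratedFDeriv ℝ k (WZW.smoothDeriv φ v w ∘ (chartAt (Fin n → ℂ) p).symm) y
      = iteratedFDeriv ℝ k (fun y' => fderiv ℝ
        (fun w' => φ w' ((chartAt (Fin n → ℂ) p).symm y')) w v) y := by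
    congr 1
    ext y'
    exact hφ.smoothDeriv_apply hW v hw _
  rw [h3]
  refine (h1.mono_right (le_of_eq (congrArg 𝓝 h2))).congr' ?_
  have ht : ∀ᶠ y' in 𝓝 y, y' ∈ (chartAt (Fin n → ℂ) p).target :=
    (chartAt (Fin n → ℂ) p).open_target.mem_nhds hy
  filter_upwards [ht.prod_inr (𝓝[≠] (0 : ℝ))] with q hq
  rw [iteratedFDeriv_chart_smul _ _ p hq, iteratedFDeriv_chart_sub _ _ p hq]
  rfl

/-- The weights τ are arbitrary in [0, 1], with no continuity in s. Boundedness is enough because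
the difference they multiply tends to 0. -/
theorem tendsto_segment {l : Filter ℝ} {F : ℝ → Smooth n X} {g : Smooth n X} {τ : ℝ → ℝ}
    (h : ∀ (p : X) (k : ℕ), ∀ y ∈ (chartAt (Fin n → ℂ) p).target,
      Tendsto (fun q : ℝ × (Fin n → ℂ) =>
        iteratedFDeriv ℝ k (F q.1 ∘ (chartAt (Fin n → ℂ) p).symm) q.2) (l ×ˢ 𝓝 y)
        (𝓝 (iteratedFDeriv ℝ k (g ∘ (chartAt (Fin n → ℂ) p).symm) y)))
    (hτ : ∀ s, τ s ∈ Set.Icc (0 : ℝ) 1) :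
    Tendsto (fun s => g + τ s • (F s - g)) l (𝓝 g) := by
  refine tendsto_smooth fun p k y hy => ?_
  have ht : ∀ᶠ y' in 𝓝 y, y' ∈ (chartAt (Fin n → ℂ) p).target :=
    (chartAt (Fin n → ℂ) p).open_target.mem_nhds hy
  have hg : Tendsto (fun q : ℝ × (Fin n → ℂ) =>
      iteratedFDeriv ℝ k (g ∘ (chartAt (Fin n → ℂ) p).symm) q.2) (l ×ˢ 𝓝 y)
      (𝓝 (iteratedFDeriv ℝ k (g ∘ (chartAt (Fin n → ℂ) p).symm) y)) := by
    have hc : ContinuousAt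
        (fun y => iteratedFDeriv ℝ k (g ∘ (chartAt (Fin n → ℂ) p).symm) y) y :=
      (continuousOn_iff_continuous_domRestrict.2 (chartDeriv p k g).continuous).continuousAt
        ((chartAt (Fin n → ℂ) p).open_target.mem_nhds hy)
    exact hc.tendsto.comp tendsto_snd
  have h0 := (h p k y hy).sub hg
  rw [sub_self] at h0
  have h1 : Tendsto (fun q : ℝ × (Fin n → ℂ) => τ q.1 •
      (iteratedFDeriv ℝ k (F q.1 ∘ (chartAt (Fin n → ℂ) p).symm) q.2
        - iteratedFDeriv ℝ k (g ∘ (chartAt (Fin n → ℂ) p).symm) q.2)) (l ×ˢ 𝓝 y) (𝓝 0) := by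
    refine squeeze_zero_norm (fun q => ?_) (tendsto_zero_iff_norm_tendsto_zero.1 h0)
    rw [norm_smul, Real.norm_of_nonneg (hτ q.1).1]
    exact mul_le_of_le_one_left (norm_nonneg _) (hτ q.1).2
  have h2 := hg.add h1
  rw [add_zero] at h2
  refine h2.congr' ?_
  filter_upwards [ht.prod_inr l] with q hq
  rw [iteratedFDeriv_chart_add _ _ p hq, iteratedFDeriv_chart_smul _ _ p hq,
    iteratedFDeriv_chart_sub _ _ p hq]

end SmoothSpace

/-! ### Convexity of H_ω and the chain rule for a two-form along a family. -/

section FormsAlong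

open Filter Topology

variable {n : ℕ} {X : Type*} [TopologicalSpace X] [ChartedSpace (Fin n → ℂ) X]
  [IsManifold 𝓘(ℂ, Fin n → ℂ) ω X] {K : KahlerForm n X} {α : FormField n X}

theorem fderiv_fderiv_combination {V : Type*} [NormedAddCommGroup V] [NormedSpace ℝ V]
    {f g : V → ℝ} {T : Set V} (hT : IsOpen T) (hf : ContDiffOn ℝ ∞ f T) (hg : ContDiffOn ℝ ∞ g T)
    (c : ℝ) {y : V} (hy : y ∈ T) :
    fderiv ℝ (fderiv ℝ fun z => f z + c * (g z - f z)) y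
      = fderiv ℝ (fderiv ℝ f) y + c • (fderiv ℝ (fderiv ℝ g) y - fderiv ℝ (fderiv ℝ f) y) := by
  have hev : fderiv ℝ (fun z => f z + c * (g z - f z))
      =ᶠ[𝓝 y] fun z => fderiv ℝ f z + c • (fderiv ℝ g z - fderiv ℝ f z) := by
    filter_upwards [hT.mem_nhds hy] with z hz
    have h1 := (hf.differentiableAt_of_isOpen hT hz).hasFDerivAt
    have h2 := (hg.differentiableAt_of_isOpen hT hz).hasFDerivAt
    exact (h1.add ((h2.sub h1).const_mul c)).fderiv
  rw [hev.fderiv_eq]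
  have h1 := ((hf.fderiv_infty hT).differentiableAt_of_isOpen hT hy).hasFDerivAt
  have h2 := ((hg.fderiv_infty hT).differentiableAt_of_isOpen hT hy).hasFDerivAt
  exact (h1.add ((h2.sub h1).const_smul c)).fderiv

theorem KahlerForm.perturb_segment (φ ψ : Smooth n X) (c : ℝ) (x : X) :
    K.perturb (φ + c • (ψ - φ) : Smooth n X) x
      = K.perturb φ x + c • (K.perturb ψ x - K.perturb φ x) := by
  have h := fderiv_fderiv_combination (chartAt (Fin n → ℂ) x).open_target
    (contDiffOn_chart φ.contMDiff x) (contDiffOn_chart ψ.contMDiff x) c (mem_chart_target _ x)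
  have h' : iddbar n (φ + c • (ψ - φ) : Smooth n X) x
      = iddbar n φ x + c • (iddbar n ψ x - iddbar n φ x) := by
    rw [iddbar_eq, iddbar_eq, iddbar_eq]
    refine (congrArg (ddc n) h).trans ?_
    ext u v
    simp [ddc_apply]
    ring
  rw [KahlerForm.perturb, KahlerForm.perturb, KahlerForm.perturb, h']
  ext u v
  simp
  ring

/-- H_ω is convex because φ ↦ ω_φ is affine. Segments can therefore carry the mean value theorem. -/
theorem KahlerForm.segment_mem {φ ψ : Smooth n X} (hφ : φ ∈ K.potentials)
    (hψ : ψ ∈ K.potentials) {c : ℝ} (hc : c ∈ Set.Icc (0 : ℝ) 1) :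
    φ + c • (ψ - φ) ∈ K.potentials := by
  intro x u hu
  rw [K.perturb_segment]
  have h1 := hφ x u hu
  have h2 := hψ x u hu
  simp only [add_apply, smul_apply, sub_apply, smul_eq_mul]
  rcases hc.1.eq_or_lt with rfl | h0
  · simpa using h1
  · nlinarith [mul_pos h0 h2, mul_nonneg (sub_nonneg.2 hc.2) h1.le]

theorem dirDeriv_smul (α : FormField n X) (φ v ξ ζ : Smooth n X) (c : ℝ) :
    dirDeriv α φ (c • v) ξ ζ = c * dirDeriv α φ v ξ ζ := by
  have := deriv_comp_mul_left c (fun t : ℝ => α (φ + t • v) ξ ζ) 0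
  rw [mul_zero, smul_eq_mul] at this
  rw [dirDeriv, dirDeriv, ← this]
  congr 1
  ext t
  rw [smul_smul, mul_comm]

theorem IsTwoForm.hasDerivAt_segment (hα : IsTwoForm K α) {φ v : Smooth n X} (ξ ζ : Smooth n X)
    {τ : ℝ} (h : φ + τ • v ∈ K.potentials) :
    HasDerivAt (fun t : ℝ => α (φ + t • v) ξ ζ) (dirDeriv α (φ + τ • v) v ξ ζ) τ := by
  have h1 : HasDerivAt (fun t : ℝ => α (φ + τ • v + t • v) ξ ζ) (dirDeriv α (φ + τ • v) v ξ ζ) 0 :=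
    (hα.differentiable _ h v ξ ζ).hasDerivAt
  have h2 : HasDerivAt (fun t : ℝ => t - τ) 1 τ := (hasDerivAt_id τ).sub_const τ
  have h3 := HasDerivAt.comp τ (h₂ := fun t : ℝ => α (φ + τ • v + t • v) ξ ζ)
    (h := fun t => t - τ) (by rwa [sub_self]) h2
  rw [mul_one] at h3
  refine h3.congr_of_eventuallyEq (Eventually.of_forall fun t => ?_)
  simp only [Function.comp_apply]
  rw [add_assoc, ← add_smul, add_sub_cancel]

theorem IsTwoForm.exists_segment (hα : IsTwoForm K α) {φ ψ : Smooth n X} (ξ ζ : Smooth n X)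
    (hφ : φ ∈ K.potentials) (hψ : ψ ∈ K.potentials) :
    ∃ τ ∈ Set.Icc (0 : ℝ) 1, α ψ ξ ζ - α φ ξ ζ = dirDeriv α (φ + τ • (ψ - φ)) (ψ - φ) ξ ζ := by
  have hd : ∀ τ ∈ Set.Icc (0 : ℝ) 1, HasDerivAt (fun t : ℝ => α (φ + t • (ψ - φ)) ξ ζ)
      (dirDeriv α (φ + τ • (ψ - φ)) (ψ - φ) ξ ζ) τ := fun τ hτ =>
    hα.hasDerivAt_segment ξ ζ (K.segment_mem hφ hψ hτ)
  obtain ⟨τ, hτ, h⟩ := exists_hasDerivAt_eq_slope (fun t : ℝ => α (φ + t • (ψ - φ)) ξ ζ)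
    (fun τ => dirDeriv α (φ + τ • (ψ - φ)) (ψ - φ) ξ ζ) zero_lt_one
    (fun τ hτ => (hd τ hτ).continuousAt.continuousWithinAt)
    (fun τ hτ => hd τ (Set.Ioo_subset_Icc_self hτ))
  refine ⟨τ, Set.Ioo_subset_Icc_self hτ, ?_⟩
  rw [h]
  simp

theorem IsTwoForm.swap (hα : IsTwoForm K α) {φ : Smooth n X} (hφ : φ ∈ K.potentials)
    (ξ ζ : Smooth n X) : α φ ξ ζ = -α φ ζ ξ := by
  have h := hα.alternating φ hφ (ξ + ζ)
  simp only [map_add, LinearMap.add_apply, hα.alternating φ hφ] at h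
  linarith

theorem IsTwoForm.tendsto_apply (hα : IsTwoForm K α) {ι : Type*} {l : Filter ι}
    {φ ξ ζ : ι → Smooth n X} {φ₀ ξ₀ ζ₀ : Smooth n X} (h₀ : φ₀ ∈ K.potentials)
    (hφ : Tendsto φ l (𝓝 φ₀)) (hp : ∀ᶠ i in l, φ i ∈ K.potentials) (hξ : Tendsto ξ l (𝓝 ξ₀))
    (hζ : Tendsto ζ l (𝓝 ζ₀)) :
    Tendsto (fun i => α (φ i) (ξ i) (ζ i)) l (𝓝 (α φ₀ ξ₀ ζ₀)) :=
  Tendsto.comp (g := fun q : Smooth n X × Smooth n X × Smooth n X => α q.1 q.2.1 q.2.2)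
    (f := fun i => (φ i, ξ i, ζ i)) (hα.continuousOn (φ₀, ξ₀, ζ₀) h₀)
    (tendsto_nhdsWithin_iff.2 ⟨hφ.prodMk_nhds (hξ.prodMk_nhds hζ), hp⟩)

theorem IsTwoForm.tendsto_dirDeriv (hα : IsTwoForm K α) {ι : Type*} {l : Filter ι}
    {φ v ξ ζ : ι → Smooth n X} {φ₀ v₀ ξ₀ ζ₀ : Smooth n X} (h₀ : φ₀ ∈ K.potentials)
    (hφ : Tendsto φ l (𝓝 φ₀)) (hp : ∀ᶠ i in l, φ i ∈ K.potentials) (hv : Tendsto v l (𝓝 v₀))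
    (hξ : Tendsto ξ l (𝓝 ξ₀)) (hζ : Tendsto ζ l (𝓝 ζ₀)) :
    Tendsto (fun i => dirDeriv α (φ i) (v i) (ξ i) (ζ i)) l (𝓝 (dirDeriv α φ₀ v₀ ξ₀ ζ₀)) :=
  Tendsto.comp (g := fun q : Smooth n X × Smooth n X × Smooth n X × Smooth n X =>
      dirDeriv α q.1 q.2.1 q.2.2.1 q.2.2.2)
    (f := fun i => (φ i, v i, ξ i, ζ i)) (hα.continuousOn_deriv (φ₀, v₀, ξ₀, ζ₀) h₀)
    (tendsto_nhdsWithin_iff.2 ⟨hφ.prodMk_nhds (hv.prodMk_nhds (hξ.prodMk_nhds hζ)), hp⟩)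

variable {E : Type*} [NormedAddCommGroup E] [NormedSpace ℝ E] {W : Set E}
  {φ ξ ζ v : E → Smooth n X}

theorem IsTwoForm.continuousOn_along (hα : IsTwoForm K α) (hW : IsOpen W)
    (hφ : SmoothFam n W fun w => φ w) (hpot : ∀ w ∈ W, φ w ∈ K.potentials)
    (hξ : SmoothFam n W fun w => ξ w) (hζ : SmoothFam n W fun w => ζ w) :
    ContinuousOn (fun w => α (φ w) (ξ w) (ζ w)) W := fun w hw =>
  hα.tendsto_apply (hpot w hw)
    ((hφ.continuousAt_smooth hW hw).tendsto.mono_left nhdsWithin_le_nhds)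
    (eventually_mem_nhdsWithin.mono hpot)
    ((hξ.continuousAt_smooth hW hw).tendsto.mono_left nhdsWithin_le_nhds)
    ((hζ.continuousAt_smooth hW hw).tendsto.mono_left nhdsWithin_le_nhds)

theorem IsTwoForm.continuousOn_dirDeriv_along (hα : IsTwoForm K α) (hW : IsOpen W)
    (hφ : SmoothFam n W fun w => φ w) (hpot : ∀ w ∈ W, φ w ∈ K.potentials)
    (hv : SmoothFam n W fun w => v w)
    (hξ : SmoothFam n W fun w => ξ w) (hζ : SmoothFam n W fun w => ζ w) :
    ContinuousOn (fun w => dirDeriv α (φ w) (v w) (ξ w) (ζ w)) W := fun w hw =>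
  hα.tendsto_dirDeriv (hpot w hw)
    ((hφ.continuousAt_smooth hW hw).tendsto.mono_left nhdsWithin_le_nhds)
    (eventually_mem_nhdsWithin.mono hpot)
    ((hv.continuousAt_smooth hW hw).tendsto.mono_left nhdsWithin_le_nhds)
    ((hξ.continuousAt_smooth hW hw).tendsto.mono_left nhdsWithin_le_nhds)
    ((hζ.continuousAt_smooth hW hw).tendsto.mono_left nhdsWithin_le_nhds)

/-- The difference quotient splits into a change of base point and changes of the two vectors. The
last two parts converge by bilinearity and continuity. The first is, by the mean value theorem, a
directional derivative of α at an intermediate potential, and converges because that derivative is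
jointly continuous. -/
theorem IsTwoForm.hasLineDerivAt_along (hα : IsTwoForm K α) (hW : IsOpen W)
    (hφ : SmoothFam n W fun w => φ w) (hpot : ∀ w ∈ W, φ w ∈ K.potentials)
    (hξ : SmoothFam n W fun w => ξ w) (hζ : SmoothFam n W fun w => ζ w) (u : E) {w : E}
    (hw : w ∈ W) :
    HasLineDerivAt ℝ (fun w => α (φ w) (ξ w) (ζ w))
      (dirDeriv α (φ w) (smoothDeriv φ u w) (ξ w) (ζ w) + α (φ w) (smoothDeriv ξ u w) (ζ w)
        + α (φ w) (ξ w) (smoothDeriv ζ u w)) w u := by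
  rw [HasLineDerivAt, hasDerivAt_iff_tendsto_slope]
  have hline : Tendsto (fun s : ℝ => w + s • u) (𝓝[≠] 0) (𝓝 w) := by
    have : Continuous fun s : ℝ => w + s • u := by fun_prop
    have h := this.tendsto 0
    rw [zero_smul, add_zero] at h
    exact h.mono_left nhdsWithin_le_nhds
  have hmem : ∀ᶠ s : ℝ in 𝓝[≠] 0, w + s • u ∈ W := hline.eventually (hW.mem_nhds hw)
  have hne : ∀ᶠ s : ℝ in 𝓝[≠] 0, s ≠ 0 := self_mem_nhdsWithin
  -- The intermediate weight is chosen for every s, with the value 0 where w + s u leaves W.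
  have hex : ∀ s : ℝ, ∃ τ ∈ Set.Icc (0 : ℝ) 1, w + s • u ∈ W →
      α (φ (w + s • u)) (ξ (w + s • u)) (ζ (w + s • u)) - α (φ w) (ξ (w + s • u)) (ζ (w + s • u))
      = dirDeriv α (φ w + τ • (φ (w + s • u) - φ w)) (φ (w + s • u) - φ w)
        (ξ (w + s • u)) (ζ (w + s • u)) := by
    intro s
    by_cases hs : w + s • u ∈ W
    · obtain ⟨τ, hτ, h⟩ := hα.exists_segment (ξ (w + s • u)) (ζ (w + s • u)) (hpot w hw)
        (hpot _ hs)
      exact ⟨τ, hτ, fun _ => h⟩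
    · exact ⟨0, by simp, fun h => absurd h hs⟩
  choose τ hτ hτe using hex
  have hξs := (hξ.continuousAt_smooth hW hw).tendsto.comp hline
  have hζs := (hζ.continuousAt_smooth hW hw).tendsto.comp hline
  have hbase : Tendsto (fun s => φ w + τ s • (φ (w + s • u) - φ w)) (𝓝[≠] 0) (𝓝 (φ w)) := by
    refine tendsto_segment (fun p k y hy => ?_) hτ
    have hU := hW.prod (chartAt (Fin n → ℂ) p).open_target
    have hc := ((contDiffOn_iteratedFDeriv_snd hU (hφ p) k).continuousOn.continuousAt
      (hU.mem_nhds (x := (w, y)) ⟨hw, hy⟩)).tendsto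
    rw [nhds_prod_eq] at hc
    exact hc.comp ((hline.comp tendsto_fst).prodMk tendsto_snd)
  have hδφ := hφ.tendsto_quotient hW u hw
  have hδξ := hξ.tendsto_quotient hW u hw
  have hδζ := hζ.tendsto_quotient hW u hw
  have t1 : Tendsto (fun s : ℝ => dirDeriv α (φ w + τ s • (φ (w + s • u) - φ w))
      (s⁻¹ • (φ (w + s • u) - φ w)) (ξ (w + s • u)) (ζ (w + s • u))) (𝓝[≠] 0)
      (𝓝 (dirDeriv α (φ w) (smoothDeriv φ u w) (ξ w) (ζ w))) := by
    refine hα.tendsto_dirDeriv (hpot w hw) hbase ?_ hδφ hξs hζs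
    filter_upwards [hmem] with s hs using K.segment_mem (hpot w hw) (hpot _ hs) (hτ s)
  have t2 : Tendsto (fun s : ℝ => α (φ w) (s⁻¹ • (ξ (w + s • u) - ξ w)) (ζ (w + s • u))) (𝓝[≠] 0)
      (𝓝 (α (φ w) (smoothDeriv ξ u w) (ζ w))) :=
    hα.tendsto_apply (hpot w hw) tendsto_const_nhds (Eventually.of_forall fun _ => hpot w hw)
      hδξ hζs
  have t3 : Tendsto (fun s : ℝ => α (φ w) (ξ w) (s⁻¹ • (ζ (w + s • u) - ζ w))) (𝓝[≠] 0)
      (𝓝 (α (φ w) (ξ w) (smoothDeriv ζ u w))) :=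
    hα.tendsto_apply (hpot w hw) tendsto_const_nhds (Eventually.of_forall fun _ => hpot w hw)
      tendsto_const_nhds hδζ
  refine ((t1.add t2).add t3).congr' ?_
  filter_upwards [hmem, hne] with s hs hs0
  -- Homogeneity in the direction turns the factor s⁻¹ on the increment into the factor of the
  -- slope.
  rw [slope_def_field, dirDeriv_smul, ← hτe s hs]
  simp only [zero_smul, add_zero, sub_zero, map_smul, map_sub, LinearMap.smul_apply,
    LinearMap.sub_apply, smul_eq_mul]
  field_simp
  ring

variable [CompactSpace X]

/-- Antisymmetry of α is known only on H_ω, hence the need for φ + t v to stay in H_ω for small t.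
-/
theorem IsTwoForm.dirDeriv_swap (hα : IsTwoForm K α) {φ : Smooth n X} (hφ : φ ∈ K.potentials)
    (v ξ ζ : Smooth n X) : dirDeriv α φ v ξ ζ = -dirDeriv α φ v ζ ξ := by
  have hfam : SmoothFam n (Set.univ : Set ℝ) fun t => (φ + t • v : Smooth n X) :=
    (SmoothFam.const φ.contMDiff).add
      (SmoothFam.scalar_mul contDiffOn_id (SmoothFam.const v.contMDiff))
  have hev := hfam.eventually_potentials K isOpen_univ (Set.mem_univ 0) (by simpa using hφ)
  rw [dirDeriv, dirDeriv, ← deriv.fun_neg]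
  refine Filter.EventuallyEq.deriv_eq ?_
  filter_upwards [hev] with t ht using hα.swap ht ξ ζ

end FormsAlong

/-! ### The first variation -/

section LineC1

variable {E : Type*} [NormedAddCommGroup E] [NormedSpace ℝ E]

/-- Continuous functions with a continuous derivative in a given direction. -/
structure LineC1 (F : E → ℝ) (W : Set E) (v : E) : Prop where
  continuousOn : ContinuousOn F W
  hasLineDerivAt : ∀ w ∈ W, HasLineDerivAt ℝ F (lineDeriv ℝ F w v) w v
  continuousOn_deriv : ContinuousOn (fun w => lineDeriv ℝ F w v) W

variable {F G : E → ℝ} {W : Set E} {v : E}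

theorem LineC1.of_hasLineDerivAt {F' : E → ℝ} (h : ContinuousOn F W) (h' : ContinuousOn F' W)
    (hd : ∀ w ∈ W, HasLineDerivAt ℝ F (F' w) w v) : LineC1 F W v :=
  ⟨h, fun w hw => (hd w hw).lineDifferentiableAt.hasLineDerivAt,
    h'.congr fun w hw => (hd w hw).lineDeriv⟩

theorem LineC1.add (hF : LineC1 F W v) (hG : LineC1 G W v) :
    LineC1 (fun w => F w + G w) W v :=
  LineC1.of_hasLineDerivAt (hF.continuousOn.add hG.continuousOn)
    (hF.continuousOn_deriv.add hG.continuousOn_deriv)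
    fun w hw => HasDerivAt.add (hF.hasLineDerivAt w hw) (hG.hasLineDerivAt w hw)

theorem LineC1.const_mul (hF : LineC1 F W v) (c : ℝ) : LineC1 (fun w => c * F w) W v :=
  LineC1.of_hasLineDerivAt (continuousOn_const.mul hF.continuousOn)
    (continuousOn_const.mul hF.continuousOn_deriv)
    fun w hw => HasDerivAt.const_mul c (hF.hasLineDerivAt w hw)

end LineC1

/-! ### Derivatives of g_M, the Euler–Lagrange expression and the currents. -/

section Variation

variable {n : ℕ} {X : Type*} [TopologicalSpace X] [ChartedSpace (Fin n → ℂ) X]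
  [IsManifold 𝓘(ℂ, Fin n → ℂ) ω X]
  {E : Type*} [NormedAddCommGroup E] [NormedSpace ℝ E] {W : Set E}
  {φ ξ ζ : E → Smooth n X}

theorem SmoothFam.smoothDeriv_comm (hφ : SmoothFam n W fun w => φ w) (hW : IsOpen W) (u v : E)
    {w : E} (hw : w ∈ W) :
    WZW.smoothDeriv (WZW.smoothDeriv φ u) v w = WZW.smoothDeriv (WZW.smoothDeriv φ v) u w := by
  have key : ∀ u v x, WZW.smoothDeriv (WZW.smoothDeriv φ u) v w x
      = WZW.famDeriv (WZW.famDeriv (fun w => φ w) u) v w x := fun u v x => by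
    rw [(hφ.smoothDeriv hW u).smoothDeriv_apply hW v hw]
    have : (fun w' => WZW.smoothDeriv φ u w' x) =ᶠ[nhds w] fun w' => WZW.famDeriv (fun w => φ w) u w' x :=
      by filter_upwards [hW.mem_nhds hw] with w' hw' using hφ.smoothDeriv_apply hW u hw' x
    rw [this.fderiv_eq]
    rfl
  ext x
  rw [key, key, hφ.famDeriv_comm hW u v hw]

theorem SmoothFam.coe_smoothDeriv (hφ : SmoothFam n W fun w => φ w) (hW : IsOpen W) (v : E)
    {w : E} (hw : w ∈ W) : (WZW.smoothDeriv φ v w : X → ℝ) = WZW.famDeriv (fun w => φ w) v w := by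
  ext x
  exact hφ.smoothDeriv_apply hW v hw x

variable [CompactSpace X] [T2Space X] (K : KahlerForm n X)

theorem KahlerForm.mabuchi_comm (φ ξ ζ : X → ℝ) : K.mabuchi φ ξ ζ = K.mabuchi φ ζ ξ :=
  integralTop_congr fun _ => mul_comm _ _

variable (hW : IsOpen W) (hφ : SmoothFam n W fun w => φ w) (hpot : ∀ w ∈ W, φ w ∈ K.potentials)

include hW hφ hpot

/-- The Leibniz rule, with a third term for the variation of ω_φⁿ. -/
theorem hasLineDerivAt_mabuchi (hξ : SmoothFam n W fun w => ξ w) (hζ : SmoothFam n W fun w => ζ w)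
    (v : E) {w : E} (hw : w ∈ W) :
    HasLineDerivAt ℝ (fun w => K.mabuchi (φ w) (ξ w) (ζ w))
      (K.mabuchi (φ w) (smoothDeriv ξ v w) (ζ w) + K.mabuchi (φ w) (ξ w) (smoothDeriv ζ v w)
        + integralTop (K.perturb (φ w))
          (fun x => ξ w x * ζ w x * K.lap (φ w) (smoothDeriv φ v w) x)) w v := by
  have h := SmoothFam.hasLineDerivAt_integralTop K hφ hW hpot (hξ.mul hζ) v hw
  have hl : Continuous (K.lap (φ w) (smoothDeriv φ v w)) :=
    (K.contMDiff_lap (hpot w hw) (smoothDeriv φ v w).contMDiff).continuous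
  have hcξ := (ξ w).contMDiff.continuous
  have hcζ := (ζ w).contMDiff.continuous
  have hcξ' := (smoothDeriv ξ v w).contMDiff.continuous
  have hcζ' := (smoothDeriv ζ v w).contMDiff.continuous
  have e : K.mabuchi (φ w) (smoothDeriv ξ v w) (ζ w) + K.mabuchi (φ w) (ξ w) (smoothDeriv ζ v w)
        + integralTop (K.perturb (φ w))
          (fun x => ξ w x * ζ w x * K.lap (φ w) (smoothDeriv φ v w) x)
      = integralTop (K.perturb (φ w)) (fun x => (smoothDeriv ξ v w x * ζ w x
          + ξ w x * smoothDeriv ζ v w x)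
          + ξ w x * ζ w x * K.lap (φ w) (smoothDeriv φ v w) x) := by
    have c1 : Continuous fun x => smoothDeriv ξ v w x * ζ w x := hcξ'.mul hcζ
    have c2 : Continuous fun x => ξ w x * smoothDeriv ζ v w x := hcξ.mul hcζ'
    have c3 : Continuous fun x => ξ w x * ζ w x * K.lap (φ w) (smoothDeriv φ v w) x :=
      (hcξ.mul hcζ).mul hl
    rw [integralTop_add K (φ w) (f := fun x => smoothDeriv ξ v w x * ζ w x
      + ξ w x * smoothDeriv ζ v w x) (c1.add c2) c3, integralTop_add K (φ w) c1 c2]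
    rfl
  rw [e]
  refine HasDerivAt.congr_deriv h (integralTop_congr fun x => ?_)
  have h1 := (hξ.hasFDerivAt hW hw x).mul (hζ.hasFDerivAt hW hw x)
  have h2 := congrArg (fun L : E →L[ℝ] ℝ => L v) h1.fderiv
  rw [hφ.coe_smoothDeriv hW v hw, hξ.smoothDeriv_apply hW v hw, hζ.smoothDeriv_apply hW v hw]
  congr 1
  refine h2.trans ?_
  simp
  ring

theorem continuousOn_mabuchi (hξ : SmoothFam n W fun w => ξ w) (hζ : SmoothFam n W fun w => ζ w) :
    ContinuousOn (fun w => K.mabuchi (φ w) (ξ w) (ζ w)) W :=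
  SmoothFam.continuousOn_integralTop K hφ hW (hξ.mul hζ)

theorem lineC1_mabuchi (hξ : SmoothFam n W fun w => ξ w) (hζ : SmoothFam n W fun w => ζ w)
    (v : E) : LineC1 (fun w => K.mabuchi (φ w) (ξ w) (ζ w)) W v :=
  LineC1.of_hasLineDerivAt (continuousOn_mabuchi K hW hφ hpot hξ hζ)
    (((continuousOn_mabuchi K hW hφ hpot (hξ.smoothDeriv hW v) hζ).add
      (continuousOn_mabuchi K hW hφ hpot hξ (hζ.smoothDeriv hW v))).add
      (SmoothFam.continuousOn_integralTop K hφ hW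
        ((hξ.mul hζ).mul (hφ.lap K hW hpot (hφ.smoothDeriv hW v)))))
    fun _ hw => hasLineDerivAt_mabuchi K hW hφ hpot hξ hζ v hw

variable {K} in
theorem IsTwoForm.lineC1_along {α : FormField n X} (hα : IsTwoForm K α)
    (hξ : SmoothFam n W fun w => ξ w) (hζ : SmoothFam n W fun w => ζ w) (v : E) :
    LineC1 (fun w => α (φ w) (ξ w) (ζ w)) W v :=
  LineC1.of_hasLineDerivAt (hα.continuousOn_along hW hφ hpot hξ hζ)
    (((hα.continuousOn_dirDeriv_along hW hφ hpot (hφ.smoothDeriv hW v) hξ hζ).add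
      (hα.continuousOn_along hW hφ hpot (hξ.smoothDeriv hW v) hζ)).add
      (hα.continuousOn_along hW hφ hpot hξ (hζ.smoothDeriv hW v)))
    fun _ hw => hα.hasLineDerivAt_along hW hφ hpot hξ hζ v hw

omit hW hφ hpot

/-- The density of the perturbed energy for two real directions of the space of parameters. -/
def KahlerForm.density (K : KahlerForm n X) (α : FormField n X) (φ : E → Smooth n X) (u v w : E) :
    ℝ :=
  K.mabuchi (φ w) (smoothDeriv φ u w) (smoothDeriv φ u w)
    + K.mabuchi (φ w) (smoothDeriv φ v w) (smoothDeriv φ v w)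
    + 2 * α (φ w) (smoothDeriv φ u w) (smoothDeriv φ v w)

/-- The Euler–Lagrange expression for two real directions of the space of parameters. -/
def KahlerForm.eulerLagrange (K : KahlerForm n X) (φ : E → Smooth n X) (u v w : E) (x : X) : ℝ :=
  K.gradDot (φ w) (smoothDeriv φ u w) (smoothDeriv φ u w) x
    + K.gradDot (φ w) (smoothDeriv φ v w) (smoothDeriv φ v w) x
    - 2 * (smoothDeriv (smoothDeriv φ u) u w x + smoothDeriv (smoothDeriv φ v) v w x)
    + 2 * K.bracket (φ w) (smoothDeriv φ u w) (smoothDeriv φ v w) x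

include hW hφ hpot

theorem smoothFam_eulerLagrange (u v : E) : SmoothFam n W (K.eulerLagrange φ u v) :=
  (((hφ.gradDot K hW hpot (hφ.smoothDeriv hW u) (hφ.smoothDeriv hW u)).add
    (hφ.gradDot K hW hpot (hφ.smoothDeriv hW v) (hφ.smoothDeriv hW v))).sub
    (SmoothFam.scalar_mul contDiffOn_const (((hφ.smoothDeriv hW u).smoothDeriv hW u).add
      ((hφ.smoothDeriv hW v).smoothDeriv hW v)))).add
    (SmoothFam.scalar_mul contDiffOn_const
      (hφ.bracket K hW hpot (hφ.smoothDeriv hW u) (hφ.smoothDeriv hW v)))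

omit hφ hpot hW in
theorem integral_eulerLagrange {φ : E → Smooth n X} {w : E} (hp : φ w ∈ K.potentials)
    (u v : E) (ψ : Smooth n X) :
    integralTop (K.perturb (φ w)) (fun x => ψ x * K.eulerLagrange φ u v w x)
      = integralTop (K.perturb (φ w))
          (fun x => ψ x * K.gradDot (φ w) (smoothDeriv φ u w) (smoothDeriv φ u w) x)
        + integralTop (K.perturb (φ w))
          (fun x => ψ x * K.gradDot (φ w) (smoothDeriv φ v w) (smoothDeriv φ v w) x)
        - 2 * (K.mabuchi (φ w) (smoothDeriv (smoothDeriv φ u) u w) ψ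
          + K.mabuchi (φ w) (smoothDeriv (smoothDeriv φ v) v w) ψ)
        + 2 * K.theta (φ w) ψ (smoothDeriv φ u w) (smoothDeriv φ v w) := by
  set a := smoothDeriv φ u w
  set b := smoothDeriv φ v w
  set a' := smoothDeriv (smoothDeriv φ u) u w
  set b' := smoothDeriv (smoothDeriv φ v) v w
  have hψ := ψ.contMDiff.continuous
  have c1 : Continuous fun x => ψ x * K.gradDot (φ w) a a x :=
    hψ.mul (K.contMDiff_gradDot hp a.contMDiff a.contMDiff).continuous
  have c2 : Continuous fun x => ψ x * K.gradDot (φ w) b b x :=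
    hψ.mul (K.contMDiff_gradDot hp b.contMDiff b.contMDiff).continuous
  have c3 : Continuous fun x => a' x * ψ x := a'.contMDiff.continuous.mul hψ
  have c4 : Continuous fun x => b' x * ψ x := b'.contMDiff.continuous.mul hψ
  have c5 : Continuous fun x => ψ x * K.bracket (φ w) a b x :=
    hψ.mul (K.contMDiff_bracket hp a.contMDiff b.contMDiff).continuous
  have e : ∀ x, ψ x * K.eulerLagrange φ u v w x
      = ((ψ x * K.gradDot (φ w) a a x + ψ x * K.gradDot (φ w) b b x)
        + (-2) * (a' x * ψ x + b' x * ψ x)) + 2 * (ψ x * K.bracket (φ w) a b x) := fun x => by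
    simp only [KahlerForm.eulerLagrange]
    ring
  have c34 : Continuous fun x => (-2) * (a' x * ψ x + b' x * ψ x) :=
    continuous_const.mul (c3.add c4)
  have c55 : Continuous fun x => 2 * (ψ x * K.bracket (φ w) a b x) := continuous_const.mul c5
  rw [integralTop_congr e, integralTop_add K (φ w) (f := fun x => (ψ x * K.gradDot (φ w) a a x
        + ψ x * K.gradDot (φ w) b b x) + (-2) * (a' x * ψ x + b' x * ψ x))
      ((c1.add c2).add c34) c55,
    integralTop_add K (φ w) (f := fun x => ψ x * K.gradDot (φ w) a a x
        + ψ x * K.gradDot (φ w) b b x) (c1.add c2) c34,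
    integralTop_add K (φ w) c1 c2, integralTop_const_mul, integralTop_const_mul,
    integralTop_add K (φ w) c3 c4, K.theta_eq hp]
  rw [KahlerForm.mabuchi, KahlerForm.mabuchi]
  ring

variable {α : FormField n X}

/-- The component along `u` of the current in the first variation formula. -/
def KahlerForm.currentU (K : KahlerForm n X) (α : FormField n X) (φ : E → Smooth n X)
    (τ u v w : E) : ℝ :=
  2 * K.mabuchi (φ w) (smoothDeriv φ u w) (smoothDeriv φ τ w)
    + 2 * α (φ w) (smoothDeriv φ τ w) (smoothDeriv φ v w)

/-- The component along `v` of the current in the first variation formula. -/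
def KahlerForm.currentV (K : KahlerForm n X) (α : FormField n X) (φ : E → Smooth n X)
    (τ u v w : E) : ℝ :=
  2 * K.mabuchi (φ w) (smoothDeriv φ v w) (smoothDeriv φ τ w)
    + 2 * α (φ w) (smoothDeriv φ u w) (smoothDeriv φ τ w)

theorem lineC1_density (hα : IsTwoForm K α) (u v τ : E) : LineC1 (K.density α φ u v) W τ := by
  have hu := hφ.smoothDeriv hW u
  have hv := hφ.smoothDeriv hW v
  exact ((lineC1_mabuchi K hW hφ hpot hu hu τ).add (lineC1_mabuchi K hW hφ hpot hv hv τ)).add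
    ((hα.lineC1_along hW hφ hpot hu hv τ).const_mul 2)

theorem lineC1_currentU (hα : IsTwoForm K α) (τ u v : E) :
    LineC1 (K.currentU α φ τ u v) W u := by
  have hu := hφ.smoothDeriv hW u
  have hv := hφ.smoothDeriv hW v
  have hτ := hφ.smoothDeriv hW τ
  exact ((lineC1_mabuchi K hW hφ hpot hu hτ u).const_mul 2).add
    ((hα.lineC1_along hW hφ hpot hτ hv u).const_mul 2)

theorem lineC1_currentV (hα : IsTwoForm K α) (τ u v : E) :
    LineC1 (K.currentV α φ τ u v) W v := by
  have hu := hφ.smoothDeriv hW u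
  have hv := hφ.smoothDeriv hW v
  have hτ := hφ.smoothDeriv hW τ
  exact ((lineC1_mabuchi K hW hφ hpot hv hτ v).const_mul 2).add
    ((hα.lineC1_along hW hφ hpot hu hτ v).const_mul 2)

/-- The first variation formula. -/
theorem lineDeriv_density (hα : IsTwoForm K α)
    (hdα : ∀ φ ∈ K.potentials, ∀ ξ₁ ξ₂ ξ₃ : Smooth n X, extD α φ ξ₁ ξ₂ ξ₃ = K.theta φ ξ₁ ξ₂ ξ₃)
    (τ u v : E) {w : E} (hw : w ∈ W) :
    lineDeriv ℝ (K.density α φ u v) w τ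
      = lineDeriv ℝ (K.currentU α φ τ u v) w u + lineDeriv ℝ (K.currentV α φ τ u v) w v
        + integralTop (K.perturb (φ w))
          (fun x => smoothDeriv φ τ w x * K.eulerLagrange φ u v w x) := by
  have hu := hφ.smoothDeriv hW u
  have hv := hφ.smoothDeriv hW v
  have hτ := hφ.smoothDeriv hW τ
  have hp := hpot w hw
  have h1 : HasLineDerivAt ℝ (K.density α φ u v) _ w τ := HasDerivAt.add
    (HasDerivAt.add (hasLineDerivAt_mabuchi K hW hφ hpot hu hu τ hw)
      (hasLineDerivAt_mabuchi K hW hφ hpot hv hv τ hw))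
    (HasDerivAt.const_mul 2 (hα.hasLineDerivAt_along hW hφ hpot hu hv τ hw))
  have h2 : HasLineDerivAt ℝ (K.currentU α φ τ u v) _ w u := HasDerivAt.add
    (HasDerivAt.const_mul 2 (hasLineDerivAt_mabuchi K hW hφ hpot hu hτ u hw))
    (HasDerivAt.const_mul 2 (hα.hasLineDerivAt_along hW hφ hpot hτ hv u hw))
  have h3 : HasLineDerivAt ℝ (K.currentV α φ τ u v) _ w v := HasDerivAt.add
    (HasDerivAt.const_mul 2 (hasLineDerivAt_mabuchi K hW hφ hpot hv hτ v hw))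
    (HasDerivAt.const_mul 2 (hα.hasLineDerivAt_along hW hφ hpot hu hτ v hw))
  -- Mixed parameter derivatives are interchanged so that τ is applied to φ first; then the
  -- first-order terms in ψ = φ_τ cancel against the currents, and the terms containing φ_uv cancel
  -- by antisymmetry.
  rw [h1.lineDeriv, h2.lineDeriv, h3.lineDeriv, integral_eulerLagrange K hp,
    hφ.smoothDeriv_comm hW u τ hw, hφ.smoothDeriv_comm hW v τ hw, hφ.smoothDeriv_comm hW v u hw]
  have g1 := integral_lap_sub K hp (smoothDeriv φ u w).contMDiff (smoothDeriv φ τ w).contMDiff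
  have g2 := integral_lap_sub K hp (smoothDeriv φ v w).contMDiff (smoothDeriv φ τ w).contMDiff
  rw [integralTop_const_mul] at g1 g2
  -- This is where dα = θ enters: the remaining derivatives of α are exactly dα(φ_τ, φ_u, φ_v).
  have g3 := hdα _ hp (smoothDeriv φ τ w) (smoothDeriv φ u w) (smoothDeriv φ v w)
  rw [extD] at g3
  rw [g1, g2, ← g3, hα.dirDeriv_swap hp (smoothDeriv φ v w) (smoothDeriv φ u w),
    hα.swap hp (smoothDeriv (smoothDeriv φ u) v w) (smoothDeriv φ τ w),
    K.mabuchi_comm _ (smoothDeriv (smoothDeriv φ τ) u w),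
    K.mabuchi_comm _ (smoothDeriv (smoothDeriv φ τ) v w)]
  ring

end Variation

/-! ### Compactly supported variations of integrals -/

section CompactVariation

open MeasureTheory

variable {V : Type*} [NormedAddCommGroup V] [NormedSpace ℝ V] [FiniteDimensional ℝ V]
  [MeasurableSpace V] [BorelSpace V] {μ : Measure V} [μ.IsAddHaarMeasure]
  {D C : Set V}

/-- Extended by zero, a has a continuous compactly supported derivative along v, whose integral
vanishes. No total differentiability is used. -/
theorem integral_lineDeriv_eq_zero_of_compact (hD : IsOpen D) (hC : IsCompact C) (hCD : C ⊆ D)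
    {a : V → ℝ} {v : V} (ha : LineC1 a D v) (h0 : ∀ z ∈ D, z ∉ C → a z = 0) :
    ∫ z in C, lineDeriv ℝ a z v ∂μ = 0 := by
  have hmem : ∀ z ∈ D, D ∈ nhds z := fun z hz => hD.mem_nhds hz
  have hb0 : ∀ z ∉ C, D.indicator a z = 0 := fun z hz => by
    by_cases hzD : z ∈ D
    · rw [Set.indicator_of_mem hzD, h0 z hzD hz]
    · exact Set.indicator_of_notMem hzD _
  have hev0 : ∀ z ∉ C, D.indicator a =ᶠ[nhds z] fun _ => 0 := fun z hz =>
    Filter.eventuallyEq_of_mem (hC.isClosed.isOpen_compl.mem_nhds hz) hb0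
  have hevD : ∀ z ∈ D, D.indicator a =ᶠ[nhds z] a := fun z hz =>
    Filter.eventuallyEq_of_mem (hmem z hz) fun x hx => Set.indicator_of_mem hx _
  have hd0 : ∀ z ∉ C, HasLineDerivAt ℝ (D.indicator a) 0 z v := fun z hz =>
    ((hasFDerivAt_const (0 : ℝ) z).congr_of_eventuallyEq (hev0 z hz)).hasLineDerivAt v
  have hdD : ∀ z ∈ D, HasLineDerivAt ℝ (D.indicator a) (lineDeriv ℝ a z v) z v := fun z hz =>
    (ha.hasLineDerivAt z hz).congr_of_eventuallyEq (hevD z hz)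
  -- The extension is zero near such a point, because the complement of C is open.
  have hz0 : ∀ z ∈ D, z ∉ C → lineDeriv ℝ a z v = 0 := fun z hz hzC =>
    (hdD z hz).unique (hd0 z hzC)
  have hb0' : ∀ z ∉ C, D.indicator (fun z => lineDeriv ℝ a z v) z = 0 := fun z hz => by
    by_cases hzD : z ∈ D
    · rw [Set.indicator_of_mem hzD, hz0 z hzD hz]
    · exact Set.indicator_of_notMem hzD _
  have hcont : ∀ {b : V → ℝ}, ContinuousOn b D → (∀ z ∉ C, D.indicator b z = 0) →
      Integrable (D.indicator b) μ := by
    intro b hb hb0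
    have hc : Continuous (D.indicator b) := by
      rw [continuous_iff_continuousAt]
      intro z
      by_cases hz : z ∈ C
      · exact (hb.continuousAt (hmem z (hCD hz))).congr
          (Filter.eventuallyEq_of_mem (hmem z (hCD hz))
            fun x hx => (Set.indicator_of_mem hx _).symm)
      · exact continuousAt_const.congr (Filter.eventuallyEq_of_mem
          (hC.isClosed.isOpen_compl.mem_nhds hz) fun x hx => (hb0 x hx).symm)
    exact hc.integrable_of_hasCompactSupport (HasCompactSupport.intro hC hb0)
  have key := integral_lineDeriv_eq_zero (μ := μ) (h := D.indicator a)
    (h' := D.indicator fun z => lineDeriv ℝ a z v) (v := v) (fun z => ?_)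
    (hcont ha.continuousOn hb0) (hcont ha.continuousOn_deriv hb0')
  · rw [← key, ← setIntegral_eq_integral_of_forall_compl_eq_zero (s := C)
      fun z hz => hb0' z hz]
    exact setIntegral_congr_fun hC.measurableSet fun z hz =>
      (Set.indicator_of_mem (hCD hz) (fun z => lineDeriv ℝ a z v)).symm
  · by_cases hz : z ∈ C
    · rw [Set.indicator_of_mem (hCD hz)]
      exact hdD z (hCD hz)
    · rw [hb0' z hz]
      exact hd0 z hz

omit [FiniteDimensional ℝ V] [NormedSpace ℝ V] [μ.IsAddHaarMeasure] in
theorem integrableOn_of_eq_off_compact [IsFiniteMeasureOnCompacts μ] (hD : IsOpen D)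
    (hC : IsCompact C) (hCD : C ⊆ D) {a b : V → ℝ}
    (ha : IntegrableOn a D μ) (hb : ContinuousOn b D) (h : ∀ z ∈ D, z ∉ C → b z = a z) :
    IntegrableOn b D μ := by
  have h1 : IntegrableOn b (D \ C) μ :=
    (ha.mono_set Set.sdiff_subset).congr_fun (fun z hz => (h z hz.1 hz.2).symm)
      (hD.measurableSet.diff hC.measurableSet)
  have h2 : IntegrableOn b C μ := (hb.mono hCD).integrableOn_compact hC
  have := h1.union h2
  rwa [Set.sdiff_union_of_subset hCD] at this

/-- Off C the integrand does not depend on t, so integrability is needed only at t = 0 and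
differentiation under the integral sign is needed only over the compact C. -/
theorem hasDerivAt_integral_of_compact_variation (hD : IsOpen D) (hC : IsCompact C) (hCD : C ⊆ D)
    {h : V × ℝ → ℝ} {W : Set (V × ℝ)} {ε : ℝ} (hε : 0 < ε)
    (hW : D ×ˢ Set.Ioo (-ε) ε ⊆ W) (hh : LineC1 h W (0, 1))
    (h0 : ∀ z ∈ D, z ∉ C → ∀ t, h (z, t) = h (z, 0))
    (hi : IntegrableOn (fun z => h (z, 0)) D μ) :
    HasDerivAt (fun t => ∫ z in D, h (z, t) ∂μ) (∫ z in C, lineDeriv ℝ h (z, 0) (0, 1) ∂μ) 0 := by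
  have hS : Set.Ioo (-ε) ε ∈ nhds (0 : ℝ) := Ioo_mem_nhds (by linarith) hε
  have hslice : ∀ t ∈ Set.Ioo (-ε) ε, ContinuousOn (fun z => h (z, t)) D := fun t ht =>
    hh.continuousOn.comp (by fun_prop) fun z hz => hW ⟨hz, ht⟩
  have hint : ∀ t ∈ Set.Ioo (-ε) ε, IntegrableOn (fun z => h (z, t)) D μ := fun t ht =>
    integrableOn_of_eq_off_compact hD hC hCD hi (hslice t ht) fun z hz hzC => h0 z hz hzC t
  have hev : (fun t => ∫ z in D, h (z, t) ∂μ) =ᶠ[nhds 0]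
      fun t => (∫ z in D \ C, h (z, 0) ∂μ) + ∫ z in C, h (z, t) ∂μ := by
    filter_upwards [hS] with t ht
    have h1 : ∫ z in D \ C, h (z, 0) ∂μ = ∫ z in D \ C, h (z, t) ∂μ :=
      setIntegral_congr_fun (hD.measurableSet.diff hC.measurableSet)
        fun z hz => (h0 z hz.1 hz.2 t).symm
    rw [h1, ← setIntegral_union Set.disjoint_sdiff_left hC.measurableSet
      ((hint t ht).mono_set Set.sdiff_subset) ((hint t ht).mono_set hCD),
      Set.sdiff_union_of_subset hCD]
  refine HasDerivAt.congr_of_eventuallyEq (HasDerivAt.const_add _ ?_) hev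
  refine hasDerivAt_setIntegral_of_compact (g := fun t z => h (z, t))
    (g' := fun t z => lineDeriv ℝ h (z, t) (0, 1)) hS hC
    (fun t ht => (hslice t ht).mono hCD) ?_ ?_
  · exact hh.continuousOn_deriv.comp (f := fun q : ℝ × V => (q.2, q.1)) (by fun_prop)
      fun q hq => hW ⟨hCD hq.2, hq.1⟩
  · intro t ht z hz
    have h1 : HasDerivAt (fun s : ℝ => h ((z, t) + s • ((0 : V), (1 : ℝ)))) _ 0 :=
      hh.hasLineDerivAt (z, t) (hW ⟨hCD hz, ht⟩)
    have h2 : HasDerivAt (fun s : ℝ => s - t) 1 t := (hasDerivAt_id t).sub_const t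
    have h3 := HasDerivAt.comp t (h₂ := fun s : ℝ => h ((z, t) + s • ((0 : V), (1 : ℝ))))
      (h := fun s => s - t) (by rwa [sub_self]) h2
    rw [mul_one] at h3
    refine h3.congr_of_eventuallyEq (Filter.Eventually.of_forall fun s => ?_)
    simp

end CompactVariation

/-! ### Complex derivatives -/

section ComplexFormulas

variable {n : ℕ} {X : Type*} [TopologicalSpace X] [ChartedSpace (Fin n → ℂ) X]
  [IsManifold 𝓘(ℂ, Fin n → ℂ) ω X] {K : KahlerForm n X} {α : FormField n X}

theorem dAt_const_mul (c : ℝ) {f : X → ℝ} (hf : ContMDiff 𝓘(ℝ, Fin n → ℂ) 𝓘(ℝ, ℝ) ∞ f) (x : X) :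
    dAt n (fun x => c * f x) x = c • dAt n f x := by
  rw [dAt_eq hf, dAt_eq (f := fun x => c * f x) (contMDiff_const.mul hf)]
  exact fderiv_const_mul (differentiableAt_chart hf x) c

theorem half_add_re (a b : ℝ) : (((a : ℂ) + Complex.I * b) / 2).re = 1 / 2 * a := by
  simp; ring

theorem half_add_im (a b : ℝ) : (((a : ℂ) + Complex.I * b) / 2).im = 1 / 2 * b := by
  simp; ring

theorem half_sub_re (a b : ℝ) : (((a : ℂ) - Complex.I * b) / 2).re = 1 / 2 * a := by
  simp; ring

theorem half_sub_im (a b : ℝ) : (((a : ℂ) - Complex.I * b) / 2).im = -(1 / 2) * b := by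
  simp; ring

theorem toSmooth_const_mul (c : ℝ) (a : Smooth n X) : toSmooth n (fun x => c * a x) = c • a :=
  toSmooth_coe (c • a)

/-- The diagonal terms vanish and the mixed ones coincide up to sign; the factor 4i of the energy
turns the result into 2 α(a, b). -/
theorem IsTwoForm.evalC_eq (hα : IsTwoForm K α) {φ : Smooth n X} (hφ : φ ∈ K.potentials)
    (a b : Smooth n X) :
    evalC α φ (fun x => ((a x : ℂ) + Complex.I * b x) / 2)
      (fun x => ((a x : ℂ) - Complex.I * b x) / 2) = -(Complex.I / 2) * (α φ a b : ℝ) := by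
  simp only [evalC, half_add_re, half_add_im, half_sub_re, half_sub_im, toSmooth_const_mul,
    map_smul, LinearMap.smul_apply, smul_eq_mul, hα.alternating φ hφ, hα.swap hφ b a]
  push_cast
  ring

theorem KahlerForm.gradSq_eq {φ : Smooth n X} (hφ : φ ∈ K.potentials) (a b : Smooth n X) (x : X) :
    K.gradSq φ (fun x => ((a x : ℂ) - Complex.I * b x) / 2) x
      = 1 / 4 * (K.gradDot φ a a x + K.gradDot φ b b x) := by
  have hp := K.perturb_isPositive hφ x
  simp only [KahlerForm.gradSq, half_sub_re, half_sub_im, hp.gradSqR_eq, KahlerForm.gradDot,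
    dAt_const_mul _ a.contMDiff, dAt_const_mul _ b.contMDiff]
  simp only [dotR, ContinuousLinearMap.smul_comp, map_smul, map_neg, smul_apply, smul_eq_mul]
  ring

theorem KahlerForm.bracketC_eq {φ : Smooth n X} (hφ : φ ∈ K.potentials) (a b : Smooth n X) (x : X) :
    K.bracketC φ (fun x => ((a x : ℂ) + Complex.I * b x) / 2)
      (fun x => ((a x : ℂ) - Complex.I * b x) / 2) x
      = -(Complex.I / 2) * (K.bracket φ a b x : ℝ) := by
  have hp := K.perturb_isPositive hφ x
  have haa : K.bracket φ a a x = 0 := by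
    have := K.bracket_swap hφ a a x
    linarith
  have hbb : K.bracket φ b b x = 0 := by
    have := K.bracket_swap hφ b b x
    linarith
  have hc : ∀ (c d : ℝ) (a b : Smooth n X),
      K.bracket φ (fun x => c * a x) (fun x => d * b x) x = c * d * K.bracket φ a b x := by
    intro c d a b
    simp only [KahlerForm.bracket, hp.bracketR_eq, dAt_const_mul _ a.contMDiff,
      dAt_const_mul _ b.contMDiff, map_smul, smul_apply, smul_eq_mul]
    ring
  simp only [KahlerForm.bracketC, half_add_re, half_add_im, half_sub_re, half_sub_im, hc, haa, hbb,
    K.bracket_swap hφ b a]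
  push_cast
  ring

variable {m : ℕ} {D : Set (Fin m → ℂ)} {Φ : (Fin m → ℂ) → Smooth n X}

theorem fderiv_ofReal {V : Type*} [NormedAddCommGroup V] [NormedSpace ℝ V] {F : V → ℝ} {z : V}
    (hF : DifferentiableAt ℝ F z) (v : V) :
    fderiv ℝ (fun w => (F w : ℂ)) z v = (fderiv ℝ F z v : ℝ) :=
  congrArg (fun L : V →L[ℝ] ℂ => L v) (Complex.ofRealCLM.hasFDerivAt.comp z hF.hasFDerivAt).fderiv

theorem SmoothFam.Dz_eq (hΦ : SmoothFam n D fun z => Φ z) (hD : IsOpen D) {z : Fin m → ℂ}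
    (hz : z ∈ D) (j : Fin m) :
    Dz Φ j z = fun x => ((WZW.smoothDeriv Φ (Pi.single j 1) z x : ℂ)
      - Complex.I * WZW.smoothDeriv Φ (Pi.single j Complex.I) z x) / 2 := by
  ext x
  rw [Dz, dz, fderiv_ofReal (hΦ.hasFDerivAt hD hz x).differentiableAt,
    fderiv_ofReal (hΦ.hasFDerivAt hD hz x).differentiableAt, hΦ.smoothDeriv_apply hD _ hz,
    hΦ.smoothDeriv_apply hD _ hz]

theorem SmoothFam.Dzbar_eq (hΦ : SmoothFam n D fun z => Φ z) (hD : IsOpen D) {z : Fin m → ℂ}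
    (hz : z ∈ D) (j : Fin m) :
    Dzbar Φ j z = fun x => ((WZW.smoothDeriv Φ (Pi.single j 1) z x : ℂ)
      + Complex.I * WZW.smoothDeriv Φ (Pi.single j Complex.I) z x) / 2 := by
  ext x
  rw [Dzbar, dzbar, fderiv_ofReal (hΦ.hasFDerivAt hD hz x).differentiableAt,
    fderiv_ofReal (hΦ.hasFDerivAt hD hz x).differentiableAt, hΦ.smoothDeriv_apply hD _ hz,
    hΦ.smoothDeriv_apply hD _ hz]

theorem SmoothFam.DzDzbar_eq (hΦ : SmoothFam n D fun z => Φ z) (hD : IsOpen D) {z : Fin m → ℂ}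
    (hz : z ∈ D) (j : Fin m) (x : X) :
    DzDzbar Φ j z x
      = ((1 / 4 * (WZW.smoothDeriv (WZW.smoothDeriv Φ (Pi.single j 1)) (Pi.single j 1) z x
        + WZW.smoothDeriv (WZW.smoothDeriv Φ (Pi.single j Complex.I))
          (Pi.single j Complex.I) z x) : ℝ) : ℂ) := by
  have hev : dz j (fun w => (Φ w x : ℂ)) =ᶠ[nhds z] fun w =>
      ((WZW.smoothDeriv Φ (Pi.single j 1) w x : ℂ)
        - Complex.I * WZW.smoothDeriv Φ (Pi.single j Complex.I) w x) / 2 := by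
    filter_upwards [hD.mem_nhds hz] with w hw using congrFun (hΦ.Dz_eq hD hw j) x
  have h1 := (hΦ.smoothDeriv hD (Pi.single j 1)).hasFDerivAt hD hz x
  have h2 := (hΦ.smoothDeriv hD (Pi.single j Complex.I)).hasFDerivAt hD hz x
  have hd : ∀ v, fderiv ℝ (dz j (fun w => (Φ w x : ℂ))) z v
      = ((WZW.smoothDeriv (WZW.smoothDeriv Φ (Pi.single j 1)) v z x : ℂ)
        - Complex.I * WZW.smoothDeriv (WZW.smoothDeriv Φ (Pi.single j Complex.I)) v z x) / 2 := by
    intro v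
    have g1 := Complex.ofRealCLM.hasFDerivAt.comp z h1
    have g2 := Complex.ofRealCLM.hasFDerivAt.comp z h2
    have g := (g1.sub (g2.const_mul Complex.I)).mul_const (2 : ℂ)⁻¹
    rw [hev.fderiv_eq]
    simp only [div_eq_mul_inv]
    refine (congrArg (fun L : (Fin m → ℂ) →L[ℝ] ℂ => L v) g.fderiv).trans ?_
    rw [(hΦ.smoothDeriv hD _).smoothDeriv_apply hD _ hz,
      (hΦ.smoothDeriv hD _).smoothDeriv_apply hD _ hz]
    simp
    ring
  -- The mixed second derivatives cancel, leaving a quarter of the real Laplacian.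
  rw [DzDzbar, dzbar, hd, hd, hΦ.smoothDeriv_comm hD (Pi.single j 1) (Pi.single j Complex.I) hz]
  push_cast
  have := Complex.I_mul_I
  linear_combination (-(WZW.smoothDeriv (WZW.smoothDeriv Φ (Pi.single j Complex.I))
    (Pi.single j Complex.I) z x : ℂ) / 4) * this

/-- The left-hand side of the Euler–Lagrange equation, in real terms. -/
def KahlerForm.realWzw (K : KahlerForm n X) (Φ : (Fin m → ℂ) → Smooth n X) (z : Fin m → ℂ)
    (x : X) : ℝ :=
  ∑ j : Fin m, K.eulerLagrange Φ (Pi.single j 1) (Pi.single j Complex.I) z x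

/-- The left side of the WZW equation is in fact real, since i times the complex bracket is half a
real bracket. -/
theorem wzw_eq (hΦ : SmoothFam n D fun z => Φ z) (hD : IsOpen D)
    (hpot : ∀ z ∈ D, Φ z ∈ K.potentials) {z : Fin m → ℂ} (hz : z ∈ D) (x : X) :
    K.wzw Φ z x = (1 / 4 : ℂ) * (K.realWzw Φ z x : ℝ) := by
  rw [KahlerForm.wzw, KahlerForm.realWzw, Complex.ofReal_sum, Finset.mul_sum]
  refine Finset.sum_congr rfl fun j _ => ?_
  rw [hΦ.DzDzbar_eq hD hz, hΦ.Dz_eq hD hz, hΦ.Dzbar_eq hD hz, K.gradSq_eq (hpot z hz),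
    K.bracketC_eq (hpot z hz), KahlerForm.eulerLagrange]
  push_cast
  linear_combination (-(1 / 2) * (K.bracket (Φ z) (smoothDeriv Φ (Pi.single j 1) z)
    (smoothDeriv Φ (Pi.single j Complex.I) z) x : ℂ)) * Complex.I_mul_I

end ComplexFormulas

/-! ### The energy in real terms -/

section Energy

open MeasureTheory

variable {n : ℕ} {X : Type*} [TopologicalSpace X] [ChartedSpace (Fin n → ℂ) X]
  [IsManifold 𝓘(ℂ, Fin n → ℂ) ω X] [CompactSpace X] [T2Space X]
  {K : KahlerForm n X} {α : FormField n X}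
  {m : ℕ} {D : Set (Fin m → ℂ)} {Φ : (Fin m → ℂ) → Smooth n X}

theorem energyDensity_eq (hΦ : SmoothFam n D fun z => Φ z) (hD : IsOpen D) {z : Fin m → ℂ}
    (hz : z ∈ D) :
    K.energyDensity Φ z = ∑ j : Fin m,
      (K.mabuchi (Φ z) (smoothDeriv Φ (Pi.single j 1) z) (smoothDeriv Φ (Pi.single j 1) z)
      + K.mabuchi (Φ z) (smoothDeriv Φ (Pi.single j Complex.I) z)
          (smoothDeriv Φ (Pi.single j Complex.I) z)) := by
  simp only [hΦ.coe_smoothDeriv hD _ hz]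
  rfl

/-- The total density of the perturbed energy. -/
def KahlerForm.totalDensity (K : KahlerForm n X) (α : FormField n X)
    (Φ : (Fin m → ℂ) → Smooth n X) (z : Fin m → ℂ) : ℝ :=
  ∑ j : Fin m, K.density α Φ (Pi.single j 1) (Pi.single j Complex.I) z

theorem totalDensity_eq (hΦ : SmoothFam n D fun z => Φ z) (hD : IsOpen D) {z : Fin m → ℂ}
    (hz : z ∈ D) :
    K.totalDensity α Φ z = K.energyDensity Φ z + ∑ j : Fin m,
      2 * α (Φ z) (smoothDeriv Φ (Pi.single j 1) z) (smoothDeriv Φ (Pi.single j Complex.I) z) := by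
  rw [energyDensity_eq hΦ hD hz, ← Finset.sum_add_distrib]
  rfl

theorem evalC_Dz (hα : IsTwoForm K α) (hΦ : SmoothFam n D fun z => Φ z) (hD : IsOpen D)
    (hpot : ∀ z ∈ D, Φ z ∈ K.potentials) {z : Fin m → ℂ} (hz : z ∈ D) (j : Fin m) :
    evalC α (Φ z) (Dzbar Φ j z) (Dz Φ j z) = -(Complex.I / 2) *
      (α (Φ z) (smoothDeriv Φ (Pi.single j 1) z) (smoothDeriv Φ (Pi.single j Complex.I) z) : ℝ) := by
  rw [hΦ.Dz_eq hD hz, hΦ.Dzbar_eq hD hz, hα.evalC_eq (hpot z hz)]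

theorem perturbedEnergy_eq (hα : IsTwoForm K α) (hΦ : SmoothFam n D fun z => Φ z) (hD : IsOpen D)
    (hpot : ∀ z ∈ D, Φ z ∈ K.potentials) (hi : IntegrableOn (K.energyDensity Φ) D)
    (hj : ∀ j : Fin m, IntegrableOn (fun z => α (Φ z) (smoothDeriv Φ (Pi.single j 1) z)
      (smoothDeriv Φ (Pi.single j Complex.I) z)) D) :
    K.perturbedEnergy α D Φ = ((∫ z in D, K.totalDensity α Φ z : ℝ) : ℂ) := by
  have h1 : ∫ z in D, K.totalDensity α Φ z = (∫ z in D, K.energyDensity Φ z)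
      + ∑ j : Fin m, 2 * ∫ z in D, α (Φ z) (smoothDeriv Φ (Pi.single j 1) z)
        (smoothDeriv Φ (Pi.single j Complex.I) z) := by
    rw [setIntegral_congr_fun hD.measurableSet fun z hz => totalDensity_eq hΦ hD hz,
      integral_add hi (integrable_finsetSum _ fun j _ => (hj j).const_mul 2),
      integral_finsetSum _ fun j _ => (hj j).const_mul 2]
    simp only [integral_const_mul]
  rw [h1, KahlerForm.perturbedEnergy, Complex.ofReal_add, Complex.ofReal_sum, Finset.mul_sum]
  congr 1
  refine Finset.sum_congr rfl fun j _ => ?_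
  rw [setIntegral_congr_fun hD.measurableSet fun z hz => evalC_Dz hα hΦ hD hpot hz j,
    integral_const_mul, integral_complex_ofReal]
  push_cast
  linear_combination (-2 * ((∫ z in D, α (Φ z) (smoothDeriv Φ (Pi.single j 1) z)
        (smoothDeriv Φ (Pi.single j Complex.I) z) : ℝ) : ℂ)) * Complex.I_mul_I

theorem integrableOn_of_energyDefined (hα : IsTwoForm K α) (hΦ : SmoothFam n D fun z => Φ z)
    (hD : IsOpen D) (hpot : ∀ z ∈ D, Φ z ∈ K.potentials) (h : K.EnergyDefined α D Φ) (j : Fin m) :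
    IntegrableOn (fun z => α (Φ z) (smoothDeriv Φ (Pi.single j 1) z)
      (smoothDeriv Φ (Pi.single j Complex.I) z)) D := by
  -- The factor 2i inverts -i/2, so the real part recovers α(Φ_u, Φ_v).
  have h1 := ((h.2 j).const_mul (2 * Complex.I)).re
  refine IntegrableOn.congr_fun h1 (fun z hz => ?_) hD.measurableSet
  rw [evalC_Dz hα hΦ hD hpot hz]
  have : 2 * Complex.I * (-(Complex.I / 2) * ((α (Φ z) (smoothDeriv Φ (Pi.single j 1) z)
      (smoothDeriv Φ (Pi.single j Complex.I) z) : ℝ) : ℂ))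
      = ((α (Φ z) (smoothDeriv Φ (Pi.single j 1) z)
      (smoothDeriv Φ (Pi.single j Complex.I) z) : ℝ) : ℂ) := by
    linear_combination (-((α (Φ z) (smoothDeriv Φ (Pi.single j 1) z)
      (smoothDeriv Φ (Pi.single j Complex.I) z) : ℝ) : ℂ)) * Complex.I_mul_I
  rw [this]
  exact Complex.ofReal_re _

end Energy

/-! ### Variations -/

section Slices

variable {n : ℕ} {X : Type*} [TopologicalSpace X] [ChartedSpace (Fin n → ℂ) X]
  [IsManifold 𝓘(ℂ, Fin n → ℂ) ω X]
  {V : Type*} [NormedAddCommGroup V] [NormedSpace ℝ V]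

theorem smoothDeriv_congr {φ ψ : V → Smooth n X} {w : V} (h : φ =ᶠ[nhds w] ψ) (v : V) :
    smoothDeriv φ v w = smoothDeriv ψ v w := by
  rw [smoothDeriv, smoothDeriv]
  congr 1
  ext x
  have : (fun w => φ w x) =ᶠ[nhds w] fun w => ψ w x := by
    filter_upwards [h] with w' hw'
    rw [hw']
  exact congrArg (fun L : V →L[ℝ] ℝ => L v) this.fderiv_eq

/-- Freezing t identifies derivatives of Φ + tΨ in z with derivatives of the family in (z, t), so
the first variation formula on the product applies. -/
theorem SmoothFam.smoothDeriv_slice {φ : V × ℝ → Smooth n X} {W : Set (V × ℝ)} (hW : IsOpen W)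
    (hφ : SmoothFam n W fun w => φ w) {z : V} {t : ℝ} (h : (z, t) ∈ W) (u : V) :
    WZW.smoothDeriv (fun z => φ (z, t)) u z = WZW.smoothDeriv φ (u, 0) (z, t) := by
  rw [WZW.smoothDeriv, WZW.smoothDeriv]
  congr 1
  ext x
  refine (congrArg (fun L : V →L[ℝ] ℝ => L u)
    (hasFDerivAt_slice_fst (hφ.hasFDerivAt hW h x)).fderiv).trans ?_
  simp [WZW.famDeriv]

theorem lineDeriv_slice (F : V × ℝ → ℝ) (z u : V) (t : ℝ) :
    lineDeriv ℝ (fun z => F (z, t)) z u = lineDeriv ℝ F (z, t) (u, 0) := by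
  simp [lineDeriv]

theorem LineC1.slice {F : V × ℝ → ℝ} {W : Set (V × ℝ)} {u : V} (h : LineC1 F W (u, 0))
    {D : Set V} {t : ℝ} (hD : ∀ z ∈ D, (z, t) ∈ W) : LineC1 (fun z => F (z, t)) D u := by
  refine LineC1.of_hasLineDerivAt (h.continuousOn.comp (by fun_prop) hD)
    (h.continuousOn_deriv.comp (f := fun z => (z, t)) (by fun_prop) hD) fun z hz => ?_
  have := h.hasLineDerivAt (z, t) (hD z hz)
  simpa [HasLineDerivAt] using this

theorem LineC1.sum {ι : Type*} {s : Finset ι} {F : ι → V → ℝ} {W : Set V} {v : V}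
    (h : ∀ i ∈ s, LineC1 (F i) W v) : LineC1 (fun w => ∑ i ∈ s, F i w) W v :=
  LineC1.of_hasLineDerivAt (continuousOn_finsetSum _ fun i hi => (h i hi).continuousOn)
    (continuousOn_finsetSum _ fun i hi => (h i hi).continuousOn_deriv)
    fun w hw => HasDerivAt.fun_sum fun i hi => (h i hi).hasLineDerivAt w hw

theorem lineDeriv_sum {ι : Type*} {s : Finset ι} {F : ι → V → ℝ} {W : Set V} {v w : V}
    (h : ∀ i ∈ s, LineC1 (F i) W v) (hw : w ∈ W) :
    lineDeriv ℝ (fun w => ∑ i ∈ s, F i w) w v = ∑ i ∈ s, lineDeriv ℝ (F i) w v :=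
  HasLineDerivAt.lineDeriv (HasDerivAt.fun_sum fun i hi => (h i hi).hasLineDerivAt w hw)

variable (K : KahlerForm n X)

theorem eulerLagrange_slice {φ : V × ℝ → Smooth n X} {W : Set (V × ℝ)} (hW : IsOpen W)
    (hφ : SmoothFam n W fun w => φ w) {z : V} {t : ℝ} (h : (z, t) ∈ W) (u v : V) :
    K.eulerLagrange (fun z => φ (z, t)) u v z = K.eulerLagrange φ (u, 0) (v, 0) (z, t) := by
  have hs : ∀ u, smoothDeriv (smoothDeriv (fun z => φ (z, t)) u) u z
      = smoothDeriv (smoothDeriv φ (u, 0)) (u, 0) (z, t) := fun u => by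
    rw [← (hφ.smoothDeriv hW (u, 0)).smoothDeriv_slice hW h]
    refine smoothDeriv_congr ?_ u
    have hc : Continuous fun z : V => (z, t) := by fun_prop
    filter_upwards [(hW.preimage hc).mem_nhds h] with z' hz' using hφ.smoothDeriv_slice hW hz' u
  ext x
  simp only [KahlerForm.eulerLagrange, hs, hφ.smoothDeriv_slice hW h]

end Slices

/-! ### The family Φ + tΨ and the derivative of the energy along it. -/

section Variations

open MeasureTheory

variable {n : ℕ} {X : Type*} [TopologicalSpace X] [ChartedSpace (Fin n → ℂ) X]
  [IsManifold 𝓘(ℂ, Fin n → ℂ) ω X] [CompactSpace X] [T2Space X]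
  {K : KahlerForm n X} {α : FormField n X}
  {m : ℕ} {D C : Set (Fin m → ℂ)} {Φ Ψ : (Fin m → ℂ) → Smooth n X}

/-- The linear variation `Φ + tΨ`, as a family with parameter `(z, t)`. -/
def lineFamily (Φ Ψ : (Fin m → ℂ) → Smooth n X) (q : (Fin m → ℂ) × ℝ) : Smooth n X :=
  Φ q.1 + q.2 • Ψ q.1

theorem smoothFam_lineFamily (hΦ : SmoothFam n D fun z => Φ z)
    (hΨ : SmoothFam n Set.univ fun z => Ψ z) :
    SmoothFam n (D ×ˢ (Set.univ : Set ℝ)) fun q => lineFamily Φ Ψ q :=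
  (hΦ.comp contDiff_fst.contDiffOn fun _ hq => hq.1).add
    (SmoothFam.scalar_mul contDiff_snd.contDiffOn
      (hΨ.comp contDiff_fst.contDiffOn fun _ _ => Set.mem_univ _))

theorem isOpen_lineFamily_potentials (hD : IsOpen D) (hΦ : SmoothFam n D fun z => Φ z)
    (hΨ : SmoothFam n Set.univ fun z => Ψ z) :
    IsOpen {q : (Fin m → ℂ) × ℝ | q.1 ∈ D ∧ lineFamily Φ Ψ q ∈ K.potentials} := by
  have hU : IsOpen (D ×ˢ (Set.univ : Set ℝ)) := hD.prod isOpen_univ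
  rw [isOpen_iff_mem_nhds]
  rintro q ⟨hq, hp⟩
  filter_upwards [hU.mem_nhds ⟨hq, Set.mem_univ _⟩,
    (smoothFam_lineFamily hΦ hΨ).eventually_potentials K hU ⟨hq, Set.mem_univ _⟩ hp]
    with q' hq' hp' using ⟨hq'.1, hp'⟩

theorem lineFamily_zero (z : Fin m → ℂ) : lineFamily Φ Ψ (z, 0) = Φ z := by
  simp [lineFamily]

theorem smoothDeriv_lineFamily_time (hD : IsOpen D) (hΦ : SmoothFam n D fun z => Φ z)
    (hΨ : SmoothFam n Set.univ fun z => Ψ z) {z : Fin m → ℂ} (hz : z ∈ D) :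
    smoothDeriv (lineFamily Φ Ψ) (0, 1) (z, 0) = Ψ z := by
  ext x
  have hU : IsOpen (D ×ˢ (Set.univ : Set ℝ)) := hD.prod isOpen_univ
  have hq : (z, (0 : ℝ)) ∈ D ×ˢ (Set.univ : Set ℝ) := ⟨hz, Set.mem_univ _⟩
  have hfam := smoothFam_lineFamily hΦ hΨ
  rw [hfam.smoothDeriv_apply hU _ hq]
  have h1 : HasDerivAt (fun t : ℝ => lineFamily Φ Ψ ((z, 0) + t • ((0 : Fin m → ℂ), (1 : ℝ))) x)
      _ 0 := (hfam.hasFDerivAt hU hq x).hasLineDerivAt (0, 1)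
  have h2 : HasDerivAt (fun t : ℝ => Φ z x + t * Ψ z x) (Ψ z x) 0 := by
    simpa using ((hasDerivAt_id (0 : ℝ)).mul_const (Ψ z x)).const_add (Φ z x)
  refine h1.unique (h2.congr_of_eventuallyEq (Filter.Eventually.of_forall fun t => ?_))
  simp [lineFamily]

theorem totalDensity_congr {Φ Φ' : (Fin m → ℂ) → Smooth n X} {z : Fin m → ℂ}
    (h : Φ =ᶠ[nhds z] Φ') : K.totalDensity α Φ z = K.totalDensity α Φ' z := by
  simp only [KahlerForm.totalDensity, KahlerForm.density, smoothDeriv_congr h, h.eq_of_nhds]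

theorem energyDensity_congr {Φ Φ' : (Fin m → ℂ) → Smooth n X} {z : Fin m → ℂ}
    (h : Φ =ᶠ[nhds z] Φ') : K.energyDensity Φ z = K.energyDensity Φ' z := by
  have hr : ∀ v, realDeriv Φ v z = realDeriv Φ' v z := fun v => by
    ext x
    have : (fun w => Φ w x) =ᶠ[nhds z] fun w => Φ' w x := by
      filter_upwards [h] with w' hw'
      rw [hw']
    exact congrArg (fun L : (Fin m → ℂ) →L[ℝ] ℝ => L v) this.fderiv_eq
  simp only [KahlerForm.energyDensity, hr, h.eq_of_nhds]

theorem variation_eventuallyEq (hC : IsCompact C) (hΨ0 : ∀ z ∉ C, Ψ z = 0) (t : ℝ)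
    {z : Fin m → ℂ} (hz : z ∉ C) : (fun z => Φ z + t • Ψ z) =ᶠ[nhds z] Φ := by
  filter_upwards [hC.isClosed.isOpen_compl.mem_nhds hz] with w hw
  rw [hΨ0 w hw, smul_zero, add_zero]

theorem continuousOn_energyDensity (hΦ : SmoothFam n D fun z => Φ z) (hD : IsOpen D)
    (hpot : ∀ z ∈ D, Φ z ∈ K.potentials) : ContinuousOn (K.energyDensity Φ) D := by
  refine ContinuousOn.congr (continuousOn_finsetSum Finset.univ fun j _ => ?_)
    fun z hz => energyDensity_eq hΦ hD hz
  exact (continuousOn_mabuchi K hD hΦ hpot (hΦ.smoothDeriv hD _) (hΦ.smoothDeriv hD _)).add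
    (continuousOn_mabuchi K hD hΦ hpot (hΦ.smoothDeriv hD _) (hΦ.smoothDeriv hD _))

/-- One ε serves for all z: compactness covers C, and off C the family is Φ itself. -/
theorem exists_variation_mem (hC : IsCompact C) (hD : IsOpen D) (hCD : C ⊆ D)
    (hΦ : SmoothFam n D fun z => Φ z) (hpot : ∀ z ∈ D, Φ z ∈ K.potentials)
    (hΨ : SmoothFam n Set.univ fun z => Ψ z) (hΨ0 : ∀ z ∉ C, Ψ z = 0) :
    ∃ ε > 0, D ×ˢ Set.Ioo (-ε) ε
      ⊆ {q : (Fin m → ℂ) × ℝ | q.1 ∈ D ∧ lineFamily Φ Ψ q ∈ K.potentials} := by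
  have hW := isOpen_lineFamily_potentials (K := K) hD hΦ hΨ
  have hev := hC.eventually_forall_of_forall_eventually (x₀ := (0 : ℝ))
    (P := fun t z => lineFamily Φ Ψ (z, t) ∈ K.potentials) fun z hz => by
      have h1 : (z, (0 : ℝ)) ∈ {q : (Fin m → ℂ) × ℝ | q.1 ∈ D ∧ lineFamily Φ Ψ q ∈ K.potentials} :=
        ⟨hCD hz, by rw [lineFamily_zero]; exact hpot z (hCD hz)⟩
      have h2 : ContinuousAt (fun q : ℝ × (Fin m → ℂ) => (q.2, q.1)) (0, z) := by fun_prop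
      filter_upwards [h2.eventually (hW.mem_nhds h1)] with q hq using hq.2
  obtain ⟨ε, hε, h⟩ := Metric.eventually_nhds_iff.1 hev
  refine ⟨ε, hε, ?_⟩
  rintro ⟨z, t⟩ ⟨hz, ht⟩
  refine ⟨hz, ?_⟩
  by_cases hzC : z ∈ C
  · exact h (by rw [Real.dist_eq, sub_zero]; exact abs_lt.2 ht) z hzC
  · rw [lineFamily, hΨ0 z hzC, smul_zero, add_zero]
    exact hpot z hz

/-- The first variation of the perturbed energy. -/
theorem hasDerivAt_perturbedEnergy (hα : IsTwoForm K α)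
    (hdα : ∀ φ ∈ K.potentials, ∀ ξ₁ ξ₂ ξ₃ : Smooth n X, extD α φ ξ₁ ξ₂ ξ₃ = K.theta φ ξ₁ ξ₂ ξ₃)
    (hD : IsOpen D) (hΦ : SmoothFam n D fun z => Φ z) (hpot : ∀ z ∈ D, Φ z ∈ K.potentials)
    (hfin : K.EnergyDefined α D Φ) (hC : IsCompact C) (hCD : C ⊆ D)
    (hΨ : SmoothFam n Set.univ fun z => Ψ z) (hΨ0 : ∀ z ∉ C, Ψ z = 0) :
    HasDerivAt (fun t : ℝ => K.perturbedEnergy α D (fun z => Φ z + t • Ψ z))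
      ((∫ z in C, integralTop (K.perturb (Φ z)) (fun x => Ψ z x * K.realWzw Φ z x) : ℝ) : ℂ) 0 := by
  obtain ⟨ε, hε, hεW⟩ := exists_variation_mem hC hD hCD hΦ hpot hΨ hΨ0
  -- The open set of parameters (z, t) at which Φ + tΨ stays in H_ω; all smoothness and
  -- differentiation take place on it.
  set W := {q : (Fin m → ℂ) × ℝ | q.1 ∈ D ∧ lineFamily Φ Ψ q ∈ K.potentials} with hWdef
  have hW : IsOpen W := isOpen_lineFamily_potentials hD hΦ hΨ
  have hfam : SmoothFam n W fun q => lineFamily Φ Ψ q :=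
    (smoothFam_lineFamily hΦ hΨ).mono fun q hq => ⟨hq.1, Set.mem_univ _⟩
  have hfp : ∀ q ∈ W, lineFamily Φ Ψ q ∈ K.potentials := fun q hq => hq.2
  have hW0 : ∀ z ∈ D, (z, (0 : ℝ)) ∈ W := fun z hz => hεW ⟨hz, by simp [hε]⟩
  let h : (Fin m → ℂ) × ℝ → ℝ := fun q => ∑ j : Fin m,
    K.density α (lineFamily Φ Ψ) (Pi.single j 1, 0) (Pi.single j Complex.I, 0) q
  have hdens : ∀ z t, (z, t) ∈ W → h (z, t) = K.totalDensity α (fun z => Φ z + t • Ψ z) z := by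
    intro z t hq
    refine Finset.sum_congr rfl fun j _ => ?_
    simp only [KahlerForm.density, ← hfam.smoothDeriv_slice hW hq]
    rfl
  have hfam_t : ∀ t, SmoothFam n D fun z => (Φ z + t • Ψ z : Smooth n X) := fun t =>
    hΦ.add (SmoothFam.scalar_mul (c := fun _ => t) contDiffOn_const (hΨ.mono (Set.subset_univ D)))
  have hpot_t : ∀ t ∈ Set.Ioo (-ε) ε, ∀ z ∈ D, Φ z + t • Ψ z ∈ K.potentials := fun t ht z hz =>
    (hεW (show (z, t) ∈ D ×ˢ Set.Ioo (-ε) ε from ⟨hz, ht⟩)).2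
  have hjint := integrableOn_of_energyDefined hα hΦ hD hpot hfin
  have hS : Set.Ioo (-ε) ε ∈ nhds (0 : ℝ) := Ioo_mem_nhds (by linarith) hε
  -- For small t the energy is the integral of `h`. Its convergence for Φ + tΨ follows from that for
  -- Φ, since the integrands agree off C.
  have hE : (fun t : ℝ => K.perturbedEnergy α D (fun z => Φ z + t • Ψ z))
      =ᶠ[nhds 0] fun t => ((∫ z in D, h (z, t) : ℝ) : ℂ) := by
    filter_upwards [hS] with t ht
    rw [perturbedEnergy_eq hα (hfam_t t) hD (hpot_t t ht)]
    · rw [setIntegral_congr_fun hD.measurableSet fun z hz => (hdens z t (hεW ⟨hz, ht⟩)).symm]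
    · exact integrableOn_of_eq_off_compact hD hC hCD hfin.1
        (continuousOn_energyDensity (hfam_t t) hD (hpot_t t ht))
        fun z _ hzC => energyDensity_congr (variation_eventuallyEq hC hΨ0 t hzC)
    · intro j
      refine integrableOn_of_eq_off_compact hD hC hCD (hjint j)
        (hα.continuousOn_along hD (hfam_t t) (hpot_t t ht) ((hfam_t t).smoothDeriv hD _)
          ((hfam_t t).smoothDeriv hD _)) fun z _ hzC => ?_
      have := variation_eventuallyEq (Φ := Φ) hC hΨ0 t hzC
      rw [smoothDeriv_congr this, smoothDeriv_congr this, hΨ0 z hzC, smul_zero, add_zero]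
  have hLC : ∀ j ∈ (Finset.univ : Finset (Fin m)), LineC1 (K.density α (lineFamily Φ Ψ)
      (Pi.single j 1, 0) (Pi.single j Complex.I, 0)) W (0, 1) := fun j _ =>
    lineC1_density K hW hfam hfp hα _ _ _
  -- Off C the two maps agree near z, so all derivatives entering the density agree, for every t.
  have h0 : ∀ z ∈ D, z ∉ C → ∀ t, h (z, t) = h (z, 0) := by
    intro z hz hzC t
    have hmem : ∀ t, (z, t) ∈ W := fun t =>
      ⟨hz, by rw [lineFamily, hΨ0 z hzC, smul_zero, add_zero]; exact hpot z hz⟩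
    rw [hdens z t (hmem t), hdens z 0 (hmem 0),
      totalDensity_congr (variation_eventuallyEq hC hΨ0 t hzC),
      totalDensity_congr (variation_eventuallyEq hC hΨ0 0 hzC)]
  have hi : IntegrableOn (fun z => h (z, 0)) D := by
    have h1 : IntegrableOn (K.totalDensity α Φ) D := by
      have h2 : IntegrableOn (fun z => K.energyDensity Φ z + ∑ j : Fin m,
          2 * α (Φ z) (smoothDeriv Φ (Pi.single j 1) z)
            (smoothDeriv Φ (Pi.single j Complex.I) z)) D :=
        hfin.1.add (integrable_finsetSum _ fun j _ => (hjint j).const_mul 2)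
      exact h2.congr_fun (fun z hz => (totalDensity_eq hΦ hD hz).symm) hD.measurableSet
    refine h1.congr_fun (fun z hz => ?_) hD.measurableSet
    rw [hdens z 0 (hW0 z hz)]
    refine totalDensity_congr (Filter.Eventually.of_forall fun w => ?_)
    simp
  have hder := (hasDerivAt_integral_of_compact_variation (μ := volume) hD hC hCD hε hεW
    (LineC1.sum hLC) h0 hi).ofReal_comp
  refine (hder.congr_of_eventuallyEq hE).congr_deriv ?_
  congr 1
  -- The currents at t = 0. They contain Ψ linearly, so they vanish off C and their derivatives
  -- integrate to zero.
  let a : Fin m → (Fin m → ℂ) → ℝ := fun j z => K.currentU α (lineFamily Φ Ψ) (0, 1)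
    (Pi.single j 1, 0) (Pi.single j Complex.I, 0) (z, 0)
  let b : Fin m → (Fin m → ℂ) → ℝ := fun j z => K.currentV α (lineFamily Φ Ψ) (0, 1)
    (Pi.single j 1, 0) (Pi.single j Complex.I, 0) (z, 0)
  have ha : ∀ j, LineC1 (a j) D (Pi.single j 1) := fun j =>
    (lineC1_currentU K hW hfam hfp hα _ _ _).slice hW0
  have hb : ∀ j, LineC1 (b j) D (Pi.single j Complex.I) := fun j =>
    (lineC1_currentV K hW hfam hfp hα _ _ _).slice hW0
  have htime : ∀ z ∈ D, smoothDeriv (lineFamily Φ Ψ) (0, 1) (z, 0) = Ψ z := fun z hz =>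
    smoothDeriv_lineFamily_time hD hΦ hΨ hz
  have hmab0 : ∀ φ ξ : X → ℝ, K.mabuchi φ ξ 0 = 0 := fun φ ξ => by
    rw [KahlerForm.mabuchi, ← integralTop_zero K φ]
    exact integralTop_congr fun x => mul_zero _
  have ha0 : ∀ j, ∫ z in C, lineDeriv ℝ (a j) z (Pi.single j 1) = 0 := fun j =>
    integral_lineDeriv_eq_zero_of_compact hD hC hCD (ha j) fun z hz hzC => by
      simp [a, KahlerForm.currentU, htime z hz, hΨ0 z hzC, hmab0]
  have hb0 : ∀ j, ∫ z in C, lineDeriv ℝ (b j) z (Pi.single j Complex.I) = 0 := fun j =>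
    integral_lineDeriv_eq_zero_of_compact hD hC hCD (hb j) fun z hz hzC => by
      simp [b, KahlerForm.currentV, htime z hz, hΨ0 z hzC, hmab0]
  have hint : ∀ {f : (Fin m → ℂ) → ℝ}, ContinuousOn f D → IntegrableOn f C := fun hf =>
    (hf.mono hCD).integrableOn_compact hC
  have hEL := smoothFam_eulerLagrange K hD hΦ hpot
  have hN : ContinuousOn (fun z => integralTop (K.perturb (Φ z))
      (fun x => Ψ z x * K.realWzw Φ z x)) D :=
    SmoothFam.continuousOn_integralTop K hΦ hD ((hΨ.mono (Set.subset_univ _)).mul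
      (SmoothFam.sum fun j _ => hEL (Pi.single j 1) (Pi.single j Complex.I)))
  have hpt : ∀ z ∈ C, lineDeriv ℝ h (z, 0) (0, 1)
      = (∑ j, (lineDeriv ℝ (a j) z (Pi.single j 1) + lineDeriv ℝ (b j) z (Pi.single j Complex.I)))
        + integralTop (K.perturb (Φ z)) (fun x => Ψ z x * K.realWzw Φ z x) := by
    intro z hzC
    have hz := hCD hzC
    have hq := hW0 z hz
    have e1 : integralTop (K.perturb (Φ z)) (fun x => Ψ z x * K.realWzw Φ z x)
        = ∑ j : Fin m, integralTop (K.perturb (Φ z)) (fun x => Ψ z x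
          * K.eulerLagrange Φ (Pi.single j 1) (Pi.single j Complex.I) z x) := by
      rw [← integralTop_finsetSum K (Φ z) _ (f := fun j x => Ψ z x
          * K.eulerLagrange Φ (Pi.single j 1) (Pi.single j Complex.I) z x) fun j _ => (Ψ z).contMDiff.continuous.mul
        ((hEL (Pi.single j 1) (Pi.single j Complex.I)).slice hz).continuous]
      exact integralTop_congr fun x => Finset.mul_sum _ _ _
    rw [e1, ← Finset.sum_add_distrib, lineDeriv_sum hLC hq]
    refine Finset.sum_congr rfl fun j _ => ?_
    -- The first variation formula with τ = (0, 1), the time direction, along which the family has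
    -- derivative Ψ.
    rw [lineDeriv_density K hW hfam hfp hα hdα _ _ _ hq, lineDeriv_slice, lineDeriv_slice,
      htime z hz, lineFamily_zero, ← eulerLagrange_slice K hW hfam hq]
    simp only [lineFamily_zero]
  rw [setIntegral_congr_fun hC.measurableSet hpt, integral_add _ (hint hN), integral_finsetSum]
  · simp only [integral_add (hint (ha _).continuousOn_deriv) (hint (hb _).continuousOn_deriv),
      ha0, hb0, add_zero, Finset.sum_const_zero, zero_add]
  · exact fun j _ => (hint (ha j).continuousOn_deriv).add (hint (hb j).continuousOn_deriv)
  · exact integrable_finsetSum _ fun j _ =>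
      (hint (ha j).continuousOn_deriv).add (hint (hb j).continuousOn_deriv)

end Variations

/-! ### The fundamental lemma of the calculus of variations. -/

section Conclusion

open MeasureTheory

variable {n : ℕ} {X : Type*} [TopologicalSpace X] [ChartedSpace (Fin n → ℂ) X]
  [IsManifold 𝓘(ℂ, Fin n → ℂ) ω X]

theorem SmoothFam.of_eq_zero {E : Type*} [NormedAddCommGroup E] [NormedSpace ℝ E] {D C : Set E}
    {f : E → X → ℝ} (hD : IsOpen D) (hC : IsClosed C) (hCD : C ⊆ D) (hf : SmoothFam n D f)
    (h0 : ∀ z ∉ C, f z = 0) : SmoothFam n Set.univ f := by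
  rintro p ⟨z, y⟩ ⟨-, hy⟩
  have hT := (chartAt (Fin n → ℂ) p).open_target
  refine ContDiffAt.contDiffWithinAt ?_
  by_cases hz : z ∈ C
  · exact (hf p).contDiffAt ((hD.prod hT).mem_nhds ⟨hCD hz, hy⟩)
  · refine (contDiffAt_const (c := (0 : ℝ))).congr_of_eventuallyEq ?_
    filter_upwards [(hC.isOpen_compl.prod hT).mem_nhds (x := (z, y)) ⟨hz, hy⟩] with q hq
    rw [h0 q.1 hq.1]
    rfl

variable [CompactSpace X] [T2Space X]

/-- A smooth field of functions on `X` which is orthogonal to all compactly supported variations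
vanishes. -/
theorem eq_zero_of_forall_variation {K : KahlerForm n X} {m : ℕ} {D : Set (Fin m → ℂ)}
    {Φ : (Fin m → ℂ) → Smooth n X} (hD : IsOpen D) (hΦ : SmoothFam n D fun z => Φ z)
    (hpot : ∀ z ∈ D, Φ z ∈ K.potentials) {F : (Fin m → ℂ) → X → ℝ} (hF : SmoothFam n D F)
    (h : ∀ (C : Set (Fin m → ℂ)) (Ψ : (Fin m → ℂ) → Smooth n X), IsCompact C → C ⊆ D →
      SmoothFam n Set.univ (fun z => Ψ z) → (∀ z ∉ C, Ψ z = 0) →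
      ∫ z in C, integralTop (K.perturb (Φ z)) (fun x => Ψ z x * F z x) = 0)
    {z : Fin m → ℂ} (hz : z ∈ D) (x : X) : F z x = 0 := by
  obtain ⟨r, hr, hrD⟩ := Metric.nhds_basis_closedBall.mem_iff.1 (hD.mem_nhds hz)
  -- The outer radius `r` keeps the support of χF in a compact ball inside D, so that χF extends by
  -- zero to a smooth variation.
  let χ : ContDiffBump z := ⟨r / 2, r, by linarith, by linarith⟩
  have hχ0 : ∀ w ∉ Metric.closedBall z r, χ w = 0 := fun w hw =>
    χ.zero_of_le_dist (by
      rw [Metric.mem_closedBall, not_le] at hw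
      exact hw.le)
  have hsm : SmoothFam n D fun w x => χ w * F w x :=
    SmoothFam.scalar_mul χ.contDiff.contDiffOn hF
  have hz0 : ∀ w ∉ Metric.closedBall z r, (fun x => χ w * F w x) = 0 := fun w hw => by
    ext x
    simp [hχ0 w hw]
  have huniv := hsm.of_eq_zero hD Metric.isClosed_closedBall hrD hz0
  have hcoe : ∀ w x, toSmooth n (fun x => χ w * F w x) x = χ w * F w x := fun w x =>
    toSmooth_apply (huniv.slice (Set.mem_univ w)) x
  have key := h (Metric.closedBall z r) (fun w => toSmooth n fun x => χ w * F w x)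
    (isCompact_closedBall z r) hrD huniv.toSmooth fun w hw => by
      ext x
      rw [hcoe]
      exact congrFun (hz0 w hw) x
  -- For the test function χF the integrand over D is χ G with G ≥ 0 continuous. It vanishes near z,
  -- and χ(z) = 1 gives G(z) = 0.
  set G : (Fin m → ℂ) → ℝ := fun w => integralTop (K.perturb (Φ w)) (fun x => F w x * F w x) with hG
  have hGc : ContinuousOn G D := SmoothFam.continuousOn_integralTop K hΦ hD (hF.mul hF)
  have hkey : ∀ w, integralTop (K.perturb (Φ w))
      (fun x => toSmooth n (fun x => χ w * F w x) x * F w x) = χ w * G w := fun w => by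
    rw [hG, ← integralTop_const_mul]
    refine integralTop_congr fun x => ?_
    rw [hcoe]
    ring
  simp only [hkey] at key
  have hnn : ∀ w ∈ D, 0 ≤ G w := fun w hw =>
    integralTop_nonneg K (hpot w hw) fun x => mul_self_nonneg _
  have hc : ContinuousOn (fun w => χ w * G w) D := χ.continuous.continuousOn.mul hGc
  have hae := (setIntegral_eq_zero_iff_of_nonneg_ae
    ((ae_restrict_mem Metric.isClosed_closedBall.measurableSet).mono fun w hw =>
      mul_nonneg χ.nonneg (hnn w (hrD hw)))
    ((hc.mono hrD).integrableOn_compact (isCompact_closedBall z r))).1 key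
  have heq := Measure.eqOn_open_of_ae_eq
    (ae_mono (Measure.restrict_mono Metric.ball_subset_closedBall le_rfl) hae) Metric.isOpen_ball
    (hc.mono (Metric.ball_subset_closedBall.trans hrD)) continuousOn_const
  have h1 : χ z = 1 := χ.one_of_mem_closedBall (Metric.mem_closedBall_self (by positivity))
  have h2 := heq (Metric.mem_ball_self hr)
  simp only [h1, one_mul, Pi.zero_apply] at h2
  exact mul_self_eq_zero.1 (eq_zero_of_integralTop_eq_zero K (hpot z hz)
    ((hF.mul hF).slice hz).continuous (fun x => mul_self_nonneg _) h2 x)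

end Conclusion

end WZW

end

theorem mainTheorem7 {m n : ℕ} {X : Type*} [TopologicalSpace X] [ChartedSpace (Fin n → ℂ) X]
    [IsManifold 𝓘(ℂ, Fin n → ℂ) ω X] [CompactSpace X] [T2Space X]
    (K : WZW.KahlerForm n X)
    (α : WZW.FormField n X) (hα : WZW.IsTwoForm K α)
    (hdα : ∀ φ ∈ K.potentials, ∀ ξ₁ ξ₂ ξ₃ : WZW.Smooth n X,
      WZW.extD α φ ξ₁ ξ₂ ξ₃ = K.theta φ ξ₁ ξ₂ ξ₃)
    (D : Set (Fin m → ℂ)) (hD : IsOpen D)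
    (Φ : (Fin m → ℂ) → WZW.Smooth n X) (hΦ : WZW.SmoothInto D Φ)
    (hΦH : ∀ z ∈ D, Φ z ∈ K.potentials) (hfin : K.EnergyDefined α D Φ) :
    K.IsCritical α D Φ ↔ ∀ z ∈ D, ∀ x : X, K.wzw Φ z x = 0 := by
  have hfam : WZW.SmoothFam n D fun z => Φ z := WZW.smoothFam_of_contMDiffOn hΦ
  have hEL : WZW.SmoothFam n D (K.realWzw Φ) := WZW.SmoothFam.sum fun j _ =>
    WZW.smoothFam_eulerLagrange K hD hfam hΦH (Pi.single j 1) (Pi.single j Complex.I)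
  have hiff : ∀ z ∈ D, ∀ x, K.wzw Φ z x = 0 ↔ K.realWzw Φ z x = 0 := fun z hz x => by
    rw [WZW.wzw_eq hfam hD hΦH hz]
    simp
  constructor
  · intro hcrit z hz x
    rw [hiff z hz x]
    refine WZW.eq_zero_of_forall_variation hD hfam hΦH hEL (fun C Ψ hC hCD hΨ hΨ0 => ?_) hz x
    have h1 := hcrit Ψ ⟨hΨ.contMDiffOn isOpen_univ, C, hCD, hC, hΨ0⟩
    have h2 := WZW.hasDerivAt_perturbedEnergy hα hdα hD hfam hΦH hfin hC hCD hΨ hΨ0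
    -- Uniqueness of the derivative makes the first variation, a real number cast to ℂ, equal to 0.
    exact_mod_cast h2.unique h1
  · rintro hwzw Ψ ⟨hΨ, C, hCD, hC, hΨ0⟩
    have h2 := WZW.hasDerivAt_perturbedEnergy hα hdα hD hfam hΦH hfin hC hCD
      (WZW.smoothFam_of_contMDiffOn (W := Set.univ) (F := fun z => Ψ z) hΨ) hΨ0
    -- By the equation the integrand of the first variation vanishes for every z in C.
    refine h2.congr_deriv ?_
    rw [MeasureTheory.setIntegral_congr_fun hC.measurableSet (g := fun _ => (0 : ℝ)) fun z hz => ?_]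
    · simp
    · rw [WZW.integralTop_congr (g := fun _ => 0) fun x => ?_, WZW.integralTop_zero]
      rw [(hiff z (hCD hz) x).1 (hwzw z (hCD hz) x), mul_zero]
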